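/- Let $K$ be an infinite field of arbitrary characteristic and let $m,r,s\ge 0$ be integers. Let $V=K^m$ with standard basis $v_1,\dots,v_m$, let $W=V^*$ with dual basis $v_1^*,\dots,v_m^*$, and let $T=V^{\otimes r}\otimes W^{\otimes s}$ with basis $v_I=v_{i_1}\otimes\cdots\otimes v_{i_r}\otimes v^*_{i_{r+1}}\otimes\cdots\otimes v^*_{i_{r+s}}$, $I=(i_1,\dots,i_{r+s})\in\{1,\dots,m\}^{r+s}$. Let $c_{ij}$ be the entries of the generic matrix $C$ over $K[GL(m)]=K[c_{ij}]_{\det}$ and $d_{ij}$ the entries of $C^{-1}$. The distribution algebra $\mathrm{Dist}(GL(m))$ (the linear forms on $K[GL(m)]$ vanishing on a power of the ideal of the identity element, with convolution) acts on the $GL(m)$-module $T$; the image $S(m,r,s)\subseteq \mathrm{End}_K(T)$ is the rational Schur algebra. The walled Brauer algebra $B_{r,s}(\delta)$ with $\delta=m$ (basis: the walled Brauer diagrams; product $\sigma\tau=\delta^t\,\sigma\circ\tau$, where $\sigma$ is placed under $\tau$ and $t$ is the number of internal cycles) acts on $T$ from the right: $v_I\sigma$ is the sum of all $v_J$ such that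 labelling the lower row of $\sigma$ by $I$ and the upper row by $J$ gives equal labels at the two ends of every edge. Let $E=\mathrm{End}_{B_{r,s}(\delta)}(T)\subseteq\mathrm{End}_K(T)$. For $\phi\in\mathrm{End}_K(T)$ let $x_{IJ}(\phi)$ be the coefficient of $v_I$ in $\phi(v_J)$. Then: 1. The homomorphism $\mathrm{Dist}(GL(m))\to E$ is surjective, that is, $S(m,r,s)=E$ as subalgebras of $\mathrm{End}_K(T)$ (maps written on the left). Moreover $S(m,r,s)\simeq E^{op}$ as $K$-algebras. 2. Let $F=F_1\otimes_K F_2$, where $F_1$ is the span of the monomials of degree $r$ in the free algebra on generators $x_{ij}$ and $F_2$ is the span of the monomials of degree $s$ in the free algebra on generators $x^*_{ij}$, $1\le i,j\le m$. Let $Y\subseteq F$ be the subspace of the elements of $F$ lying in the two-sided ideal generated (in the tensor product of the two free algebras) by the relations $$x_{ij}x_{kl}=x_{kl}x_{ij},\qquad x^*_{ij}x^*_{kl}=x^*_{kl}x^*_{ij}\qquad\text{for all } i,j,k,l,$$ $$\sum_{k=1}^m x_{ki}x^*_{kj}=0,\qquad \sum_{k=1}^m x_{ik}x^*_{jk}=0\qquad\text{for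 } i\ne j,$$ $$\sum_{k=1}^m x_{ki}x^*_{ki}=\sum_{k=1}^m x_{jk}x^*_{jk}\qquad\text{for all } i,j.$$ There is a $K$-linear isomorphism $(E^{op})^*\simeq F/Y$ that maps the restriction of $x_{IJ}$ to the class of $x_{i_1j_1}\cdots x_{i_rj_r}\otimes x^*_{i_{r+1}j_{r+1}}\cdots x^*_{i_{r+s}j_{r+s}}$ for all $I,J$. 3. Let $A(m,r,s)\subseteq K[GL(m)]$ be the span of all products $\prod_{ij}c_{ij}^{a_{ij}}\prod_{ij}d_{ij}^{b_{ij}}$ with $a_{ij},b_{ij}\ge 0$, $\sum a_{ij}=r$, $\sum b_{ij}=s$. There is a $K$-linear isomorphism $F/Y\simeq A(m,r,s)$ that maps the class of $x_{i_1j_1}\cdots x_{i_rj_r}\otimes x^*_{i_{r+1}j_{r+1}}\cdots x^*_{i_{r+s}j_{r+s}}$ to $c_{j_1i_1}\cdots c_{j_ri_r}\,d_{i_{r+1}j_{r+1}}\cdots d_{i_{r+s}j_{r+s}}$ for all $I,J$. 4. $A(m,r,s)\simeq S(m,r,s)^*$ as $K$-spaces, through an isomorphism that identifies the restriction of $x_{IJ}$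 to $S(m,r,s)$ with the coefficient function $c_{i_1j_1}\cdots c_{i_rj_r}\,d_{j_{r+1}i_{r+1}}\cdots d_{j_{r+s}i_{r+s}}$ of $T$ for all $I,J$. -/

import Mathlib

namespace MixedSchurWeyl

open scoped TensorProduct
open Coalgebra Bialgebra

noncomputable section

/-! ### The coordinate algebra of the algebraic group `GL(m)` -/

/-- `K[GL(m)]`: the polynomial algebra on the entries of an `m × m` matrix, with the determinant
inverted. -/
def GLCoord (K : Type*) [Field K] (m : ℕ) : Type _ :=
  Localization.Away (Matrix.mvPolynomialX (Fin m) (Fin m) K).det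

instance (K : Type*) [Field K] (m : ℕ) : CommRing (GLCoord K m) :=
  inferInstanceAs (CommRing (Localization.Away (Matrix.mvPolynomialX (Fin m) (Fin m) K).det))

instance (K : Type*) [Field K] (m : ℕ) : Algebra K (GLCoord K m) :=
  inferInstanceAs (Algebra K (Localization.Away (Matrix.mvPolynomialX (Fin m) (Fin m) K).det))

instance (K : Type*) [Field K] (m : ℕ) :
    Algebra (MvPolynomial (Fin m × Fin m) K) (GLCoord K m) :=
  inferInstanceAs (Algebra (MvPolynomial (Fin m × Fin m) K)
    (Localization.Away (Matrix.mvPolynomialX (Fin m) (Fin m) K).det))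

instance (K : Type*) [Field K] (m : ℕ) :
    IsScalarTower K (MvPolynomial (Fin m × Fin m) K) (GLCoord K m) :=
  inferInstanceAs (IsScalarTower K (MvPolynomial (Fin m × Fin m) K)
    (Localization.Away (Matrix.mvPolynomialX (Fin m) (Fin m) K).det))

instance (K : Type*) [Field K] (m : ℕ) :
    IsLocalization.Away (Matrix.mvPolynomialX (Fin m) (Fin m) K).det (GLCoord K m) :=
  inferInstanceAs (IsLocalization.Away (Matrix.mvPolynomialX (Fin m) (Fin m) K).det
    (Localization.Away (Matrix.mvPolynomialX (Fin m) (Fin m) K).det))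

/-- The generic matrix `C = (c_{ij})`. -/
def cMat (K : Type*) [Field K] (m : ℕ) : Matrix (Fin m) (Fin m) (GLCoord K m) :=
  (Matrix.mvPolynomialX (Fin m) (Fin m) K).map
    (algebraMap (MvPolynomial (Fin m × Fin m) K) (GLCoord K m))

/-- The inverse `C⁻¹ = (d_{ij})` of the generic matrix. -/
def dMat (K : Type*) [Field K] (m : ℕ) : Matrix (Fin m) (Fin m) (GLCoord K m) :=
  (cMat K m)⁻¹

theorem isUnit_det_cMat (K : Type*) [Field K] (m : ℕ) : IsUnit (cMat K m).det := by
  have h := IsLocalization.Away.algebraMap_isUnit (S := GLCoord K m)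
    (Matrix.mvPolynomialX (Fin m) (Fin m) K).det
  rwa [RingHom.map_det] at h

/-- The universal property of `K[GL(m)]`: an invertible matrix over a commutative `K`-algebra `A`
is the image of the generic matrix under a unique algebra homomorphism. -/
def liftGL {K : Type*} [Field K] {m : ℕ} {A : Type*} [CommRing A] [Algebra K A]
    (M : Matrix (Fin m) (Fin m) A) (hM : IsUnit M.det) : GLCoord K m →ₐ[K] A :=
  IsLocalization.liftAlgHom (M := Submonoid.powers (Matrix.mvPolynomialX (Fin m) (Fin m) K).det)
    (f := MvPolynomial.aeval (R := K) fun p : Fin m × Fin m => M p.1 p.2) (by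
      rintro ⟨_, n, rfl⟩
      have h : (MvPolynomial.aeval (R := K) fun p : Fin m × Fin m => M p.1 p.2)
          (Matrix.mvPolynomialX (Fin m) (Fin m) K).det = M.det := by
        rw [AlgHom.map_det, Matrix.mvPolynomialX_mapMatrix_aeval]
      simp only [map_pow, h]
      exact hM.pow n)

theorem liftGL_cMat {K : Type*} [Field K] {m : ℕ} {A : Type*} [CommRing A] [Algebra K A]
    (M : Matrix (Fin m) (Fin m) A) (hM : IsUnit M.det) (i j : Fin m) :
    liftGL (K := K) M hM (cMat K m i j) = M i j := by
  simp [liftGL, cMat]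

theorem algHom_ext_GL {K : Type*} [Field K] {m : ℕ} {A : Type*} [CommRing A] [Algebra K A]
    {f g : GLCoord K m →ₐ[K] A} (h : ∀ i j, f (cMat K m i j) = g (cMat K m i j)) : f = g := by
  apply AlgHom.coe_ringHom_injective
  apply IsLocalization.ringHom_ext
    (Submonoid.powers (Matrix.mvPolynomialX (Fin m) (Fin m) K).det)
  apply MvPolynomial.ringHom_ext
  · intro k
    have e : algebraMap (MvPolynomial (Fin m × Fin m) K) (GLCoord K m) (MvPolynomial.C k)
        = algebraMap K (GLCoord K m) k :=
      (IsScalarTower.algebraMap_apply K (MvPolynomial (Fin m × Fin m) K) (GLCoord K m) k).symm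
    simp [e]
  · rintro ⟨i, j⟩
    exact h i j

/-- An algebra homomorphism carries `C⁻¹` to the inverse of the image of `C`. -/
theorem map_dMat {K : Type*} [Field K] {m : ℕ} {A : Type*} [CommRing A] [Algebra K A]
    (f : GLCoord K m →ₐ[K] A) (M N : Matrix (Fin m) (Fin m) A)
    (hM : ∀ i j, f (cMat K m i j) = M i j) (hN : M * N = 1) (i j : Fin m) :
    f (dMat K m i j) = N i j := by
  have h1 : f.mapMatrix (dMat K m) * f.mapMatrix (cMat K m) = 1 := by
    rw [← map_mul, dMat, Matrix.nonsing_inv_mul _ (isUnit_det_cMat K m), map_one]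
  have h2 : f.mapMatrix (cMat K m) = M := by
    ext i j; exact hM i j
  rw [h2] at h1
  have h3 : f.mapMatrix (dMat K m) = N := by
    calc f.mapMatrix (dMat K m) = f.mapMatrix (dMat K m) * (M * N) := by rw [hN, mul_one]
      _ = N := by rw [← mul_assoc, h1, one_mul]
  exact congrFun (congrFun h3 i) j

/-- The product of the two generic matrices of `K[GL(m)] ⊗ K[GL(m)]`. -/
def comulMat (K : Type*) [Field K] (m : ℕ) :
    Matrix (Fin m) (Fin m) (GLCoord K m ⊗[K] GLCoord K m) :=
  Matrix.of fun i j => ∑ k, cMat K m i k ⊗ₜ[K] cMat K m k j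

/-- The product of the inverses of the two generic matrices, in the opposite order. -/
def comulInvMat (K : Type*) [Field K] (m : ℕ) :
    Matrix (Fin m) (Fin m) (GLCoord K m ⊗[K] GLCoord K m) :=
  Matrix.of fun i j => ∑ k, dMat K m k j ⊗ₜ[K] dMat K m i k

theorem comulMat_mul_comulInvMat (K : Type*) [Field K] (m : ℕ) :
    comulMat K m * comulInvMat K m = 1 := by
  have hcd : cMat K m * dMat K m = 1 := Matrix.mul_nonsing_inv _ (isUnit_det_cMat K m)
  let L : GLCoord K m →ₐ[K] GLCoord K m ⊗[K] GLCoord K m := Algebra.TensorProduct.includeLeft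
  let R : GLCoord K m →ₐ[K] GLCoord K m ⊗[K] GLCoord K m := Algebra.TensorProduct.includeRight
  have h1 : comulMat K m = L.mapMatrix (cMat K m) * R.mapMatrix (cMat K m) := by
    ext i j
    simp [comulMat, Matrix.mul_apply, L, R]
  have h2 : comulInvMat K m = R.mapMatrix (dMat K m) * L.mapMatrix (dMat K m) := by
    ext i j
    simp [comulInvMat, Matrix.mul_apply, L, R]
  have hL : L.mapMatrix (cMat K m) * L.mapMatrix (dMat K m) = 1 := by
    rw [← map_mul, hcd, map_one]
  have hR : R.mapMatrix (cMat K m) * R.mapMatrix (dMat K m) = 1 := by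
    rw [← map_mul, hcd, map_one]
  calc comulMat K m * comulInvMat K m
      = L.mapMatrix (cMat K m) * (R.mapMatrix (cMat K m) * R.mapMatrix (dMat K m))
          * L.mapMatrix (dMat K m) := by rw [h1, h2]; simp only [mul_assoc]
    _ = 1 := by rw [hR, mul_one, hL]

theorem isUnit_det_comulMat (K : Type*) [Field K] (m : ℕ) : IsUnit (comulMat K m).det :=
  Matrix.isUnit_det_of_right_inverse (comulMat_mul_comulInvMat K m)

/-- The bialgebra structure of `K[GL(m)]`, dual to matrix multiplication:
`Δ(c_{ij}) = ∑ₖ c_{ik} ⊗ c_{kj}` and `ε(c_{ij}) = δ_{ij}`. -/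
instance (K : Type*) [Field K] (m : ℕ) : Bialgebra K (GLCoord K m) :=
  Bialgebra.ofAlgHom
    (liftGL (comulMat K m) (isUnit_det_comulMat K m))
    (liftGL (1 : Matrix (Fin m) (Fin m) K) (by simp))
    (by
      apply algHom_ext_GL
      intro i j
      simp only [AlgHom.comp_apply, liftGL_cMat, comulMat, Matrix.of_apply, map_sum,
        Algebra.TensorProduct.map_tmul, AlgHom.id_apply, TensorProduct.sum_tmul,
        TensorProduct.tmul_sum, AlgEquiv.coe_toAlgHom, Algebra.TensorProduct.assoc_tmul]
      rw [Finset.sum_comm])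
    (by
      apply algHom_ext_GL
      intro i j
      simp [liftGL_cMat, comulMat, Matrix.one_apply, TensorProduct.ite_tmul,
        Algebra.TensorProduct.lid_symm_apply])
    (by
      apply algHom_ext_GL
      intro i j
      simp [liftGL_cMat, comulMat, Matrix.one_apply, TensorProduct.tmul_ite])

theorem comul_cMat (K : Type*) [Field K] (m : ℕ) (i j : Fin m) :
    comul (R := K) (cMat K m i j) = ∑ k, cMat K m i k ⊗ₜ[K] cMat K m k j :=
  liftGL_cMat (comulMat K m) (isUnit_det_comulMat K m) i j

theorem counit_cMat (K : Type*) [Field K] (m : ℕ) (i j : Fin m) :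
    counit (R := K) (cMat K m i j) = (1 : Matrix (Fin m) (Fin m) K) i j :=
  liftGL_cMat (1 : Matrix (Fin m) (Fin m) K) (by simp) i j

theorem comul_dMat (K : Type*) [Field K] (m : ℕ) (i j : Fin m) :
    comul (R := K) (dMat K m i j) = ∑ k, dMat K m k j ⊗ₜ[K] dMat K m i k :=
  map_dMat (comulAlgHom K (GLCoord K m)) (comulMat K m) (comulInvMat K m)
    (comul_cMat K m) (comulMat_mul_comulInvMat K m) i j

theorem counit_dMat (K : Type*) [Field K] (m : ℕ) (i j : Fin m) :
    counit (R := K) (dMat K m i j) = (1 : Matrix (Fin m) (Fin m) K) i j :=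
  map_dMat (counitAlgHom K (GLCoord K m)) 1 1 (counit_cMat K m) (one_mul 1) i j

/-! ### The distribution algebra of `GL(m)` -/

/-- The ideal of the identity element of `GL(m)`: the functions vanishing there. -/
def augIdeal (K : Type*) [Field K] (m : ℕ) : Ideal (GLCoord K m) :=
  RingHom.ker (counitAlgHom K (GLCoord K m))

theorem comul_mem_of_mem_augIdeal (K : Type*) [Field K] (m : ℕ) {f : GLCoord K m}
    (hf : f ∈ augIdeal K m) :
    comulAlgHom K (GLCoord K m) f ∈
      (augIdeal K m).map (Algebra.TensorProduct.includeLeft :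
          GLCoord K m →ₐ[K] GLCoord K m ⊗[K] GLCoord K m) ⊔
        (augIdeal K m).map (Algebra.TensorProduct.includeRight :
          GLCoord K m →ₐ[K] GLCoord K m ⊗[K] GLCoord K m) := by
  set J := (augIdeal K m).map (Algebra.TensorProduct.includeLeft :
          GLCoord K m →ₐ[K] GLCoord K m ⊗[K] GLCoord K m) ⊔
        (augIdeal K m).map (Algebra.TensorProduct.includeRight :
          GLCoord K m →ₐ[K] GLCoord K m ⊗[K] GLCoord K m) with hJ
  have hmem : ∀ i j, cMat K m i j - algebraMap K _ ((1 : Matrix (Fin m) (Fin m) K) i j)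
      ∈ augIdeal K m := by
    intro i j
    rw [augIdeal, RingHom.mem_ker, map_sub, AlgHom.commutes]
    exact sub_eq_zero.mpr (counit_cMat K m i j)
  have hL : ∀ i j, Ideal.Quotient.mkₐ K J (cMat K m i j ⊗ₜ[K] 1) =
      algebraMap K _ ((1 : Matrix (Fin m) (Fin m) K) i j) := by
    intro i j
    rw [← AlgHom.commutes (Ideal.Quotient.mkₐ K J), ← sub_eq_zero, ← map_sub]
    refine Ideal.Quotient.eq_zero_iff_mem.mpr (hJ ▸ Ideal.mem_sup_left ?_)
    have := Ideal.mem_map_of_mem (Algebra.TensorProduct.includeLeft :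
          GLCoord K m →ₐ[K] GLCoord K m ⊗[K] GLCoord K m) (hmem i j)
    simpa only [map_sub, AlgHom.commutes, Algebra.TensorProduct.includeLeft_apply] using this
  have hR : ∀ i j, Ideal.Quotient.mkₐ K J (1 ⊗ₜ[K] cMat K m i j) =
      algebraMap K _ ((1 : Matrix (Fin m) (Fin m) K) i j) := by
    intro i j
    rw [← AlgHom.commutes (Ideal.Quotient.mkₐ K J), ← sub_eq_zero, ← map_sub]
    refine Ideal.Quotient.eq_zero_iff_mem.mpr (hJ ▸ Ideal.mem_sup_right ?_)
    have := Ideal.mem_map_of_mem (Algebra.TensorProduct.includeRight :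
          GLCoord K m →ₐ[K] GLCoord K m ⊗[K] GLCoord K m) (hmem i j)
    simpa only [map_sub, AlgHom.commutes, Algebra.TensorProduct.includeRight_apply] using this
  have key : (Ideal.Quotient.mkₐ K J).comp (comulAlgHom K (GLCoord K m)) =
      (Algebra.ofId K _).comp (counitAlgHom K (GLCoord K m)) := by
    apply algHom_ext_GL
    intro i j
    have e : ∀ k, cMat K m i k ⊗ₜ[K] cMat K m k j =
        (cMat K m i k ⊗ₜ[K] (1 : GLCoord K m)) * ((1 : GLCoord K m) ⊗ₜ[K] cMat K m k j) := by
      intro k; simp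
    simp only [AlgHom.comp_apply, comulAlgHom_apply, counitAlgHom_apply, comul_cMat, counit_cMat,
      map_sum, Algebra.ofId_apply]
    simp only [e, map_mul, hL, hR]
    simp only [← map_mul, ← map_sum, ← Matrix.mul_apply, one_mul]
  have h2 := DFunLike.congr_fun key f
  have h3 : counitAlgHom K (GLCoord K m) f = 0 := hf
  rw [AlgHom.comp_apply, AlgHom.comp_apply, h3, map_zero] at h2
  exact Ideal.Quotient.eq_zero_iff_mem.mp h2

/-- `Dist(GL(m))`: the linear forms on `K[GL(m)]` that vanish on some power of the ideal of the
identity element, with the convolution product `(μν)(f) = (μ ⊗ ν)(Δ f)`. -/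
def Dist (K : Type*) [Field K] (m : ℕ) : Subalgebra K (WithConv (GLCoord K m →ₗ[K] K)) where
  carrier := {μ | ∃ n : ℕ, ∀ f ∈ augIdeal K m ^ (n + 1), μ f = 0}
  mul_mem' := by
    rintro μ ν ⟨a, ha⟩ ⟨b, hb⟩
    refine ⟨a + b + 1, fun f hf => ?_⟩
    set IL := (augIdeal K m).map (Algebra.TensorProduct.includeLeft :
          GLCoord K m →ₐ[K] GLCoord K m ⊗[K] GLCoord K m) with hIL
    set IR := (augIdeal K m).map (Algebra.TensorProduct.includeRight :
          GLCoord K m →ₐ[K] GLCoord K m ⊗[K] GLCoord K m) with hIR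
    have h1 : comulAlgHom K (GLCoord K m) f ∈ (IL ⊔ IR) ^ (a + b + 1 + 1) := by
      have h2 : augIdeal K m ≤ (IL ⊔ IR).comap (comulAlgHom K (GLCoord K m)) :=
        fun x hx => comul_mem_of_mem_augIdeal K m hx
      have h3 := Ideal.pow_right_mono h2 (a + b + 1 + 1) hf
      exact Ideal.le_comap_pow _ _ h3
    have h2 : comulAlgHom K (GLCoord K m) f ∈ IL ^ (a + 1) ⊔ IR ^ (b + 1) := by
      have e : a + b + 1 + 1 = (a + 1) + (b + 1) := by ring
      rw [e] at h1
      exact Ideal.sup_pow_add_le_pow_sup_pow h1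
    have hL : ∀ x ∈ IL ^ (a + 1),
        LinearMap.mul' K K (TensorProduct.map μ.ofConv ν.ofConv x) = 0 := by
      intro x hx
      rw [hIL, ← Ideal.map_pow] at hx
      refine Submodule.span_induction (p := fun x _ =>
        ∀ y, LinearMap.mul' K K (TensorProduct.map μ.ofConv ν.ofConv (y * x)) = 0)
        ?_ ?_ ?_ ?_ hx 1 |> (by simpa using ·)
      · rintro _ ⟨g, hg, rfl⟩ y
        induction y using TensorProduct.induction_on with
        | zero => simp
        | add y z hy hz => rw [add_mul, map_add, map_add, hy, hz, add_zero]
        | tmul y z =>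
          have : μ.ofConv (y * g) = 0 := ha _ (Ideal.mul_mem_left _ y hg)
          simp [this]
      · simp
      · intro x y _ _ hx hy z
        rw [mul_add, map_add, map_add, hx, hy, add_zero]
      · intro c x _ hx y
        rw [smul_eq_mul, ← mul_assoc]
        exact hx _
    have hR : ∀ x ∈ IR ^ (b + 1),
        LinearMap.mul' K K (TensorProduct.map μ.ofConv ν.ofConv x) = 0 := by
      intro x hx
      rw [hIR, ← Ideal.map_pow] at hx
      refine Submodule.span_induction (p := fun x _ =>
        ∀ y, LinearMap.mul' K K (TensorProduct.map μ.ofConv ν.ofConv (y * x)) = 0)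
        ?_ ?_ ?_ ?_ hx 1 |> (by simpa using ·)
      · rintro _ ⟨g, hg, rfl⟩ y
        induction y using TensorProduct.induction_on with
        | zero => simp
        | add y z hy hz => rw [add_mul, map_add, map_add, hy, hz, add_zero]
        | tmul y z =>
          have : ν.ofConv (z * g) = 0 := hb _ (Ideal.mul_mem_left _ z hg)
          simp [this]
      · simp
      · intro x y _ _ hx hy z
        rw [mul_add, map_add, map_add, hx, hy, add_zero]
      · intro c x _ hx y
        rw [smul_eq_mul, ← mul_assoc]
        exact hx _
    obtain ⟨x, hx, y, hy, hxy⟩ := Submodule.mem_sup.mp h2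
    rw [LinearMap.convMul_apply, ← comulAlgHom_apply, ← hxy, map_add, map_add, hL x hx, hR y hy,
      add_zero]
  add_mem' := by
    rintro μ ν ⟨a, ha⟩ ⟨b, hb⟩
    refine ⟨a + b, fun f hf => ?_⟩
    have h1 : μ f = 0 := ha f (Ideal.pow_le_pow_right (by omega) hf)
    have h2 : ν f = 0 := hb f (Ideal.pow_le_pow_right (by omega) hf)
    rw [WithConv.ofConv_add, LinearMap.add_apply, h1, h2, add_zero]
  algebraMap_mem' := by
    intro k
    refine ⟨0, fun f hf => ?_⟩
    have h : counitAlgHom K (GLCoord K m) f = 0 := by simpa [augIdeal] using hf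
    rw [counitAlgHom_apply] at h
    rw [LinearMap.convAlgebraMap_apply, h, map_zero, smul_zero]

/-! ### The mixed tensor space and the action of the distribution algebra -/

/-- The mixed tensor space `V^{⊗r} ⊗ W^{⊗s}`, where `V = K^m` and `W = V^*`. -/
abbrev MixedTensor (K : Type*) [Field K] (m r s : ℕ) : Type _ :=
  (PiTensorProduct K fun _ : Fin r => (Fin m → K)) ⊗[K]
    (PiTensorProduct K fun _ : Fin s => Module.Dual K (Fin m → K))

/-- Multi-indices `I = (I_V, I_W)` of length `r + s` with entries in `{1, …, m}`. -/
abbrev MultiIndex (m r s : ℕ) : Type := (Fin r → Fin m) × (Fin s → Fin m)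

/-- The basis `v_I = v_{i_1} ⊗ ⋯ ⊗ v_{i_r} ⊗ v^*_{i_{r+1}} ⊗ ⋯ ⊗ v^*_{i_{r+s}}` of the mixed tensor
space. -/
def mixedBasis (K : Type*) [Field K] (m r s : ℕ) :
    Module.Basis (MultiIndex m r s) K (MixedTensor K m r s) :=
  (Basis.piTensorProduct fun _ : Fin r => Pi.basisFun K (Fin m)).tensorProduct
    (Basis.piTensorProduct fun _ : Fin s => (Pi.basisFun K (Fin m)).dualBasis)

/-- The coefficient functions of the `GL(m)`-module `V^{⊗r} ⊗ W^{⊗s}`. Since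
`g v_j = ∑ᵢ c_{ij}(g) v_i` and `g v^*_j = v^*_j ∘ g⁻¹ = ∑ᵢ d_{ji}(g) v^*_i`, one has
`g v_J = ∑_I (mixedCoeff I J)(g) v_I`. -/
def mixedCoeff (K : Type*) [Field K] (m r s : ℕ) (I J : MultiIndex m r s) : GLCoord K m :=
  (∏ a, cMat K m (I.1 a) (J.1 a)) * ∏ b, dMat K m (J.2 b) (I.2 b)

theorem prod_sum_tmul (K : Type*) [Field K] {A : Type*} [CommRing A] [Algebra K A] {n m : ℕ}
    (f g : Fin n → Fin m → A) :
    ∏ a, ∑ k, f a k ⊗ₜ[K] g a k = ∑ l : Fin n → Fin m, (∏ a, f a (l a)) ⊗ₜ[K] ∏ a, g a (l a) := by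
  rw [Fintype.prod_sum]
  refine Finset.sum_congr rfl fun l _ => ?_
  induction (Finset.univ : Finset (Fin n)) using Finset.induction_on with
  | empty => simp [Algebra.TensorProduct.one_def]
  | insert a t ha ih =>
    rw [Finset.prod_insert ha, Finset.prod_insert ha, Finset.prod_insert ha, ih,
      Algebra.TensorProduct.tmul_mul_tmul]

theorem comul_mixedCoeff (K : Type*) [Field K] (m r s : ℕ) (I J : MultiIndex m r s) :
    comul (R := K) (mixedCoeff K m r s I J) =
      ∑ L, mixedCoeff K m r s I L ⊗ₜ[K] mixedCoeff K m r s L J := by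
  rw [← comulAlgHom_apply, mixedCoeff, map_mul, map_prod, map_prod]
  simp only [comulAlgHom_apply, comul_cMat, comul_dMat]
  rw [prod_sum_tmul, prod_sum_tmul, Finset.sum_mul_sum, Fintype.sum_prod_type]
  simp only [Algebra.TensorProduct.tmul_mul_tmul, mixedCoeff]

theorem counit_mixedCoeff (K : Type*) [Field K] (m r s : ℕ) (I J : MultiIndex m r s) :
    counit (R := K) (mixedCoeff K m r s I J) =
      (1 : Matrix (MultiIndex m r s) (MultiIndex m r s) K) I J := by
  rw [← counitAlgHom_apply, mixedCoeff, map_mul, map_prod, map_prod]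
  simp only [counitAlgHom_apply, counit_cMat, counit_dMat, Matrix.one_apply]
  rw [Finset.prod_ite_zero, Finset.prod_ite_zero]
  have h1 : (∀ a ∈ Finset.univ, I.1 a = J.1 a) ↔ I.1 = J.1 := by simp [funext_iff]
  have h2 : (∀ b ∈ Finset.univ, J.2 b = I.2 b) ↔ I.2 = J.2 := by simp [funext_iff, eq_comm]
  simp only [h1, h2, Finset.prod_const_one, Prod.ext_iff]
  by_cases h3 : I.1 = J.1 <;> by_cases h4 : I.2 = J.2 <;> simp [h3, h4]

/-- The action of `Dist(GL(m))` on the mixed tensor space, an algebra homomorphism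
`Dist(GL(m)) → End_K(V^{⊗r} ⊗ W^{⊗s})`: a distribution `μ` acts by
`μ v_J = ∑_I μ(mixedCoeff I J) v_I`. -/
def distAction (K : Type*) [Field K] (m r s : ℕ) :
    Dist K m →ₐ[K] Module.End K (MixedTensor K m r s) :=
  ((Matrix.toLinAlgEquiv (mixedBasis K m r s)).toAlgHom.comp
    (AlgHom.ofLinearMap
      { toFun := fun μ : WithConv (GLCoord K m →ₗ[K] K) =>
          Matrix.of fun I J => μ (mixedCoeff K m r s I J)
        map_add' := fun μ ν => by ext I J; simp
        map_smul' := fun k μ => by ext I J; simp }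
      (by
        ext I J
        change (1 : WithConv (GLCoord K m →ₗ[K] K)) (mixedCoeff K m r s I J) = _
        rw [LinearMap.convOne_apply, counit_mixedCoeff]
        simp)
      (fun μ ν => by
        ext I J
        change (μ * ν) (mixedCoeff K m r s I J) = _
        rw [LinearMap.convMul_apply, comul_mixedCoeff, Matrix.mul_apply]
        simp))).comp (Dist K m).val

/-- The rational Schur algebra `S(m,r,s)`: the image of `Dist(GL(m))` in
`End_K(V^{⊗r} ⊗ W^{⊗s})`. -/
def rationalSchur (K : Type*) [Field K] (m r s : ℕ) :
    Subalgebra K (Module.End K (MixedTensor K m r s)) :=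
  (distAction K m r s).range

/-! ### The walled Brauer algebra -/

/-- The positions of the tensor factors: `r` factors on the left of the wall, `s` on the right. -/
abbrev Pos (r s : ℕ) : Type := Fin r ⊕ Fin s

/-- The vertices of a diagram: `Sum.inl x` is the upper vertex and `Sum.inr x` the lower vertex at
position `x`. -/
abbrev Vertex (r s : ℕ) : Type := Pos r s ⊕ Pos r s

/-- `true` on the upper vertices left of the wall and on the lower vertices right of the wall. -/
def side {r s : ℕ} : Vertex r s → Bool := Sum.elim Sum.isLeft Sum.isRight

/-- A walled Brauer diagram: each vertex is joined to exactly one other vertex, its `partner`. By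
`side_partner` a vertical edge stays on one side of the wall and a horizontal edge crosses it. -/
@[ext]
structure WalledDiagram (r s : ℕ) where
  partner : Vertex r s → Vertex r s
  partner_partner : ∀ v, partner (partner v) = v
  side_partner : ∀ v, side (partner v) = !side v

theorem WalledDiagram.partner_ne {r s : ℕ} (σ : WalledDiagram r s) (v : Vertex r s) :
    σ.partner v ≠ v := by
  intro h
  have h1 := σ.side_partner v
  rw [h] at h1
  cases h2 : side v <;> simp [h2] at h1

/-- The vertices of two stacked diagrams: `botV x`, `midV x` and `topV x` for each position `x`. -/
abbrev Stack (r s : ℕ) : Type := Pos r s ⊕ (Pos r s ⊕ Pos r s)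

abbrev botV {r s : ℕ} (x : Pos r s) : Stack r s := Sum.inl x
abbrev midV {r s : ℕ} (x : Pos r s) : Stack r s := Sum.inr (Sum.inl x)
abbrev topV {r s : ℕ} (x : Pos r s) : Stack r s := Sum.inr (Sum.inr x)

/-- The vertices of the lower diagram inside the stack. -/
def lowerEmb {r s : ℕ} : Vertex r s → Stack r s := Sum.elim midV botV

/-- The vertices of the upper diagram inside the stack. -/
def upperEmb {r s : ℕ} : Vertex r s → Stack r s := Sum.elim topV midV

/-- The boundary vertices of the stack, which are the vertices of the concatenation. -/
def bdryEmb {r s : ℕ} : Vertex r s → Stack r s := Sum.elim topV botV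

/-- The graph obtained by putting the diagram `σ` under the diagram `τ`. -/
def stackGraph {r s : ℕ} (σ τ : WalledDiagram r s) : SimpleGraph (Stack r s) :=
  SimpleGraph.fromRel fun u v =>
    (∃ w, u = lowerEmb w ∧ v = lowerEmb (σ.partner w)) ∨
    (∃ w, u = upperEmb w ∧ v = upperEmb (τ.partner w))

theorem lowerEmb_injective {r s : ℕ} : Function.Injective (lowerEmb (r := r) (s := s)) := by
  rintro (x | x) (y | y) h <;> simp_all [lowerEmb]

theorem upperEmb_injective {r s : ℕ} : Function.Injective (upperEmb (r := r) (s := s)) := by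
  rintro (x | x) (y | y) h <;> simp_all [upperEmb]

theorem stackGraph_adj_iff {r s : ℕ} (σ τ : WalledDiagram r s) (u v : Stack r s) :
    (stackGraph σ τ).Adj u v ↔
      (∃ w, u = lowerEmb w ∧ v = lowerEmb (σ.partner w)) ∨
      (∃ w, u = upperEmb w ∧ v = upperEmb (τ.partner w)) := by
  rw [stackGraph, SimpleGraph.fromRel_adj]
  constructor
  · rintro ⟨-, h | (⟨w, h1, h2⟩ | ⟨w, h1, h2⟩)⟩
    · exact h
    · exact Or.inl ⟨σ.partner w, h2, by rw [σ.partner_partner]; exact h1⟩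
    · exact Or.inr ⟨τ.partner w, h2, by rw [τ.partner_partner]; exact h1⟩
  · intro h
    refine ⟨?_, Or.inl h⟩
    rcases h with ⟨w, rfl, rfl⟩ | ⟨w, rfl, rfl⟩
    · exact fun h => σ.partner_ne w (lowerEmb_injective h).symm
    · exact fun h => τ.partner_ne w (upperEmb_injective h).symm

open Classical in
/-- Every component of the stack has as many boundary vertices on one side as on the other. -/
theorem sum_side_component {r s : ℕ} (σ τ : WalledDiagram r s)
    (C : (stackGraph σ τ).ConnectedComponent) :
    ∑ w : Vertex r s, (if (stackGraph σ τ).connectedComponentMk (bdryEmb w) = C then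
      (if side w then (1 : ℤ) else -1) else 0) = 0 := by
  let e : Vertex r s → ℤ := fun w => if side w then 1 else -1
  let g : Stack r s → ℤ → ℤ := fun u z =>
    if (stackGraph σ τ).connectedComponentMk u = C then z else 0
  have hg : ∀ u z, g u (-z) = -g u z := by
    intro u z
    simp only [g]
    split_ifs <;> simp
  have hσ : ∑ w : Vertex r s, g (lowerEmb w) (e w) = 0 := by
    refine Finset.sum_involution (fun w _ => σ.partner w) ?_ ?_ ?_ ?_
    · intro w _
      have h : (stackGraph σ τ).connectedComponentMk (lowerEmb (σ.partner w)) =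
          (stackGraph σ τ).connectedComponentMk (lowerEmb w) :=
        SimpleGraph.ConnectedComponent.sound
          ((stackGraph_adj_iff σ τ _ _).mpr (Or.inl ⟨w, rfl, rfl⟩)).reachable.symm
      simp only [g, e, h, σ.side_partner]
      cases side w <;> split_ifs <;> simp_all
    · intro w _ _
      exact σ.partner_ne w
    · intro w _
      exact Finset.mem_univ _
    · intro w _
      exact σ.partner_partner w
  have hτ : ∑ w : Vertex r s, g (upperEmb w) (e w) = 0 := by
    refine Finset.sum_involution (fun w _ => τ.partner w) ?_ ?_ ?_ ?_
    · intro w _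
      have h : (stackGraph σ τ).connectedComponentMk (upperEmb (τ.partner w)) =
          (stackGraph σ τ).connectedComponentMk (upperEmb w) :=
        SimpleGraph.ConnectedComponent.sound
          ((stackGraph_adj_iff σ τ _ _).mpr (Or.inr ⟨w, rfl, rfl⟩)).reachable.symm
      simp only [g, e, h, τ.side_partner]
      cases side w <;> split_ifs <;> simp_all
    · intro w _ _
      exact τ.partner_ne w
    · intro w _
      exact Finset.mem_univ _
    · intro w _
      exact τ.partner_partner w
  have he : ∀ x : Pos r s, e (Sum.inr x) = -e (Sum.inl x) := by
    rintro (x | x) <;> simp [e, side]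
  have hb : ∑ w : Vertex r s, g (bdryEmb w) (e w) = 0 := by
    rw [Fintype.sum_sum_type] at hσ hτ ⊢
    simp only [lowerEmb, upperEmb, bdryEmb, Sum.elim_inl, Sum.elim_inr, he, hg,
      Finset.sum_neg_distrib] at hσ hτ ⊢
    linarith
  exact hb

theorem bdryEmb_injective {r s : ℕ} : Function.Injective (bdryEmb (r := r) (s := s)) := by
  rintro (x | x) (y | y) h <;> simp_all [bdryEmb]

open Classical in
theorem stackGraph_degree_le {r s : ℕ} (σ τ : WalledDiagram r s) (u : Stack r s) :
    (stackGraph σ τ).degree u + (if u ∈ Set.range bdryEmb then 1 else 0) ≤ 2 := by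
  have hsub : ∀ t : Finset (Stack r s), (∀ v, (stackGraph σ τ).Adj u v → v ∈ t) →
      (stackGraph σ τ).degree u ≤ t.card := by
    intro t ht
    rw [← SimpleGraph.card_neighborFinset_eq_degree]
    refine Finset.card_le_card fun v hv => ht v ?_
    simpa using hv
  rcases u with x | x | x
  · have h := hsub {lowerEmb (σ.partner (Sum.inr x))} (by
      intro v hv
      rw [stackGraph_adj_iff] at hv
      rcases hv with ⟨w | w, h1, rfl⟩ | ⟨w | w, h1, rfl⟩ <;>
        simp [lowerEmb, upperEmb] at h1 <;> subst h1 <;> simp [lowerEmb, upperEmb])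
    rw [Finset.card_singleton] at h
    split_ifs <;> omega
  · have h := hsub {lowerEmb (σ.partner (Sum.inl x)), upperEmb (τ.partner (Sum.inr x))} (by
      intro v hv
      rw [stackGraph_adj_iff] at hv
      rcases hv with ⟨w | w, h1, rfl⟩ | ⟨w | w, h1, rfl⟩ <;>
        simp [lowerEmb, upperEmb] at h1 <;> subst h1 <;> simp [lowerEmb, upperEmb])
    have h2 : (Sum.inr (Sum.inl x) : Stack r s) ∉ Set.range bdryEmb := by
      rintro ⟨w | w, hw⟩ <;> simp [bdryEmb] at hw
    rw [if_neg h2]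
    exact h.trans Finset.card_le_two
  · have h := hsub {upperEmb (τ.partner (Sum.inl x))} (by
      intro v hv
      rw [stackGraph_adj_iff] at hv
      rcases hv with ⟨w | w, h1, rfl⟩ | ⟨w | w, h1, rfl⟩ <;>
        simp [lowerEmb, upperEmb] at h1 <;> subst h1 <;> simp [lowerEmb, upperEmb])
    rw [Finset.card_singleton] at h
    split_ifs <;> omega

open Classical in
/-- A component of the stack has at most two boundary vertices. -/
theorem card_bdry_component_le {r s : ℕ} (σ τ : WalledDiagram r s)
    (C : (stackGraph σ τ).ConnectedComponent) :
    (Finset.univ.filter fun w : Vertex r s =>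
      (stackGraph σ τ).connectedComponentMk (bdryEmb w) = C).card ≤ 2 := by
  have hconn : C.toSimpleGraph.Connected := C.connected_toSimpleGraph
  have h1 := hconn.card_vert_le_card_edgeSet_add_one
  have h2 := C.toSimpleGraph.sum_degrees_eq_twice_card_edges
  have h3 : ∀ u : C, C.toSimpleGraph.degree u +
      (if (u : Stack r s) ∈ Set.range bdryEmb then 1 else 0) ≤ 2 := by
    intro u
    refine le_trans (Nat.add_le_add_right ?_ _) (stackGraph_degree_le σ τ u)
    rw [← SimpleGraph.card_neighborFinset_eq_degree, ← SimpleGraph.card_neighborFinset_eq_degree]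
    refine Finset.card_le_card_of_injOn (fun v => (v : Stack r s)) ?_
      Subtype.val_injective.injOn
    intro v hv
    have hv' : C.toSimpleGraph.Adj u v := by simpa using hv
    have : (stackGraph σ τ).Adj u v := hv'
    simpa using this
  have h4 : ∑ u : C, (C.toSimpleGraph.degree u +
      (if (u : Stack r s) ∈ Set.range bdryEmb then 1 else 0)) ≤ ∑ _u : C, 2 :=
    Finset.sum_le_sum fun u _ => h3 u
  rw [Finset.sum_add_distrib, h2, Finset.sum_const, Finset.card_univ, smul_eq_mul,
    ← Finset.card_filter] at h4
  rw [Nat.card_eq_fintype_card, Nat.card_eq_fintype_card, ← SimpleGraph.edgeFinset_card] at h1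
  have h5 : (Finset.univ.filter fun w : Vertex r s => (stackGraph σ τ).connectedComponentMk (bdryEmb w) = C).card
      ≤ (Finset.univ.filter fun u : C => (u : Stack r s) ∈ Set.range bdryEmb).card := by
    refine Finset.card_le_card_of_injOn
      (fun w => if h : (stackGraph σ τ).connectedComponentMk (bdryEmb w) = C then (⟨bdryEmb w, h⟩ : C)
        else ⟨C.out, C.out_eq⟩) ?_ ?_
    · intro w hw
      have hw' : (stackGraph σ τ).connectedComponentMk (bdryEmb w) = C := by simpa using hw
      simp only [hw', dif_pos, Finset.coe_filter, Finset.mem_univ, true_and, Set.mem_ofPred_eq]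
      exact ⟨w, rfl⟩
    · intro w hw v hv h
      have hw' : (stackGraph σ τ).connectedComponentMk (bdryEmb w) = C := by simpa using hw
      have hv' : (stackGraph σ τ).connectedComponentMk (bdryEmb v) = C := by simpa using hv
      simp only [hw', hv', dif_pos] at h
      exact bdryEmb_injective (congrArg Subtype.val h)
  omega

/-- In a stack every boundary vertex is connected to exactly one other boundary vertex. -/
theorem existsUnique_partner {r s : ℕ} (σ τ : WalledDiagram r s) (v : Vertex r s) :
    ∃ w, (w ≠ v ∧ (stackGraph σ τ).Reachable (bdryEmb v) (bdryEmb w) ∧ side w = !side v) ∧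
      ∀ w', w' ≠ v → (stackGraph σ τ).Reachable (bdryEmb v) (bdryEmb w') → w' = w := by
  classical
  obtain ⟨C, hC⟩ : ∃ C, C = (stackGraph σ τ).connectedComponentMk (bdryEmb v) := ⟨_, rfl⟩
  have hsum := sum_side_component σ τ C
  have hcard := card_bdry_component_le σ τ C
  have hex : ∃ w, (stackGraph σ τ).connectedComponentMk (bdryEmb w) = C ∧ side w = !side v := by
    by_contra hcon
    push Not at hcon
    have hs : ∀ w, (stackGraph σ τ).connectedComponentMk (bdryEmb w) = C → side w = side v := by
      intro w hw
      have := hcon w hw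
      cases h1 : side w <;> cases h2 : side v <;> simp_all
    have h1 : ∑ w : Vertex r s, (if (stackGraph σ τ).connectedComponentMk (bdryEmb w) = C then
        (if side w then (1 : ℤ) else -1) else 0) =
        ∑ w : Vertex r s, (if (stackGraph σ τ).connectedComponentMk (bdryEmb w) = C then
        (if side v then (1 : ℤ) else -1) else 0) := by
      refine Finset.sum_congr rfl fun w _ => ?_
      by_cases h : (stackGraph σ τ).connectedComponentMk (bdryEmb w) = C
      · rw [if_pos h, if_pos h, hs w h]
      · rw [if_neg h, if_neg h]
    rw [hsum, ← Finset.sum_filter, Finset.sum_const, nsmul_eq_mul] at h1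
    have h2 : 0 < (Finset.univ.filter fun w : Vertex r s =>
        (stackGraph σ τ).connectedComponentMk (bdryEmb w) = C).card :=
      Finset.card_pos.mpr ⟨v, by simp [hC]⟩
    rcases mul_eq_zero.mp h1.symm with h3 | h3
    · omega
    · split_ifs at h3 <;> simp at h3
  obtain ⟨w, hw, hs⟩ := hex
  have hne : w ≠ v := by
    rintro rfl
    cases h2 : side w <;> simp [h2] at hs
  refine ⟨w, ⟨hne, (SimpleGraph.ConnectedComponent.exact (hw.trans hC)).symm, hs⟩, ?_⟩
  intro w' hne' hw'
  by_contra hcon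
  have h3 : ({v, w, w'} : Finset (Vertex r s)) ⊆ Finset.univ.filter fun w : Vertex r s =>
      (stackGraph σ τ).connectedComponentMk (bdryEmb w) = C := by
    intro x hx
    simp only [Finset.mem_insert, Finset.mem_singleton] at hx
    rcases hx with rfl | rfl | rfl
    · simp [hC]
    · simp [hw]
    · simp only [Finset.mem_filter, Finset.mem_univ, true_and]
      exact (SimpleGraph.ConnectedComponent.sound hw').symm.trans hC.symm
  have h4 := Finset.card_le_card h3
  rw [Finset.card_eq_three.mpr ⟨v, w, w', hne.symm, hne'.symm, fun h => hcon h.symm, rfl⟩] at h4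
  omega

/-- The concatenation `σ ∘ τ` (`σ` under `τ`): two vertices are joined when they are connected
in the stack. -/
def WalledDiagram.comp {r s : ℕ} (σ τ : WalledDiagram r s) : WalledDiagram r s where
  partner v := (existsUnique_partner σ τ v).choose
  partner_partner v := by
    have h1 := (existsUnique_partner σ τ v).choose_spec
    have h2 := (existsUnique_partner σ τ (existsUnique_partner σ τ v).choose).choose_spec
    exact (h2.2 v h1.1.1.symm h1.1.2.1.symm).symm
  side_partner v := (existsUnique_partner σ τ v).choose_spec.1.2.2

/-- The number of internal cycles of the stack: the components without boundary vertices. -/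
def WalledDiagram.loops {r s : ℕ} (σ τ : WalledDiagram r s) : ℕ :=
  Nat.card {C : (stackGraph σ τ).ConnectedComponent //
    ∀ w, (stackGraph σ τ).connectedComponentMk (bdryEmb w) ≠ C}

theorem WalledDiagram.reachable_comp_partner {r s : ℕ} (σ τ : WalledDiagram r s)
    (v : Vertex r s) :
    (stackGraph σ τ).Reachable (bdryEmb v) (bdryEmb ((σ.comp τ).partner v)) :=
  (existsUnique_partner σ τ v).choose_spec.1.2.1

theorem WalledDiagram.eq_or_eq_partner {r s : ℕ} (σ τ : WalledDiagram r s) {v w : Vertex r s}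
    (h : (stackGraph σ τ).Reachable (bdryEmb v) (bdryEmb w)) :
    w = v ∨ w = (σ.comp τ).partner v := by
  by_cases hw : w = v
  · exact Or.inl hw
  · exact Or.inr ((existsUnique_partner σ τ v).choose_spec.2 w hw h)

/-- The labelling of the vertices of `σ` by `a` on the lower row and `b` on the upper row is
constant along the edges. -/
def WalledDiagram.Compat {r s : ℕ} {X : Type*} (σ : WalledDiagram r s) (a b : Pos r s → X) :
    Prop :=
  ∀ v, (Sum.elim b a : Vertex r s → X) (σ.partner v) = (Sum.elim b a : Vertex r s → X) v

theorem compat_iff_adj {r s : ℕ} {X : Type*} (σ τ : WalledDiagram r s) (a k b : Pos r s → X) :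
    (σ.Compat a k ∧ τ.Compat k b) ↔ ∀ u v, (stackGraph σ τ).Adj u v →
      (Sum.elim a (Sum.elim k b) : Stack r s → X) u = (Sum.elim a (Sum.elim k b)) v := by
  have hl : ∀ w : Vertex r s, (Sum.elim a (Sum.elim k b) : Stack r s → X) (lowerEmb w) =
      (Sum.elim k a : Vertex r s → X) w := by
    rintro (w | w) <;> simp [lowerEmb]
  have hu : ∀ w : Vertex r s, (Sum.elim a (Sum.elim k b) : Stack r s → X) (upperEmb w) =
      (Sum.elim b k : Vertex r s → X) w := by
    rintro (w | w) <;> simp [upperEmb]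
  constructor
  · rintro ⟨h1, h2⟩ u v huv
    rcases (stackGraph_adj_iff σ τ u v).mp huv with ⟨w, rfl, rfl⟩ | ⟨w, rfl, rfl⟩
    · rw [hl, hl, h1 w]
    · rw [hu, hu, h2 w]
  · intro h
    constructor
    · intro w
      rw [← hl, ← hl]
      exact (h _ _ ((stackGraph_adj_iff σ τ _ _).mpr (Or.inl ⟨w, rfl, rfl⟩))).symm
    · intro w
      rw [← hu, ← hu]
      exact (h _ _ ((stackGraph_adj_iff σ τ _ _).mpr (Or.inr ⟨w, rfl, rfl⟩))).symm

theorem eq_of_reachable {V X : Type*} {G : SimpleGraph V} {f : V → X}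
    (h : ∀ u v, G.Adj u v → f u = f v) {u v : V} (huv : G.Reachable u v) : f u = f v := by
  obtain ⟨p⟩ := huv
  induction p with
  | nil => rfl
  | cons hadj _ ih => exact (h _ _ hadj).trans ih

theorem compat_comp {r s : ℕ} {X : Type*} (σ τ : WalledDiagram r s) (a k b : Pos r s → X)
    (h : σ.Compat a k ∧ τ.Compat k b) : (σ.comp τ).Compat a b := by
  intro v
  have hb : ∀ w : Vertex r s, (Sum.elim a (Sum.elim k b) : Stack r s → X) (bdryEmb w) =
      (Sum.elim b a : Vertex r s → X) w := by
    rintro (w | w) <;> simp [bdryEmb]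
  rw [← hb, ← hb]
  exact (eq_of_reachable ((compat_iff_adj σ τ a k b).mp h)
    (σ.reachable_comp_partner τ v)).symm

open Classical in
/-- The extensions to the middle row of a labelling that is compatible with the concatenation
are the labellings of the internal cycles. -/
def extensionEquiv {r s : ℕ} {X : Type*} (σ τ : WalledDiagram r s) (a b : Pos r s → X)
    (hab : (σ.comp τ).Compat a b) :
    {k : Pos r s → X // σ.Compat a k ∧ τ.Compat k b} ≃
      ({C : (stackGraph σ τ).ConnectedComponent //
        ∀ w, (stackGraph σ τ).connectedComponentMk (bdryEmb w) ≠ C} → X) := by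
  set G := stackGraph σ τ with hG
  have hb : ∀ (k : Pos r s → X) (w : Vertex r s),
      (Sum.elim a (Sum.elim k b) : Stack r s → X) (bdryEmb w) =
      (Sum.elim b a : Vertex r s → X) w := by
    rintro k (w | w) <;> simp [bdryEmb]
  let F : ({C : G.ConnectedComponent // ∀ w, G.connectedComponentMk (bdryEmb w) ≠ C} → X) →
      G.ConnectedComponent → X := fun g C =>
    if h : ∀ w, G.connectedComponentMk (bdryEmb w) ≠ C then g ⟨C, h⟩
    else (Sum.elim b a : Vertex r s → X) (not_forall.mp h).choose
  have hFb : ∀ g w, F g (G.connectedComponentMk (bdryEmb w)) =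
      (Sum.elim b a : Vertex r s → X) w := by
    intro g w
    have h : ¬ ∀ w', G.connectedComponentMk (bdryEmb w') ≠ G.connectedComponentMk (bdryEmb w) :=
      fun h => h w rfl
    simp only [F, dif_neg h]
    have h2 := not_not.mp (not_forall.mp h).choose_spec
    rcases σ.eq_or_eq_partner τ (SimpleGraph.ConnectedComponent.exact h2).symm with h3 | h3
    · rw [h3]
    · rw [h3]; exact hab w
  have hF : ∀ g, (Sum.elim a (Sum.elim (fun x => F g (G.connectedComponentMk (midV x))) b) :
      Stack r s → X) = fun u => F g (G.connectedComponentMk u) := by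
    intro g
    funext u
    rcases u with x | x | x
    · exact (hFb g (Sum.inr x)).symm
    · rfl
    · exact (hFb g (Sum.inl x)).symm
  exact
    { toFun := fun k C => (Sum.elim a (Sum.elim k.1 b) : Stack r s → X) C.1.out
      invFun := fun g => ⟨fun x => F g (G.connectedComponentMk (midV x)), by
        rw [compat_iff_adj, hF]
        intro u v huv
        simp only
        rw [SimpleGraph.ConnectedComponent.sound huv.reachable]⟩
      left_inv := by
        rintro ⟨k, hk⟩
        have hk' := (compat_iff_adj σ τ a k b).mp hk
        ext x
        simp only [F]
        split_ifs with h
        · exact eq_of_reachable hk' (SimpleGraph.ConnectedComponent.exact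
            (Quot.out_eq (G.connectedComponentMk (midV x))))
        · rw [← hb k]
          exact eq_of_reachable hk' (SimpleGraph.ConnectedComponent.exact
            (not_not.mp (not_forall.mp h).choose_spec))
      right_inv := by
        intro g
        funext C
        simp only [hF]
        have h1 : G.connectedComponentMk C.1.out = C.1 := Quot.out_eq C.1
        rw [h1]
        simp only [F]
        rw [dif_pos C.2] }

open Classical in
/-- Gluing formula: the `0`-`1` matrices of the diagrams multiply like the diagrams, with a factor
`|X|` for each internal cycle. -/
theorem sum_compat {r s : ℕ} {X : Type*} [Fintype X] (σ τ : WalledDiagram r s)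
    (a b : Pos r s → X) :
    ∑ k : Pos r s → X, (if σ.Compat a k then 1 else 0) * (if τ.Compat k b then 1 else 0) =
      Fintype.card X ^ σ.loops τ * (if (σ.comp τ).Compat a b then 1 else 0) := by
  have h1 : ∀ k : Pos r s → X, (if σ.Compat a k then 1 else 0) * (if τ.Compat k b then 1 else 0) =
      (if σ.Compat a k ∧ τ.Compat k b then 1 else 0) := by
    intro k
    split_ifs <;> simp_all
  rw [Finset.sum_congr rfl fun k _ => h1 k, ← Finset.card_filter, ← Fintype.card_subtype]
  by_cases hab : (σ.comp τ).Compat a b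
  · rw [Fintype.card_congr (extensionEquiv σ τ a b hab), if_pos hab, mul_one, Fintype.card_fun,
      WalledDiagram.loops, Nat.card_eq_fintype_card]
  · rw [if_neg hab, mul_zero, Fintype.card_eq_zero_iff]
    exact ⟨fun k => hab (compat_comp σ τ a k.1 b k.2)⟩

/-- The identity diagram, with the vertical edges only. -/
def WalledDiagram.id (r s : ℕ) : WalledDiagram r s where
  partner := Sum.swap
  partner_partner := Sum.swap_swap
  side_partner := by rintro ((x | x) | (x | x)) <;> rfl

theorem WalledDiagram.id_compat_iff {r s : ℕ} {X : Type*} (a b : Pos r s → X) :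
    (WalledDiagram.id r s).Compat a b ↔ a = b := by
  constructor
  · intro h
    funext x
    exact h (Sum.inl x)
  · rintro rfl (v | v) <;> rfl

open Classical in
/-- The matrix of a diagram for the two-element set of labels. -/
def boolMat {r s : ℕ} (σ : WalledDiagram r s) : Matrix (Pos r s → Bool) (Pos r s → Bool) ℕ :=
  Matrix.of fun a b => if σ.Compat a b then 1 else 0

theorem boolMat_mul {r s : ℕ} (σ τ : WalledDiagram r s) :
    boolMat σ * boolMat τ = 2 ^ σ.loops τ • boolMat (σ.comp τ) := by
  ext a b
  rw [Matrix.mul_apply, Matrix.smul_apply, smul_eq_mul]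
  exact sum_compat σ τ a b

theorem boolMat_id (r s : ℕ) : boolMat (WalledDiagram.id r s) = 1 := by
  ext a b
  simp [boolMat, WalledDiagram.id_compat_iff, Matrix.one_apply]

theorem boolMat_const {r s : ℕ} (σ : WalledDiagram r s) :
    boolMat σ (fun _ => true) (fun _ => true) = 1 := by
  have : σ.Compat (fun _ => true) (fun _ => true) := by
    intro v
    cases σ.partner v <;> cases v <;> rfl
  simp [boolMat, this]

theorem boolMat_injective {r s : ℕ} : Function.Injective (boolMat (r := r) (s := s)) := by
  classical
  intro σ τ h
  have hc : ∀ a b : Pos r s → Bool, σ.Compat a b → τ.Compat a b := by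
    intro a b hab
    have h1 := congrFun (congrFun h a) b
    by_contra hcon
    simp [boolMat, hab, hcon] at h1
  apply WalledDiagram.ext
  funext v
  let k : Vertex r s → Bool := fun w => decide (w = v ∨ w = σ.partner v)
  have hk : (Sum.elim (fun x => k (Sum.inl x)) (fun x => k (Sum.inr x)) : Vertex r s → Bool) = k :=
    Sum.elim_comp_inl_inr k
  have h1 : σ.Compat (fun x => k (Sum.inr x)) (fun x => k (Sum.inl x)) := by
    intro w
    rw [hk]
    have e1 : σ.partner w = v ↔ w = σ.partner v :=
      ⟨fun h => by rw [← h, σ.partner_partner], fun h => by rw [h, σ.partner_partner]⟩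
    have e2 : σ.partner w = σ.partner v ↔ w = v :=
      ⟨fun h => by rw [← σ.partner_partner w, h, σ.partner_partner], fun h => by rw [h]⟩
    simp only [k, e1, e2]
    exact decide_eq_decide.mpr or_comm
  have h2 := hc _ _ h1 v
  rw [hk] at h2
  simp only [k, true_or, decide_true, decide_eq_true_eq] at h2
  rcases h2 with h2 | h2
  · exact absurd h2 (τ.partner_ne v)
  · exact h2.symm

theorem boolMat_smul_inj {r s : ℕ} {σ τ : WalledDiagram r s} {p q : ℕ}
    (h : 2 ^ p • boolMat σ = 2 ^ q • boolMat τ) : p = q ∧ σ = τ := by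
  have h1 := congrFun (congrFun h fun _ => true) fun _ => true
  simp only [Matrix.smul_apply, boolMat_const, smul_eq_mul, mul_one] at h1
  have hpq : p = q := Nat.pow_right_injective le_rfl h1
  refine ⟨hpq, boolMat_injective ?_⟩
  ext a b
  have h2 := congrFun (congrFun h a) b
  rw [hpq] at h2
  simp only [Matrix.smul_apply, smul_eq_mul] at h2
  exact Nat.eq_of_mul_eq_mul_left (by positivity) h2

theorem comp_assoc_aux {r s : ℕ} (ρ σ τ : WalledDiagram r s) :
    ρ.loops σ + (ρ.comp σ).loops τ = σ.loops τ + ρ.loops (σ.comp τ) ∧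
      (ρ.comp σ).comp τ = ρ.comp (σ.comp τ) := by
  apply boolMat_smul_inj
  have h := mul_assoc (boolMat ρ) (boolMat σ) (boolMat τ)
  rw [boolMat_mul, boolMat_mul, smul_mul_assoc, mul_smul_comm, boolMat_mul, boolMat_mul,
    smul_smul, smul_smul, ← pow_add, ← pow_add] at h
  exact h

theorem id_comp_aux {r s : ℕ} (σ : WalledDiagram r s) :
    (WalledDiagram.id r s).loops σ = 0 ∧ (WalledDiagram.id r s).comp σ = σ := by
  apply boolMat_smul_inj
  rw [← boolMat_mul, boolMat_id, one_mul, pow_zero, one_smul]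

theorem comp_id_aux {r s : ℕ} (σ : WalledDiagram r s) :
    σ.loops (WalledDiagram.id r s) = 0 ∧ σ.comp (WalledDiagram.id r s) = σ := by
  apply boolMat_smul_inj
  rw [← boolMat_mul, boolMat_id, mul_one, pow_zero, one_smul]

/-- The walled Brauer algebra `B_{r,s}(δ)`: the vector space with the walled Brauer diagrams as a
basis. -/
def WalledBrauer (K : Type*) [Field K] (r s : ℕ) (_δ : K) : Type _ := WalledDiagram r s →₀ K

instance (K : Type*) [Field K] (r s : ℕ) (δ : K) : AddCommGroup (WalledBrauer K r s δ) :=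
  inferInstanceAs (AddCommGroup (WalledDiagram r s →₀ K))

instance (K : Type*) [Field K] (r s : ℕ) (δ : K) : Module K (WalledBrauer K r s δ) :=
  inferInstanceAs (Module K (WalledDiagram r s →₀ K))

/-- The basis of `B_{r,s}(δ)` formed by the diagrams. -/
def diagramBasis (K : Type*) [Field K] (r s : ℕ) (δ : K) :
    Module.Basis (WalledDiagram r s) K (WalledBrauer K r s δ) :=
  Module.Basis.ofRepr (LinearEquiv.refl K (WalledDiagram r s →₀ K))

/-- The multiplication `σ τ = δ ^ t (σ ∘ τ)`, where `t` is the number of internal cycles. -/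
def brauerMul (K : Type*) [Field K] (r s : ℕ) (δ : K) :
    WalledBrauer K r s δ →ₗ[K] WalledBrauer K r s δ →ₗ[K] WalledBrauer K r s δ :=
  (diagramBasis K r s δ).constr K fun σ => (diagramBasis K r s δ).constr K fun τ =>
    δ ^ σ.loops τ • diagramBasis K r s δ (σ.comp τ)

theorem brauerMul_basis (K : Type*) [Field K] (r s : ℕ) (δ : K) (σ τ : WalledDiagram r s) :
    brauerMul K r s δ (diagramBasis K r s δ σ) (diagramBasis K r s δ τ) =
      δ ^ σ.loops τ • diagramBasis K r s δ (σ.comp τ) := by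
  simp only [brauerMul, Module.Basis.constr_basis]

theorem brauerMul_assoc (K : Type*) [Field K] (r s : ℕ) (δ : K) (x y z : WalledBrauer K r s δ) :
    brauerMul K r s δ (brauerMul K r s δ x y) z = brauerMul K r s δ x (brauerMul K r s δ y z) := by
  have h : (brauerMul K r s δ).compr₂ (brauerMul K r s δ) =
      ((LinearMap.llcomp K (WalledBrauer K r s δ) (WalledBrauer K r s δ)
        (WalledBrauer K r s δ)).flip.comp (brauerMul K r s δ)).flip.comp (brauerMul K r s δ) := by
    refine (diagramBasis K r s δ).ext fun ρ => (diagramBasis K r s δ).ext fun σ =>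
      (diagramBasis K r s δ).ext fun τ => ?_
    simp only [LinearMap.compr₂_apply, LinearMap.comp_apply, LinearMap.flip_apply,
      LinearMap.llcomp_apply, brauerMul_basis, map_smul, LinearMap.smul_apply, smul_smul,
      ← pow_add]
    obtain ⟨h1, h2⟩ := comp_assoc_aux ρ σ τ
    rw [h1, h2]
  exact DFunLike.congr_fun (DFunLike.congr_fun (DFunLike.congr_fun h x) y) z

instance (K : Type*) [Field K] (r s : ℕ) (δ : K) : Ring (WalledBrauer K r s δ) where
  __ := (inferInstance : AddCommGroup (WalledBrauer K r s δ))
  mul x y := brauerMul K r s δ x y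
  one := diagramBasis K r s δ (WalledDiagram.id r s)
  left_distrib x y z := map_add (brauerMul K r s δ x) y z
  right_distrib x y z := LinearMap.map_add₂ (brauerMul K r s δ) x y z
  zero_mul x := LinearMap.map_zero₂ (brauerMul K r s δ) x
  mul_zero x := map_zero (brauerMul K r s δ x)
  mul_assoc := brauerMul_assoc K r s δ
  one_mul x := by
    have h : brauerMul K r s δ (diagramBasis K r s δ (WalledDiagram.id r s)) = LinearMap.id :=
      (diagramBasis K r s δ).ext fun σ => by
        rw [brauerMul_basis, (id_comp_aux σ).1, (id_comp_aux σ).2, pow_zero, one_smul,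
          LinearMap.id_apply]
    exact DFunLike.congr_fun h x
  mul_one x := by
    have h : (brauerMul K r s δ).flip (diagramBasis K r s δ (WalledDiagram.id r s)) =
        LinearMap.id :=
      (diagramBasis K r s δ).ext fun σ => by
        rw [LinearMap.flip_apply, brauerMul_basis, (comp_id_aux σ).1, (comp_id_aux σ).2, pow_zero,
          one_smul, LinearMap.id_apply]
    exact DFunLike.congr_fun h x

instance (K : Type*) [Field K] (r s : ℕ) (δ : K) : Algebra K (WalledBrauer K r s δ) :=
  Algebra.ofModule (fun k x y => LinearMap.map_smul₂ (brauerMul K r s δ) k x y)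
    (fun k x y => map_smul (brauerMul K r s δ x) k y)

/-- The labelling of the positions by the entries of a multi-index. -/
def label {m r s : ℕ} (I : MultiIndex m r s) : Pos r s → Fin m := Sum.elim I.1 I.2

open Classical in
/-- The operator of a diagram on the mixed tensor space: `v_I σ` is the sum of the `v_J` such that
the labelling of the lower row of `σ` by `I` and of the upper row by `J` is constant along the
edges. -/
def diagramOp (K : Type*) [Field K] (m r s : ℕ) (σ : WalledDiagram r s) :
    Module.End K (MixedTensor K m r s) :=
  Matrix.toLinAlgEquiv (mixedBasis K m r s)
    (Matrix.of fun J I => if σ.Compat (label I) (label J) then (1 : K) else 0)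

theorem diagramOp_mul (K : Type*) [Field K] (m r s : ℕ) (σ τ : WalledDiagram r s) :
    diagramOp K m r s τ * diagramOp K m r s σ =
      (m : K) ^ σ.loops τ • diagramOp K m r s (σ.comp τ) := by
  classical
  rw [diagramOp, diagramOp, diagramOp, ← map_mul, ← map_smul]
  congr 1
  ext J I
  have h := sum_compat σ τ (label I) (label J)
  rw [← (Equiv.sumArrowEquivProdArrow (Fin r) (Fin s) (Fin m)).symm.sum_comp] at h
  have h' := congrArg (Nat.cast : ℕ → K) h
  rw [Fintype.card_fin] at h'
  push_cast at h'
  rw [Matrix.mul_apply, Matrix.smul_apply, smul_eq_mul, Matrix.of_apply, ← h']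
  refine Finset.sum_congr rfl fun L _ => ?_
  rw [Matrix.of_apply, Matrix.of_apply, mul_comm]
  rfl

theorem diagramOp_id (K : Type*) [Field K] (m r s : ℕ) :
    diagramOp K m r s (WalledDiagram.id r s) = 1 := by
  rw [diagramOp, ← map_one (Matrix.toLinAlgEquiv (mixedBasis K m r s))]
  congr 1
  ext J I
  have h : label I = label J ↔ J = I := by
    constructor
    · intro h
      exact ((Equiv.sumArrowEquivProdArrow (Fin r) (Fin s) (Fin m)).symm.injective h).symm
    · rintro rfl
      rfl
  simp [WalledDiagram.id_compat_iff, Matrix.one_apply, h]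

/-- The right action of `B_{r,s}(δ)`, `δ = m`, on the mixed tensor space. -/
def brauerAction (K : Type*) [Field K] (m r s : ℕ) :
    WalledBrauer K r s (m : K) →ₐ[K] (Module.End K (MixedTensor K m r s))ᵐᵒᵖ :=
  AlgHom.ofLinearMap
    ((diagramBasis K r s (m : K)).constr K fun σ => MulOpposite.op (diagramOp K m r s σ))
    (by
      change (diagramBasis K r s (m : K)).constr K _
        (diagramBasis K r s (m : K) (WalledDiagram.id r s)) = 1
      rw [Module.Basis.constr_basis, diagramOp_id, MulOpposite.op_one])
    (fun x y => by
      have h : (brauerMul K r s (m : K)).compr₂ ((diagramBasis K r s (m : K)).constr K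
            fun σ => MulOpposite.op (diagramOp K m r s σ)) =
          (LinearMap.mul K (Module.End K (MixedTensor K m r s))ᵐᵒᵖ).compl₁₂
            ((diagramBasis K r s (m : K)).constr K
              fun σ => MulOpposite.op (diagramOp K m r s σ))
            ((diagramBasis K r s (m : K)).constr K
              fun σ => MulOpposite.op (diagramOp K m r s σ)) := by
        refine (diagramBasis K r s (m : K)).ext fun σ => (diagramBasis K r s (m : K)).ext
          fun τ => ?_
        simp only [LinearMap.compr₂_apply, LinearMap.compl₁₂_apply, LinearMap.mul_apply',
          brauerMul_basis, map_smul, Module.Basis.constr_basis]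
        rw [← MulOpposite.op_mul, diagramOp_mul, MulOpposite.op_smul]
      exact DFunLike.congr_fun (DFunLike.congr_fun h x) y)

/-- `End_{B_{r,s}(δ)}(V^{⊗r} ⊗ W^{⊗s})`: the linear endomorphisms `φ` with `φ(v b) = φ(v) b` for
all `b` in `B_{r,s}(δ)`, under composition. -/
def brauerEnd (K : Type*) [Field K] (m r s : ℕ) :
    Subalgebra K (Module.End K (MixedTensor K m r s)) :=
  Subalgebra.centralizer K
    (Set.range fun x : WalledBrauer K r s (m : K) => (brauerAction K m r s x).unop)

/-! ### Generators and relations for the dual of the centralizer -/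

/-- The tensor product of the free algebra on the generators `x_{ij}` and the free algebra on the
generators `x^*_{ij}`, `1 ≤ i, j ≤ m`. -/
def FreeMixed (K : Type*) [Field K] (m : ℕ) : Type _ :=
  FreeAlgebra K (Fin m × Fin m) ⊗[K] FreeAlgebra K (Fin m × Fin m)

instance (K : Type*) [Field K] (m : ℕ) : Ring (FreeMixed K m) :=
  inferInstanceAs (Ring (FreeAlgebra K (Fin m × Fin m) ⊗[K] FreeAlgebra K (Fin m × Fin m)))

instance (K : Type*) [Field K] (m : ℕ) : Algebra K (FreeMixed K m) :=
  inferInstanceAs (Algebra K (FreeAlgebra K (Fin m × Fin m) ⊗[K] FreeAlgebra K (Fin m × Fin m)))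

/-- The element `p ⊗ q`. -/
def FreeMixed.tmul {K : Type*} [Field K] {m : ℕ} (p q : FreeAlgebra K (Fin m × Fin m)) :
    FreeMixed K m :=
  p ⊗ₜ[K] q

/-- The generator `x_{ij}`. -/
def genX (K : Type*) [Field K] (m : ℕ) (i j : Fin m) : FreeMixed K m :=
  FreeMixed.tmul (FreeAlgebra.ι K (i, j)) 1

/-- The generator `x^*_{ij}`. -/
def genXs (K : Type*) [Field K] (m : ℕ) (i j : Fin m) : FreeMixed K m :=
  FreeMixed.tmul 1 (FreeAlgebra.ι K (i, j))

/-- The monomial `x_{i_1 j_1} ⋯ x_{i_r j_r} ⊗ x^*_{i_{r+1} j_{r+1}} ⋯ x^*_{i_{r+s} j_{r+s}}`. -/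
def monomialX (K : Type*) [Field K] (m r s : ℕ) (I J : MultiIndex m r s) : FreeMixed K m :=
  FreeMixed.tmul (List.ofFn fun a => FreeAlgebra.ι K (I.1 a, J.1 a)).prod
    (List.ofFn fun b => FreeAlgebra.ι K (I.2 b, J.2 b)).prod

/-- `F = F₁ ⊗ F₂`: the span of the monomials of degree `r` in the `x_{ij}` and degree `s` in the
`x^*_{ij}`. -/
def freePart (K : Type*) [Field K] (m r s : ℕ) : Submodule K (FreeMixed K m) :=
  Submodule.span K (Set.range fun p : MultiIndex m r s × MultiIndex m r s =>
    monomialX K m r s p.1 p.2)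

/-- The defining relations, as elements that are set equal to zero. -/
inductive IsRelator (K : Type*) [Field K] (m : ℕ) : FreeMixed K m → Prop
  | comm_x (i j k l : Fin m) :
      IsRelator K m (genX K m i j * genX K m k l - genX K m k l * genX K m i j)
  | comm_xs (i j k l : Fin m) :
      IsRelator K m (genXs K m i j * genXs K m k l - genXs K m k l * genXs K m i j)
  | column (i j : Fin m) (h : i ≠ j) : IsRelator K m (∑ k, genX K m k i * genXs K m k j)
  | row (i j : Fin m) (h : i ≠ j) : IsRelator K m (∑ k, genX K m i k * genXs K m j k)
  | diag (i j : Fin m) :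
      IsRelator K m (∑ k, genX K m k i * genXs K m k i - ∑ k, genX K m j k * genXs K m j k)

/-- `Y ⊆ F`: the elements of `F` that are linear combinations of multiples `p ρ q` of relators. -/
def relPart (K : Type*) [Field K] (m r s : ℕ) : Submodule K (freePart K m r s) :=
  (Submodule.span K {y : FreeMixed K m | ∃ p q ρ, IsRelator K m ρ ∧ y = p * ρ * q}).comap
    (freePart K m r s).subtype

/-- The class in `F / Y` of the monomial of `I, J`. -/
def monomialClass (K : Type*) [Field K] (m r s : ℕ) (I J : MultiIndex m r s) :
    freePart K m r s ⧸ relPart K m r s :=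
  (relPart K m r s).mkQ ⟨monomialX K m r s I J, Submodule.subset_span ⟨(I, J), rfl⟩⟩

/-- The coefficient function `x_{IJ}` on `End_K(V^{⊗r} ⊗ W^{⊗s})`: the coefficient `a_{IJ}` of the
matrix unit `E_{IJ}` (which maps `v_J` to `v_I`) in `φ = ∑ a_{IJ} E_{IJ}`. -/
def coordFun (K : Type*) [Field K] (m r s : ℕ) (I J : MultiIndex m r s) :
    Module.Dual K (Module.End K (MixedTensor K m r s)) :=
  ((mixedBasis K m r s).coord I).comp (LinearMap.applyₗ (mixedBasis K m r s J))

/-- `A(m,r,s) ⊆ K[GL(m)]`: the span of the products `∏ c_{ij}^{a_{ij}} ∏ d_{ij}^{b_{ij}}` with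
`∑ a_{ij} = r` and `∑ b_{ij} = s`. -/
def coeffSpace (K : Type*) [Field K] (m r s : ℕ) : Submodule K (GLCoord K m) :=
  Submodule.span K {f | ∃ a b : Fin m × Fin m → ℕ, ∑ p, a p = r ∧ ∑ p, b p = s ∧
    f = (∏ p, cMat K m p.1 p.2 ^ a p) * ∏ p, dMat K m p.1 p.2 ^ b p}

end

end MixedSchurWeyl

namespace MixedSchurWeyl

open scoped TensorProduct
open Coalgebra Bialgebra

noncomputable section

/-! ### Minors up to sign -/

/-! A formal combination `l` of symbols indexed by pairs `(I, J)` can be evaluated in four ways: as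
a linear form on the centralizer `E`, as a linear form on the rational Schur algebra `S`, as a
function in `K[GL(m)]` (each pair becomes a coefficient function), and as a class of monomials
modulo the relations. The theorem follows once these four evaluations have the same kernel, and that
is proved around a cycle.

Vanishing on `E` implies vanishing on `S`, because `S ⊆ E`: the matrix of coefficient functions
commutes with each diagram matrix, since along every edge a row of `C` meets a column of `C⁻¹`
(`coeffMat_mul_diagMat`). Vanishing on `S` forces the function to be zero, because distributions at
the identity separate functions, by Krull's intersection theorem (`eq_zero_of_dist`). If the
function is zero, the combination of monomials lies in the relation ideal
(`mem_relIdeal_of_mixedEval`); this is the hard step. If it lies in the relation ideal, it vanishes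
on `E`, because the matrix entries of an endomorphism commuting with the permutation diagrams and
with one contraction satisfy the relations (`wordForm_relIdeal`).

Equal annihilators give `S = E`, and equal kernels of surjections give the three linear
isomorphisms; the transposed indices in the third assertion come from the automorphism of `K[GL(m)]`
that transposes `C`. The isomorphism with the opposite algebra is transposition of matrices, which
preserves `E` because diagrams can be reflected.

The hard step says that `A(m,r,s)` satisfies no further relations. For `m > 0` the relations define
a commutative ring with generic matrices `X`, `Z` and an element `c` such that `XᵀZ` and `XZᵀ` are
both `c` times the identity. Modulo `c` every product of minors is straightened into standard
rational bitableaux: the usual exchange relation reorders two columns of the same matrix, and a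
Cauchy–Binet argument for `ZᵀX = 0` treats a column against a dual column (`exchange`,
`mixed_exchange`, `prodMinors_mem_stdSpan`). Lifting step by step along powers of `c`, and stopping
by the grading, shows that the image of `F` is spanned by standard bitableaux times the power of `c`
that completes the degree. Setting `c = 1` maps these to the standard bitableaux in `K[GL(m)]`,
which are linearly independent (`linearIndependent_stdVal`): after multiplication by a power of the
determinant, Jacobi's formula replaces dual columns by complementary ordinary ones, and at a product
of two suitably weighted generic matrices the leading monomial recovers the bitableau.

Signs are irrelevant both for membership in spans and for the nonvanishing of leading coefficients,
so minors are handled only up to sign throughout. -/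

/-- Equality up to sign. -/
def PM {R : Type*} [Ring R] (x y : R) : Prop := x = y ∨ x = -y

namespace PM

variable {R : Type*} [CommRing R] {x y z x' y' : R}

theorem refl (x : R) : PM x x := Or.inl rfl

theorem of_eq (h : x = y) : PM x y := Or.inl h

theorem symm (h : PM x y) : PM y x := by
  rcases h with rfl | rfl
  · exact Or.inl rfl
  · exact Or.inr (neg_neg _).symm

theorem trans (h : PM x y) (h' : PM y z) : PM x z := by
  rcases h with rfl | rfl
  · exact h'
  · rcases h' with rfl | rfl
    · exact Or.inr rfl
    · exact Or.inl (neg_neg _)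

theorem mul (h : PM x y) (h' : PM x' y') : PM (x * x') (y * y') := by
  rcases h with rfl | rfl <;> rcases h' with rfl | rfl <;> simp [PM]

theorem prod {ι : Type*} (s : Finset ι) {f g : ι → R} (h : ∀ i ∈ s, PM (f i) (g i)) :
    PM (∏ i ∈ s, f i) (∏ i ∈ s, g i) := by
  classical
  induction s using Finset.induction_on with
  | empty => simp [PM]
  | insert a s ha ih =>
    rw [Finset.prod_insert ha, Finset.prod_insert ha]
    exact (h a (Finset.mem_insert_self a s)).mul
      (ih fun i hi => h i (Finset.mem_insert_of_mem hi))

theorem list_prod {ι : Type*} (l : List ι) {f g : ι → R} (h : ∀ i ∈ l, PM (f i) (g i)) :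
    PM (l.map f).prod (l.map g).prod := by
  induction l with
  | nil => simp [PM]
  | cons a l ih =>
    simp only [List.map_cons, List.prod_cons]
    exact (h a (by simp)).mul (ih fun i hi => h i (List.mem_cons_of_mem a hi))

theorem exists_mul (h : PM x y) : ∃ ε : R, PM ε 1 ∧ x = ε * y := by
  rcases h with rfl | rfl
  · exact ⟨1, Or.inl rfl, (one_mul _).symm⟩
  · exact ⟨-1, Or.inr rfl, by ring⟩

theorem eq_zero (h : PM x 0) : x = 0 := by
  rcases h with rfl | rfl <;> simp

theorem map {S : Type*} [CommRing S] (f : R →+* S) (h : PM x y) : PM (f x) (f y) := by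
  rcases h with rfl | rfl
  · exact Or.inl rfl
  · exact Or.inr (map_neg f _)

theorem mem_iff {K : Type*} [CommRing K] [Algebra K R] (V : Submodule K R) (h : PM x y) :
    x ∈ V ↔ y ∈ V := by
  rcases h with rfl | rfl
  · rfl
  · exact neg_mem_iff

end PM

theorem pm_det_submatrix {R p q : Type*} [CommRing R] [Fintype p] [DecidableEq p] [Fintype q]
    [DecidableEq q] (M : Matrix p p R) (e e' : q ≃ p) : PM (M.submatrix e e').det M.det := by
  have h : M.submatrix e e' = (M.submatrix id (e.symm.trans e')).submatrix e e := by
    ext i j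
    simp
  rw [h, Matrix.det_submatrix_equiv_self, Matrix.det_permute' (e.symm.trans e') M]
  rcases Int.units_eq_one_or (Equiv.Perm.sign (e.symm.trans e')) with h | h <;> simp [h, PM]

section Minor

variable {R ι κ : Type*} [CommRing R] [DecidableEq ι] [DecidableEq κ]

/-- The minor of `M` with the rows `A` and the columns `B`, up to a sign. -/
def minor (M : Matrix ι κ R) (A : Finset ι) (B : Finset κ) : R :=
  if h : A.card = B.card then
    (M.submatrix (fun a : A => (a : ι)) (fun a : A => (Finset.equivOfCardEq h a : κ))).det
  else 0

theorem minor_of_card_ne (M : Matrix ι κ R) {A : Finset ι} {B : Finset κ} (h : A.card ≠ B.card) :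
    minor M A B = 0 := dif_neg h

/-- The bijection chosen in `minor` is arbitrary. Two enumerations of the same row and column sets
differ by permutations, hence only by a sign, so any injective parametrization computes the minor.
-/
theorem pm_minor {p : Type*} [Fintype p] [DecidableEq p] (M : Matrix ι κ R) {f : p → ι} {g : p → κ}
    (hf : f.Injective) (hg : g.Injective) {A : Finset ι} {B : Finset κ}
    (hA : Finset.univ.image f = A) (hB : Finset.univ.image g = B) :
    PM (M.submatrix f g).det (minor M A B) := by
  have hcA : A.card = Fintype.card p := by
    rw [← hA, Finset.card_image_of_injective _ hf, Finset.card_univ]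
  have hcB : B.card = Fintype.card p := by
    rw [← hB, Finset.card_image_of_injective _ hg, Finset.card_univ]
  have h : A.card = B.card := hcA.trans hcB.symm
  have hfA : ∀ i, f i ∈ A := fun i => hA ▸ Finset.mem_image_of_mem f (Finset.mem_univ i)
  have hgB : ∀ i, g i ∈ B := fun i => hB ▸ Finset.mem_image_of_mem g (Finset.mem_univ i)
  have bf : Function.Bijective fun i => (⟨f i, hfA i⟩ : A) := by
    rw [Fintype.bijective_iff_injective_and_card]
    exact ⟨fun i j hij => hf (congrArg Subtype.val hij), by simp [hcA]⟩
  have bg : Function.Bijective fun i => (⟨g i, hgB i⟩ : B) := by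
    rw [Fintype.bijective_iff_injective_and_card]
    exact ⟨fun i j hij => hg (congrArg Subtype.val hij), by simp [hcB]⟩
  rw [minor, dif_pos h]
  set M' := M.submatrix (fun a : A => (a : ι)) (fun a : A => (Finset.equivOfCardEq h a : κ))
  have e : M.submatrix f g = M'.submatrix (Equiv.ofBijective _ bf)
      ((Equiv.ofBijective _ bg).trans (Finset.equivOfCardEq h).symm) := by
    ext i j
    simp [M']
  rw [e]
  exact pm_det_submatrix _ _ _

theorem det_submatrix_eq_zero_of_row {p : Type*} [Fintype p] [DecidableEq p] (M : Matrix ι κ R)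
    {f : p → ι} (g : p → κ) (hf : ¬ f.Injective) : (M.submatrix f g).det = 0 := by
  rw [Function.not_injective_iff] at hf
  obtain ⟨a, b, hab, hne⟩ := hf
  exact Matrix.det_zero_of_row_eq hne (by ext j; simp [hab])

theorem det_submatrix_eq_zero_of_col {p : Type*} [Fintype p] [DecidableEq p] (M : Matrix ι κ R)
    (f : p → ι) {g : p → κ} (hg : ¬ g.Injective) : (M.submatrix f g).det = 0 := by
  rw [Function.not_injective_iff] at hg
  obtain ⟨a, b, hab, hne⟩ := hg
  exact Matrix.det_zero_of_column_eq hne (by intro j; simp [hab])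

/-- A minor as the determinant for a given bijection of the rows with the columns. -/
theorem minor_pm (M : Matrix ι κ R) {A : Finset ι} {B : Finset κ} (e : A ≃ B) :
    PM (minor M A B) (M.submatrix (fun a : A => (a : ι)) (fun a : A => (e a : κ))).det := by
  refine (pm_minor M Subtype.val_injective (Subtype.val_injective.comp e.injective) ?_ ?_).symm
  · ext i; simp
  · ext i
    simp only [Finset.mem_image, Finset.mem_univ, true_and, Function.comp]
    constructor
    · rintro ⟨a, rfl⟩; exact (e a).2
    · intro hi; exact ⟨e.symm ⟨i, hi⟩, by simp⟩

theorem minor_transpose (M : Matrix ι κ R) (A : Finset ι) (B : Finset κ) :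
    PM (minor M.transpose B A) (minor M A B) := by
  by_cases h : A.card = B.card
  · set e := Finset.equivOfCardEq h
    refine (minor_pm M.transpose e.symm).trans ?_
    have h1 : M.transpose.submatrix (fun b : B => (b : κ)) (fun b : B => (e.symm b : ι)) =
        ((M.submatrix (fun a : A => (a : ι)) (fun a : A => (e a : κ))).submatrix
          e.symm e.symm).transpose := by
      ext i j; simp
    rw [h1, Matrix.det_transpose, Matrix.det_submatrix_equiv_self]
    exact (minor_pm M e).symm
  · rw [minor_of_card_ne _ h, minor_of_card_ne _ (Ne.symm h)]
    exact PM.refl 0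

theorem map_minor {S : Type*} [CommRing S] (f : R →+* S) (M : Matrix ι κ R) (A : Finset ι)
    (B : Finset κ) : f (minor M A B) = minor (M.map f) A B := by
  unfold minor
  split_ifs with h
  · rw [RingHom.map_det]; rfl
  · exact map_zero f

theorem minor_smul (c : R) (M : Matrix ι κ R) (A : Finset ι) (B : Finset κ) :
    minor (c • M) A B = c ^ A.card * minor M A B := by
  unfold minor
  split_ifs with h
  · change (c • M.submatrix _ _).det = _
    rw [Matrix.det_smul]; simp
  · simp

theorem minor_singleton (M : Matrix ι κ R) (i : ι) (j : κ) : minor M {i} {j} = M i j := by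
  rw [minor, dif_pos (by simp), Matrix.det_unique]
  have h := (Finset.equivOfCardEq (s := ({i} : Finset ι)) (t := ({j} : Finset κ)) (by simp)
    default).2
  simp only [Finset.mem_singleton] at h
  simp [h]

end Minor

/-! ### Laplace expansion along several rows or columns. -/

section Laplace

variable {R ρ γ : Type*} [CommRing R] [Fintype ρ] [Fintype γ] [DecidableEq ρ] [DecidableEq γ]

/-- This is one term of the Laplace expansion: after rows and columns are sorted by membership in
`s` and `t`, the matrix is block diagonal. If the blocks are not square, no permutation avoids the
zero entries, in agreement with the value zero of `minor`. -/
theorem pm_det_blocks (G : Matrix ρ γ R) (e : ρ ≃ γ) (s t : Finset ρ) :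
    PM (Matrix.of fun i j => if (i ∈ s ↔ j ∈ t) then G i (e j) else 0).det
      (minor G s (t.map e.toEmbedding) * minor G sᶜ (t.map e.toEmbedding)ᶜ) := by
  by_cases h : s.card = t.card
  · let e1 : {a // a ∈ s} ≃ {a // a ∈ t} := Finset.equivOfCardEq h
    have hc : Fintype.card {a // ¬ a ∈ s} = Fintype.card {a // ¬ a ∈ t} := by
      simp [Fintype.card_subtype_compl, h]
    let e2 : {a // ¬ a ∈ s} ≃ {a // ¬ a ∈ t} := Fintype.equivOfCardEq hc
    refine (pm_det_submatrix _ (Equiv.sumCompl (· ∈ s))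
      ((Equiv.sumCongr e1 e2).trans (Equiv.sumCompl (· ∈ t)))).symm.trans ?_
    have hb : (Matrix.of fun i j => if (i ∈ s ↔ j ∈ t) then G i (e j) else 0).submatrix
        (Equiv.sumCompl (· ∈ s)) ((Equiv.sumCongr e1 e2).trans (Equiv.sumCompl (· ∈ t))) =
        Matrix.fromBlocks (G.submatrix (fun a : {a // a ∈ s} => (a : ρ)) fun a => e (e1 a)) 0 0
          (G.submatrix (fun a : {a // ¬ a ∈ s} => (a : ρ)) fun a => e (e2 a)) := by
      ext i j
      rcases i with ⟨i, hi⟩ | ⟨i, hi⟩ <;> rcases j with j | j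
      · have := (e1 j).2
        simp [hi]
      · have := (e2 j).2
        simp [hi, this]
      · have := (e1 j).2
        simp [hi]
      · have := (e2 j).2
        simp [hi, this]
    rw [hb, Matrix.det_fromBlocks_zero₁₂]
    refine PM.mul ?_ ?_
    · refine pm_minor G Subtype.val_injective
        (e.injective.comp (Subtype.val_injective.comp e1.injective)) ?_ ?_
      · ext i; simp
      · ext j
        simp only [Finset.mem_image, Finset.mem_univ, true_and, Function.comp, Finset.mem_map,
          Equiv.coe_toEmbedding]
        constructor
        · rintro ⟨a, rfl⟩; exact ⟨_, (e1 a).2, rfl⟩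
        · rintro ⟨a, ha, rfl⟩; exact ⟨e1.symm ⟨a, ha⟩, by simp⟩
    · refine pm_minor G Subtype.val_injective
        (e.injective.comp (Subtype.val_injective.comp e2.injective)) ?_ ?_
      · ext i; simp
      · ext j
        simp only [Finset.mem_image, Finset.mem_univ, true_and, Function.comp, Finset.mem_map,
          Equiv.coe_toEmbedding, Finset.mem_compl, not_exists, not_and]
        constructor
        · rintro ⟨a, rfl⟩ b hb hab
          exact (e2 a).2 (e.injective hab ▸ hb)
        · intro hj
          exact ⟨e2.symm ⟨e.symm j, fun h => hj _ h (by simp)⟩, by simp⟩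
  · rw [minor_of_card_ne G (by simpa using h), zero_mul]
    refine PM.of_eq ?_
    rw [Matrix.det_apply]
    refine Finset.sum_eq_zero fun σ _ => ?_
    -- A permutation avoiding every zero would carry `t` onto `s`.
    have hex : ∃ i, ¬ (σ i ∈ s ↔ i ∈ t) := by
      by_contra hcon
      push Not at hcon
      refine h ?_
      have : s = t.map σ.toEmbedding := by
        ext i
        have := hcon (σ.symm i)
        simp only [Equiv.apply_symm_apply] at this
        rw [this, Finset.mem_map_equiv]
      rw [this, Finset.card_map]
    obtain ⟨i, hi⟩ := hex
    rw [Finset.prod_eq_zero (Finset.mem_univ i), smul_zero]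
    simp [hi]

/-- Laplace expansion along a set of rows, up to the signs of the terms. -/
theorem exists_laplace_rows (G : Matrix ρ γ R) (e : ρ ≃ γ) (s : Finset ρ) :
    ∃ ε : Finset γ → R, (∀ t, PM (ε t) 1) ∧
      (G.submatrix id e).det = ∑ t, ε t * (minor G s t * minor G sᶜ tᶜ) := by
  have h1 : (G.submatrix id e).det = ∑ t : Finset ρ,
      (Matrix.of fun i j => if (i ∈ s ↔ j ∈ t) then G i (e j) else 0).det := by
    rw [← Matrix.det_transpose]
    -- Each column is the sum of its part in the rows of `s` and its part outside. Multilinearity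
    -- expands the determinant over the set `t` of columns that contribute their first part.
    have h2 : (G.submatrix id e).transpose =
        (fun j i => if i ∈ s then G i (e j) else 0) + fun j i => if i ∈ s then 0 else G i (e j) := by
      ext j i
      simp only [Matrix.transpose_apply, Matrix.submatrix_apply, id, Pi.add_apply]
      split_ifs <;> simp
    have h3 := (Matrix.detRowAlternating (R := R) (n := ρ)).toMultilinearMap.map_add_univ
      (fun j i => if i ∈ s then G i (e j) else 0) fun j i => if i ∈ s then 0 else G i (e j)
    rw [h2]
    refine h3.trans (Finset.sum_congr rfl fun t _ => ?_)
    rw [← Matrix.det_transpose]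
    change Matrix.det _ = _
    congr 1
    ext j i
    simp only [Finset.piecewise, Matrix.transpose_apply, Matrix.of_apply]
    by_cases hj : j ∈ t <;> by_cases hi : i ∈ s <;> simp [hj, hi]
  choose ε hε hεe using fun t : Finset ρ => (pm_det_blocks G e s t).exists_mul
  refine ⟨fun t => ε (t.map e.symm.toEmbedding), fun t => hε _, ?_⟩
  rw [h1]
  refine Finset.sum_bij (fun t _ => t.map e.toEmbedding) (by simp) ?_ ?_ ?_
  · intro a _ b _ h; exact Finset.map_injective _ h
  · intro b _
    exact ⟨b.map e.symm.toEmbedding, Finset.mem_univ _, by ext; simp⟩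
  · intro t _
    have h2 : (t.map e.toEmbedding).map e.symm.toEmbedding = t := by ext; simp
    change _ = ε ((t.map e.toEmbedding).map e.symm.toEmbedding) * _
    rw [h2]
    exact hεe t

/-- Laplace expansion along a set of columns, up to the signs of the terms. -/
theorem exists_laplace_cols (G : Matrix ρ γ R) (e : ρ ≃ γ) (t : Finset γ) :
    ∃ ε : Finset ρ → R, (∀ s, PM (ε s) 1) ∧
      (G.submatrix id e).det = ∑ s, ε s * (minor G s t * minor G sᶜ tᶜ) := by
  obtain ⟨ε, hε, h⟩ := exists_laplace_rows G.transpose e.symm t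
  have h1 : (G.transpose.submatrix id e.symm).det = (G.submatrix id e).det := by
    rw [← Matrix.det_transpose, ← Matrix.det_submatrix_equiv_self e]
    congr 1
    ext i j
    simp
  choose ε' hε' h' using fun s => ((minor_transpose G s t).mul
    (minor_transpose G sᶜ tᶜ)).exists_mul
  refine ⟨fun s => ε s * ε' s, fun s => ?_, ?_⟩
  · simpa using (hε s).mul (hε' s)
  · rw [← h1, h]
    exact Finset.sum_congr rfl fun s _ => by rw [h' s, mul_assoc]

end Laplace

/-! ### Minors of matrices whose entries are read off through labels. -/

section Labels

variable {R ι κ ρ γ : Type*} [CommRing R] [DecidableEq ι] [DecidableEq κ] [DecidableEq ρ]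
  [DecidableEq γ]

/-- The auxiliary block matrices below copy entries of a fixed matrix, possibly with repeated rows.
On a set where the labels are injective their minors are again minors of the original matrix. -/
theorem pm_minor_of_labels {G : Matrix ρ γ R} {M : Matrix ι κ R} {f : ρ → ι} {g : γ → κ}
    {s : Finset ρ} {t : Finset γ} (hG : ∀ i ∈ s, ∀ j ∈ t, G i j = M (f i) (g j))
    (hf : Set.InjOn f s) (hg : Set.InjOn g t) :
    PM (minor G s t) (minor M (s.image f) (t.image g)) := by
  by_cases h : s.card = t.card
  · rw [minor, dif_pos h]
    set e := Finset.equivOfCardEq h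
    have h1 : G.submatrix (fun a : s => (a : ρ)) (fun a : s => (e a : γ)) =
        M.submatrix (fun a : s => f a) (fun a : s => g (e a)) := by
      ext i j
      exact hG i i.2 (e j) (e j).2
    rw [h1]
    refine pm_minor M (fun a b hab => Subtype.ext (hf a.2 b.2 hab))
      (fun a b hab => e.injective (Subtype.ext (hg (e a).2 (e b).2 hab))) ?_ ?_
    · ext i; simp
    · ext i
      simp only [Finset.mem_image, Finset.mem_univ, true_and]
      constructor
      · rintro ⟨a, rfl⟩; exact ⟨_, (e a).2, rfl⟩
      · rintro ⟨a, ha, rfl⟩; exact ⟨e.symm ⟨a, ha⟩, by simp⟩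
  · rw [minor_of_card_ne _ h, minor_of_card_ne]
    · exact PM.refl 0
    · rwa [Finset.card_image_of_injOn hf, Finset.card_image_of_injOn hg]

/-- A repeated label means two equal rows or columns, or the shape is not square; either way the
minor vanishes. -/
theorem minor_eq_zero_of_labels {G : Matrix ρ γ R} {M : Matrix ι κ R} {f : ρ → ι} {g : γ → κ}
    {s : Finset ρ} {t : Finset γ} (hG : ∀ i ∈ s, ∀ j ∈ t, G i j = M (f i) (g j))
    (hf : ¬ (Set.InjOn f s ∧ Set.InjOn g t)) : minor G s t = 0 := by
  unfold minor
  split_ifs with h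
  · set e := Finset.equivOfCardEq h
    have h1 : G.submatrix (fun a : s => (a : ρ)) (fun a : s => (e a : γ)) =
        M.submatrix (fun a : s => f a) (fun a : s => g (e a)) := by
      ext i j
      exact hG i i.2 (e j) (e j).2
    rw [h1]
    by_cases hi : Set.InjOn f s
    · refine det_submatrix_eq_zero_of_col M _ fun hinj => hf ⟨hi, fun a ha b hb hab => ?_⟩
      have := hinj (a₁ := e.symm ⟨a, ha⟩) (a₂ := e.symm ⟨b, hb⟩) (by simpa using hab)
      simpa using this
    · refine det_submatrix_eq_zero_of_row M _ fun hinj => hi fun a ha b hb hab => ?_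
      have := hinj (a₁ := ⟨a, ha⟩) (a₂ := ⟨b, hb⟩) hab
      simpa using this
  · rfl

theorem minor_eq_zero_of_row {G : Matrix ρ γ R} {s : Finset ρ} {t : Finset γ} {i : ρ} (hi : i ∈ s)
    (h0 : ∀ j ∈ t, G i j = 0) : minor G s t = 0 := by
  unfold minor
  split_ifs with h
  · exact Matrix.det_eq_zero_of_row_eq_zero ⟨i, hi⟩ fun j => h0 _ (Finset.equivOfCardEq h j).2
  · rfl

end Labels

/-! ### A Cauchy–Binet formula with fixed extra rows. -/

section Bordered

variable {R κ β β' α α' : Type*} [CommRing R] [Fintype κ] [Fintype β] [Fintype β'] [Fintype α]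
  [Fintype α'] [DecidableEq κ] [DecidableEq β] [DecidableEq β'] [DecidableEq α] [DecidableEq α']

/-- The bordered product of `Z` and `X`. -/
def bordered (X : Matrix (κ ⊕ α) β R) (Z : Matrix (κ ⊕ α') β' R) : Matrix (β' ⊕ α) (β ⊕ α') R :=
  Matrix.fromBlocks (Matrix.of fun b' b => -∑ k, Z (Sum.inl k) b' * X (Sum.inl k) b)
    (Matrix.of fun b' c => Z (Sum.inr c) b') (Matrix.of fun c b => X (Sum.inr c) b) 0

/-- The matrix with Schur complement `bordered X Z`. -/
def borderedExt (X : Matrix (κ ⊕ α) β R) (Z : Matrix (κ ⊕ α') β' R) :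
    Matrix (κ ⊕ (β' ⊕ α)) (κ ⊕ (β ⊕ α')) R :=
  Matrix.fromBlocks 1 (Matrix.of fun k => Sum.elim (fun b => X (Sum.inl k) b) fun _ => 0)
    (Matrix.of (Sum.elim (fun b' k => Z (Sum.inl k) b') fun _ _ => 0))
    (Matrix.fromBlocks 0 (Matrix.of fun b' c => Z (Sum.inr c) b')
      (Matrix.of fun c b => X (Sum.inr c) b) 0)

/-- Eliminating the identity block leaves the Schur complement, whose upper left block is `0 - ZᵀX`
over the indices in `κ`. -/
theorem det_borderedExt (X : Matrix (κ ⊕ α) β R) (Z : Matrix (κ ⊕ α') β' R)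
    (e : β' ⊕ α ≃ β ⊕ α') :
    ((borderedExt X Z).submatrix id (Equiv.sumCongr (Equiv.refl κ) e)).det =
      ((bordered X Z).submatrix id e).det := by
  have h : (borderedExt X Z).submatrix id (Equiv.sumCongr (Equiv.refl κ) e) =
      Matrix.fromBlocks 1
        ((Matrix.of fun k => Sum.elim (fun b => X (Sum.inl k) b) fun _ => 0).submatrix id e)
        (Matrix.of (Sum.elim (fun b' k => Z (Sum.inl k) b') fun _ _ => 0))
        ((Matrix.fromBlocks 0 (Matrix.of fun b' c => Z (Sum.inr c) b')
          (Matrix.of fun c b => X (Sum.inr c) b) 0).submatrix id e) := by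
    ext i j
    rcases i with i | i <;> rcases j with j | j <;> simp [borderedExt]
  rw [h, Matrix.det_fromBlocks_one₁₁]
  congr 1
  ext i j
  rcases hj : e j with b | c <;> rcases i with b' | c' <;>
    simp [bordered, Matrix.mul_apply, hj]

/-- In the columns of `β` the chosen rows of the extended matrix are exactly rows of `X`. -/
theorem pm_minor_borderedExt_left (X : Matrix (κ ⊕ α) β R) (Z : Matrix (κ ⊕ α') β' R)
    (C : Finset κ) :
    PM (minor (borderedExt X Z) (C.disjSum ((∅ : Finset β').disjSum Finset.univ))
        ((∅ : Finset κ).disjSum ((Finset.univ : Finset β).disjSum ∅)))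
      (minor X (C.disjSum Finset.univ) Finset.univ) := by
  by_cases h : (C.disjSum (Finset.univ : Finset α)).card = (Finset.univ : Finset β).card
  · have hc : Fintype.card (C ⊕ α) = Fintype.card β := by simpa using h
    let h0 : C ⊕ α ≃ β := Fintype.equivOfCardEq hc
    let l : C ⊕ α → κ ⊕ α := Sum.map Subtype.val id
    have hl : l.Injective := Subtype.val_injective.sumMap Function.injective_id
    let f : C ⊕ α → κ ⊕ (β' ⊕ α) := Sum.map Subtype.val Sum.inr
    have hf : f.Injective := Subtype.val_injective.sumMap Sum.inr_injective
    let g : C ⊕ α → κ ⊕ (β ⊕ α') := fun i => Sum.inr (Sum.inl (h0 i))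
    have hg : g.Injective := Sum.inr_injective.comp (Sum.inl_injective.comp h0.injective)
    refine (pm_minor (borderedExt X Z) hf hg ?_ ?_).symm.trans ?_
    · ext (k | b | a) <;> simp [f]
    · ext (k | b | a)
      · simp [g]
      · simp only [Finset.mem_image, Finset.mem_univ, true_and, Finset.inr_mem_disjSum,
          Finset.inl_mem_disjSum, iff_true]
        exact ⟨h0.symm b, by simp [g]⟩
      · simp [g]
    · have h1 : (borderedExt X Z).submatrix f g = X.submatrix l h0 := by
        ext (i | i) j <;> simp [f, g, l, borderedExt]
      rw [h1]
      refine pm_minor X hl h0.injective ?_ ?_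
      · ext (k | a) <;> simp [l]
      · ext b; simp
  · rw [minor_of_card_ne X h, minor_of_card_ne]
    · exact PM.refl 0
    · simpa using h

/-- The identity block cancels the rows and columns of `Cᶜ`; what remains are the rows of `Z`
indexed by `C` and the border. -/
theorem pm_minor_borderedExt_right (X : Matrix (κ ⊕ α) β R) (Z : Matrix (κ ⊕ α') β' R)
    (C : Finset κ) :
    PM (minor (borderedExt X Z) (Cᶜ.disjSum ((Finset.univ : Finset β').disjSum ∅))
        ((Finset.univ : Finset κ).disjSum ((∅ : Finset β).disjSum Finset.univ)))
      (minor Z (C.disjSum Finset.univ) Finset.univ) := by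
  by_cases h : (C.disjSum (Finset.univ : Finset α')).card = (Finset.univ : Finset β').card
  · have hc : Fintype.card β' = Fintype.card (C ⊕ α') := by
      simpa using h.symm
    let h0 : β' ≃ C ⊕ α' := Fintype.equivOfCardEq hc
    let l : C ⊕ α' → κ ⊕ α' := Sum.map Subtype.val id
    have hl : l.Injective := Subtype.val_injective.sumMap Function.injective_id
    let l' : κ ⊕ α' → κ ⊕ (β ⊕ α') := Sum.map id Sum.inr
    have hl' : l'.Injective := Function.injective_id.sumMap Sum.inr_injective
    let f : (Cᶜ : Finset κ) ⊕ β' → κ ⊕ (β' ⊕ α) := Sum.map Subtype.val Sum.inl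
    let g : (Cᶜ : Finset κ) ⊕ β' → κ ⊕ (β ⊕ α') :=
      Sum.elim (fun k => Sum.inl k) fun b => l' (l (h0 b))
    have hf : f.Injective := Subtype.val_injective.sumMap Sum.inl_injective
    have hg : g.Injective := by
      refine Function.Injective.sumElim (fun a b hab => Subtype.ext (Sum.inl_injective hab))
        (hl'.comp (hl.comp h0.injective)) ?_
      intro a b hab
      rcases hb : h0 b with c | c
      · simp only [hb, l, l', Sum.map_inl, id, Sum.inl.injEq] at hab
        exact (Finset.mem_compl.mp a.2) (hab ▸ c.2)
      · simp [hb, l, l'] at hab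
    refine (pm_minor (borderedExt X Z) hf hg ?_ ?_).symm.trans ?_
    · ext (k | b | a) <;> simp [f]
    · ext (k | b | a)
      · simp only [Finset.mem_image, Finset.mem_univ, true_and, Finset.inl_mem_disjSum, iff_true]
        by_cases hk : k ∈ C
        · exact ⟨Sum.inr (h0.symm (Sum.inl ⟨k, hk⟩)), by simp [g, l, l']⟩
        · exact ⟨Sum.inl ⟨k, by simpa using hk⟩, rfl⟩
      · simp only [Finset.mem_image, Finset.mem_univ, true_and, Finset.inr_mem_disjSum,
          Finset.inl_mem_disjSum, Finset.notMem_empty, iff_false]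
        rintro ⟨a | a, ha⟩
        · simp [g] at ha
        · rcases hb : h0 a with c | c <;> simp [g, hb, l, l'] at ha
      · simp only [Finset.mem_image, Finset.mem_univ, true_and, Finset.inr_mem_disjSum, iff_true]
        exact ⟨Sum.inr (h0.symm (Sum.inr a)), by simp [g, l, l']⟩
    -- The columns are ordered with `Cᶜ` first, so the matrix is block lower triangular with an
    -- identity block.
    · have h1 : (borderedExt X Z).submatrix f g = Matrix.fromBlocks 1 0
          (Matrix.of fun b' k => Z (Sum.inl k.1) b')
          (Z.submatrix (fun b => l (h0 b)) id).transpose := by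
        ext (i | i) (j | j)
        · by_cases hij : i = j
          · simp [f, g, borderedExt, hij]
          · have : (i : κ) ≠ j := fun h => hij (Subtype.ext h)
            simp [f, g, borderedExt, Matrix.one_apply_ne this, Matrix.one_apply_ne hij]
        · rcases hb : h0 j with c | c
          · have : (i : κ) ≠ c := fun h => Finset.mem_compl.mp i.2 (h ▸ c.2)
            simp [f, g, borderedExt, l, l', hb, this]
          · simp [f, g, borderedExt, l, l', hb]
        · simp [f, g, borderedExt]
        · rcases hb : h0 j with c | c <;> simp [f, g, borderedExt, l, l', hb]
      rw [h1, Matrix.det_fromBlocks_zero₁₂, Matrix.det_one, one_mul, Matrix.det_transpose]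
      refine pm_minor Z (hl.comp h0.injective) Function.injective_id ?_ (by simp)
      ext (k | a)
      · simp only [Finset.mem_image, Finset.mem_univ, true_and, Function.comp,
          Finset.inl_mem_disjSum]
        constructor
        · rintro ⟨b, hb⟩
          rcases hb' : h0 b with c | c <;> simp [l, hb'] at hb
          exact hb ▸ c.2
        · intro hk
          exact ⟨h0.symm (Sum.inl ⟨k, hk⟩), by simp [l]⟩
      · simp only [Finset.mem_image, Finset.mem_univ, true_and, Function.comp,
          Finset.inr_mem_disjSum, iff_true]
        exact ⟨h0.symm (Sum.inr a), by simp [l]⟩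
  · rw [minor_of_card_ne Z h, minor_of_card_ne]
    · exact PM.refl 0
    · intro h'
      apply h
      simp only [Finset.card_disjSum, Finset.card_univ, Finset.card_empty, Finset.card_compl] at h' ⊢
      have := Finset.card_le_univ C
      omega

/-- The Cauchy-Binet formula for a bordered product, up to the signs of the terms. -/
theorem exists_det_bordered (X : Matrix (κ ⊕ α) β R) (Z : Matrix (κ ⊕ α') β' R)
    (e : β' ⊕ α ≃ β ⊕ α') :
    ∃ ε : Finset κ → R, (∀ C, PM (ε C) 1) ∧ ((bordered X Z).submatrix id e).det =
      ∑ C, ε C * (minor X (C.disjSum Finset.univ) Finset.univ *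
        minor Z (C.disjSum Finset.univ) Finset.univ) := by
  obtain ⟨ε, hε, h⟩ := exists_laplace_cols (borderedExt X Z) (Equiv.sumCongr (Equiv.refl κ) e)
    ((∅ : Finset κ).disjSum ((Finset.univ : Finset β).disjSum ∅))
  rw [det_borderedExt] at h
  let F : Finset κ → Finset (κ ⊕ (β' ⊕ α)) := fun C =>
    C.disjSum ((∅ : Finset β').disjSum Finset.univ)
  have ht : ((∅ : Finset κ).disjSum ((Finset.univ : Finset β).disjSum (∅ : Finset α')))ᶜ =
      (Finset.univ : Finset κ).disjSum ((∅ : Finset β).disjSum Finset.univ) := by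
    ext (i | i | i) <;> simp
  have hF : ∀ C, (F C)ᶜ = Cᶜ.disjSum ((Finset.univ : Finset β').disjSum ∅) := by
    intro C
    ext (i | i | i) <;> simp [F]
  choose δ hδ hδ' using fun C => ((pm_minor_borderedExt_left X Z C).mul
    (pm_minor_borderedExt_right X Z C)).exists_mul
  refine ⟨fun C => ε (F C) * δ C, fun C => by simpa using (hε _).mul (hδ C), ?_⟩
  rw [h]
  symm
  refine Finset.sum_of_injOn F ?_ (by simp) ?_ ?_
  · intro C _ C' _ hCC
    ext k
    have := congrArg (Sum.inl k ∈ ·) hCC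
    simpa [F] using this
  -- Only the row sets `F C` survive: a row from `β'` is zero in the columns of `β`, and a row from
  -- `α` left to the complement is zero in all complementary columns.
  · intro s _ hs
    rcases Classical.em (∃ b, Sum.inr (Sum.inl b) ∈ s) with ⟨b, hb⟩ | hb
    · rw [minor_eq_zero_of_row hb, zero_mul, mul_zero]
      rintro (j | j | j) hj <;> simp [borderedExt] at hj ⊢
    · rcases Classical.em (∃ a, Sum.inr (Sum.inr a) ∉ s) with ⟨a, ha⟩ | ha
      · rw [minor_eq_zero_of_row (s := sᶜ) (i := Sum.inr (Sum.inr a)) (by simpa using ha), mul_zero,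
          mul_zero]
        rw [ht]
        rintro (j | j | j) hj <;> simp [borderedExt] at hj ⊢
      · exfalso
        push Not at ha hb
        refine hs ⟨Finset.univ.filter fun k => Sum.inl k ∈ s, by simp, ?_⟩
        ext (i | i | i) <;> simp [F, ha, hb]
  · intro C _
    rw [ht, hF, hδ' C, mul_assoc]

end Bordered

/-! ### Orders and weights of column sets -/

section Columns

variable {m : ℕ}

/-- The number of elements of `A` below `N`. -/
def cnt (A : Finset (Fin m)) (N : ℕ) : ℕ := (A.filter fun a : Fin m => (a : ℕ) < N).card

/-- The order of the columns of semistandard tableaux. -/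
def ColLE (A A' : Finset (Fin m)) : Prop := ∀ N, cnt A' N ≤ cnt A N

/-- The compatibility of a column with a dual column in standard rational tableaux. -/
def Mix (A A' : Finset (Fin m)) : Prop := ∀ N, N ≤ m → cnt A N + cnt A' N ≤ N

/-- A weight of column sets. -/
def wt (A : Finset (Fin m)) : ℕ := ∑ a ∈ A, 2 ^ (a : ℕ)

theorem card_filter_coe {α : Type*} (A : Finset α) (p : α → Prop) [DecidablePred p] :
    (Finset.univ.filter fun a : A => p a).card = (A.filter p).card := by
  rw [← Finset.card_map (Function.Embedding.subtype _)]
  congr 1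
  ext a
  simp [and_comm]

theorem cnt_le_card (A : Finset (Fin m)) (N : ℕ) : cnt A N ≤ A.card := Finset.card_filter_le _ _

theorem cnt_add_card_filter (A : Finset (Fin m)) (N : ℕ) :
    cnt A N + (A.filter fun a : Fin m => N ≤ (a : ℕ)).card = A.card := by
  rw [cnt, ← Finset.card_filter_add_card_filter_not (s := A) fun a : Fin m => (a : ℕ) < N]
  simp only [not_lt]

theorem cnt_univ {N : ℕ} (hN : N ≤ m) : cnt (Finset.univ : Finset (Fin m)) N = N := by
  have h : (Finset.univ.filter fun a : Fin m => (a : ℕ) < N) =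
      Finset.univ.image (Fin.castLE hN) := by
    ext a
    simp only [Finset.mem_filter, Finset.mem_univ, true_and, Finset.mem_image]
    constructor
    · intro h; exact ⟨⟨a, h⟩, rfl⟩
    · rintro ⟨b, rfl⟩; exact b.2
  rw [cnt, h, Finset.card_image_of_injective _ (Fin.castLE_injective hN)]
  simp

theorem cnt_top (A : Finset (Fin m)) {N : ℕ} (hN : m ≤ N) : cnt A N = A.card := by
  rw [cnt, Finset.filter_true_of_mem]
  intro a _; omega

theorem cnt_add_cnt_compl (A : Finset (Fin m)) {N : ℕ} (hN : N ≤ m) : cnt A N + cnt Aᶜ N = N := by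
  rw [cnt, cnt, ← Finset.card_union_of_disjoint, ← Finset.filter_union, Finset.union_compl]
  · exact cnt_univ hN
  · exact Finset.disjoint_filter_filter disjoint_compl_right

theorem wt_le (A : Finset (Fin m)) : wt A ≤ 2 ^ m * m := by
  calc wt A ≤ ∑ _a ∈ A, 2 ^ m :=
        Finset.sum_le_sum fun a _ => Nat.pow_le_pow_right (by norm_num) a.2.le
    _ ≤ 2 ^ m * m := by
      rw [Finset.sum_const, smul_eq_mul, mul_comm]
      exact Nat.mul_le_mul_left _ (by simpa using Finset.card_le_univ A)

theorem cnt_succ (A : Finset (Fin m)) (a : Fin m) :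
    cnt A (a + 1) = cnt A a + if a ∈ A then 1 else 0 := by
  have h : (A.filter fun b : Fin m => (b : ℕ) < a + 1) =
      (A.filter fun b : Fin m => (b : ℕ) < a) ∪ if a ∈ A then {a} else ∅ := by
    ext b
    by_cases hb : b = a
    · subst hb; split_ifs <;> simp [*]
    · have : (b : ℕ) ≠ a := fun h => hb (Fin.ext h)
      have : (b : ℕ) < a + 1 ↔ (b : ℕ) < a := by omega
      simp only [Finset.mem_filter, Finset.mem_union, this]
      split_ifs <;> simp [hb]
  rw [cnt, cnt, h, Finset.card_union_of_disjoint]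
  · split_ifs <;> simp
  · split_ifs <;> simp

theorem eq_of_cnt_eq {A A' : Finset (Fin m)} (h : ∀ N, cnt A N = cnt A' N) : A = A' := by
  ext a
  have h1 := cnt_succ A a
  have h2 := cnt_succ A' a
  rw [h, h] at h1
  by_cases ha : a ∈ A <;> by_cases ha' : a ∈ A' <;> simp [ha, ha'] at h1 h2 ⊢ <;> omega

end Columns

/-! ### Products of minors -/

section TabSpan

variable {K R τ : Type*} [CommRing K] [CommRing R] [Algebra K R] {m : ℕ}

/-- The product of the minors of the matrices `Mt` listed by `s`. -/
def prodMinors (Mt : τ → Matrix (Fin m) (Fin m) R)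
    (s : Multiset (τ × Finset (Fin m) × Finset (Fin m))) : R :=
  (s.map fun p => minor (Mt p.1) p.2.1 p.2.2).prod

/-- All minors in the list have as many rows as columns, and at least one. -/
def IsTab (s : Multiset (τ × Finset (Fin m) × Finset (Fin m))) : Prop :=
  ∀ p ∈ s, p.2.1.card = p.2.2.card ∧ p.2.1.card ≠ 0

/-- The total size of the minors in the list. -/
def tabDeg (s : Multiset (τ × Finset (Fin m) × Finset (Fin m))) : ℕ :=
  (s.map fun p => p.2.1.card).sum

/-- A measure of the shape that prefers large minors. -/
def tabMeas (s : Multiset (τ × Finset (Fin m) × Finset (Fin m))) : ℕ :=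
  (s.map fun p => 3 ^ p.2.1.card - 1).sum

variable (K)

/-- The span of the products of minors of total size `d` and of measure at least `N`. -/
def tabSpan (Mt : τ → Matrix (Fin m) (Fin m) R) (d N : ℕ) : Submodule K R :=
  Submodule.span K {x | ∃ s, IsTab s ∧ tabDeg s = d ∧ N ≤ tabMeas s ∧ x = prodMinors Mt s}

variable {K} {Mt : τ → Matrix (Fin m) (Fin m) R}

theorem tabSpan_anti {d N N' : ℕ} (h : N' ≤ N) : tabSpan K Mt d N ≤ tabSpan K Mt d N' := by
  refine Submodule.span_mono ?_
  rintro x ⟨s, h1, h2, h3, h4⟩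
  exact ⟨s, h1, h2, h.trans h3, h4⟩

theorem mul_mem_tabSpan {d d' N N' : ℕ} {x y : R} (hx : x ∈ tabSpan K Mt d N)
    (hy : y ∈ tabSpan K Mt d' N') : x * y ∈ tabSpan K Mt (d + d') (N + N') := by
  have h := Submodule.mul_mem_mul hx hy
  rw [tabSpan, tabSpan, Submodule.span_mul_span] at h
  refine Submodule.span_mono ?_ h
  rintro _ ⟨x, ⟨s, hs, hd, hN, rfl⟩, y, ⟨s', hs', hd', hN', rfl⟩, rfl⟩
  refine ⟨s + s', ?_, ?_, ?_, ?_⟩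
  · intro p hp
    rcases Multiset.mem_add.mp hp with hp | hp
    · exact hs p hp
    · exact hs' p hp
  · simp only [tabDeg, Multiset.map_add, Multiset.sum_add] at hd hd' ⊢
    omega
  · simp only [tabMeas, Multiset.map_add, Multiset.sum_add] at hN hN' ⊢
    omega
  · simp [prodMinors]

theorem one_mem_tabSpan : (1 : R) ∈ tabSpan K Mt 0 0 :=
  Submodule.subset_span ⟨0, by simp [IsTab], by simp [tabDeg], by simp, by simp [prodMinors]⟩

theorem prod_mem_tabSpan {ι : Type*} (s : Finset ι) {d N : ι → ℕ} {f : ι → R}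
    (h : ∀ i ∈ s, f i ∈ tabSpan K Mt (d i) (N i)) :
    ∏ i ∈ s, f i ∈ tabSpan K Mt (∑ i ∈ s, d i) (∑ i ∈ s, N i) := by
  classical
  induction s using Finset.induction_on with
  | empty => simpa using one_mem_tabSpan
  | insert a s ha ih =>
    rw [Finset.prod_insert ha, Finset.sum_insert ha, Finset.sum_insert ha]
    exact mul_mem_tabSpan (h a (Finset.mem_insert_self a s))
      (ih fun i hi => h i (Finset.mem_insert_of_mem hi))

theorem minor_mem_tabSpan (i : τ) (A B : Finset (Fin m)) :
    minor (Mt i) A B ∈ tabSpan K Mt A.card (3 ^ A.card - 1) := by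
  by_cases h : A.card = B.card
  · by_cases h0 : A.card = 0
    · have hA := Finset.card_eq_zero.mp h0
      have hB := Finset.card_eq_zero.mp (h ▸ h0)
      subst hA hB
      have : minor (Mt i) ∅ ∅ = 1 := by
        rw [minor, dif_pos rfl, Matrix.det_isEmpty]
      rw [this]
      simpa using one_mem_tabSpan
    · refine Submodule.subset_span ⟨{(i, A, B)}, ?_, ?_, ?_, ?_⟩
      · intro p hp
        rw [Multiset.mem_singleton] at hp
        subst hp
        exact ⟨h, h0⟩
      · simp [tabDeg]
      · simp [tabMeas]
      · simp [prodMinors]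
  · rw [minor_of_card_ne _ h]
    exact zero_mem _

/-- A minor of a matrix with some entries replaced by zero need not be a minor of the original
matrix, so it is expanded into products of `1 × 1` minors. The trivial bound `0` on the measure
suffices where this is used. -/
theorem minor_mem_tabSpan_of_entries {ρ γ : Type*} [DecidableEq ρ] [DecidableEq γ]
    {G : Matrix ρ γ R} (i : τ) (hG : ∀ a b, G a b = 0 ∨ ∃ a' b', G a b = Mt i a' b') (s : Finset ρ)
    (t : Finset γ) : minor G s t ∈ tabSpan K Mt s.card 0 := by
  unfold minor
  split_ifs with h
  · rw [Matrix.det_apply]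
    refine Submodule.sum_mem _ fun σ _ => ?_
    have h1 : ∏ j, G.submatrix (fun a : s => (a : ρ))
        (fun a : s => (Finset.equivOfCardEq h a : γ)) (σ j) j ∈ tabSpan K Mt s.card 0 := by
      have h2 := prod_mem_tabSpan (K := K) (Mt := Mt) (Finset.univ : Finset s) (d := fun _ => 1)
        (N := fun _ => 0) (f := fun j => G.submatrix (fun a : s => (a : ρ))
          (fun a : s => (Finset.equivOfCardEq h a : γ)) (σ j) j) ?_
      · simpa using h2
      · intro j _
        rw [Matrix.submatrix_apply]
        rcases hG (σ j) (Finset.equivOfCardEq h j) with h3 | ⟨a', b', h3⟩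
        · rw [h3]; exact zero_mem _
        · rw [h3, ← minor_singleton (Mt i)]
          exact tabSpan_anti (Nat.zero_le _)
            (by simpa using minor_mem_tabSpan (K := K) (Mt := Mt) i {a'} {b'})
    rcases Int.units_eq_one_or (Equiv.Perm.sign σ) with h3 | h3 <;> simp only [h3]
    · simpa using h1
    · simpa using neg_mem h1
  · exact zero_mem _

/-- The exchange relation for two columns of the same matrix. -/
theorem exchange (i : τ) {A A' B B' : Finset (Fin m)} (hAB : A.card = B.card)
    (hAB' : A'.card = B'.card) (hle : A'.card ≤ A.card) {N : ℕ} (hN : cnt A N < cnt A' N) :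
    minor (Mt i) A B * minor (Mt i) A' B' ∈
      Submodule.span K {x | ∃ P P', P.card = A.card ∧ P'.card = A'.card ∧
        wt P + wt P' = wt A + wt A' ∧ wt P < wt A ∧
        x = minor (Mt i) P B * minor (Mt i) P' B'} ⊔
      tabSpan K Mt (A.card + A'.card) (3 ^ A.card - 1 + (3 ^ A'.card - 1) + 1) := by
  classical
  set M := Mt i with hM
  let lab : A ⊕ A' → Fin m := Sum.elim Subtype.val Subtype.val
  let lab' : B ⊕ B' → Fin m := Sum.elim Subtype.val Subtype.val
  -- The diagonal blocks are the two given minors. Off the diagonal, `M` is kept only in the rows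
  -- that may be exchanged: those of `A` from `N` on and those of `A'` below `N`.
  let G : Matrix (A ⊕ A') (B ⊕ B') R := Matrix.fromBlocks (Matrix.of fun a b => M a b)
    (Matrix.of fun a b => if N ≤ (a : Fin m) then M a b else 0)
    (Matrix.of fun a b => if ((a : Fin m) : ℕ) < N then M a b else 0)
    (Matrix.of fun a b => M a b)
  have hcard : Fintype.card (A ⊕ A') = Fintype.card (B ⊕ B') := by simp [hAB, hAB']
  let e : A ⊕ A' ≃ B ⊕ B' := Fintype.equivOfCardEq hcard
  -- the expansion along the rows that occur in one block only
  have hrow : (G.submatrix id e).det ∈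
      tabSpan K Mt (A.card + A'.card) (3 ^ A.card - 1 + (3 ^ A'.card - 1) + 1) := by
    let s : Finset (A ⊕ A') := Finset.univ.filter fun x =>
      Sum.elim (fun a : A => ((a : Fin m) : ℕ) < N) (fun a : A' => N ≤ ((a : Fin m) : ℕ)) x
    -- The complement of `s` consists of the rows that carry `M` in both blocks. There are more than
    -- `A.card` of them, because `cnt A N < cnt A' N`; this produces a larger minor.
    have hsc : sᶜ.card = (A.filter fun a : Fin m => N ≤ (a : ℕ)).card + cnt A' N := by
      have h1 : sᶜ = (Finset.univ.filter fun a : A => N ≤ ((a : Fin m) : ℕ)).disjSum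
          (Finset.univ.filter fun a : A' => ((a : Fin m) : ℕ) < N) := by
        ext (a | a) <;> simp [s]
      rw [h1, Finset.card_disjSum, cnt]
      congr 1
      · exact card_filter_coe A fun a => N ≤ (a : ℕ)
      · exact card_filter_coe A' fun a => (a : ℕ) < N
    have hs : s.card + sᶜ.card = A.card + A'.card := by
      rw [Finset.card_add_card_compl]; simp
    obtain ⟨ε, hε, h⟩ := exists_laplace_rows G e s
    rw [h]
    refine Submodule.sum_mem _ fun t _ => ?_
    have hε' : PM (ε t * (minor G s t * minor G sᶜ tᶜ)) (minor G s t * minor G sᶜ tᶜ) := by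
      simpa using (hε t).mul (PM.refl (minor G s t * minor G sᶜ tᶜ))
    rw [hε'.mem_iff]
    have h1 : minor G s t ∈ tabSpan K Mt s.card 0 := by
      refine minor_mem_tabSpan_of_entries i ?_ s t
      rintro (a | a) (b | b)
      · exact Or.inr ⟨a, b, rfl⟩
      · by_cases hc : N ≤ ((a : Fin m) : ℕ)
        · exact Or.inr ⟨a, b, by simp [G, hc, hM]⟩
        · exact Or.inl (by simp [G, hc])
      · by_cases hc : ((a : Fin m) : ℕ) < N
        · exact Or.inr ⟨a, b, by simp [G, hc, hM]⟩
        · exact Or.inl (by simp [G, hc])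
      · exact Or.inr ⟨a, b, rfl⟩
    have h2 : minor G sᶜ tᶜ ∈ tabSpan K Mt sᶜ.card (3 ^ sᶜ.card - 1) := by
      have hlab : ∀ a ∈ sᶜ, ∀ b ∈ tᶜ, G a b = M (lab a) (lab' b) := by
        rintro (a | a) ha (b | b) _ <;> simp [s] at ha <;> simp [G, lab, lab', ha]
      by_cases hinj : Set.InjOn lab ↑sᶜ ∧ Set.InjOn lab' ↑tᶜ
      · rw [(pm_minor_of_labels hlab hinj.1 hinj.2).mem_iff]
        have := minor_mem_tabSpan (K := K) (Mt := Mt) i (sᶜ.image lab) (tᶜ.image lab')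
        rwa [Finset.card_image_of_injOn hinj.1] at this
      · rw [minor_eq_zero_of_labels hlab hinj]
        exact zero_mem _
    have h3 := mul_mem_tabSpan h1 h2
    rw [hs] at h3
    refine tabSpan_anti ?_ h3
    have h4 := cnt_add_card_filter A N
    have h5 : A.card + 1 ≤ sᶜ.card := by omega
    -- One minor of size at least `A.card + 1` outweighs both given minors in the measure, since
    -- `A'.card ≤ A.card`; the other factor contributes `0`.
    have h6 : 3 ^ (A.card + 1) ≤ 3 ^ sᶜ.card := Nat.pow_le_pow_right (by norm_num) h5
    have h7 : 3 ^ A'.card ≤ 3 ^ A.card := Nat.pow_le_pow_right (by norm_num) hle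
    have h8 : 0 < 3 ^ A'.card := by positivity
    rw [pow_succ] at h6
    omega
  -- the expansion along the columns of the first block
  let t : Finset (B ⊕ B') := (Finset.univ : Finset B).disjSum ∅
  have htc : tᶜ = (∅ : Finset B).disjSum Finset.univ := by
    ext (b | b) <;> simp [t]
  obtain ⟨ε, hε, h⟩ := exists_laplace_cols G e t
  let s0 : Finset (A ⊕ A') := (Finset.univ : Finset A).disjSum ∅
  have hs0c : s0ᶜ = (∅ : Finset A).disjSum Finset.univ := by
    ext (b | b) <;> simp [s0]
  have hlabt : Set.InjOn lab' t := by
    rintro (b | b) hb (c | c) hc <;> simp [lab', t] at hb hc ⊢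
  have hlabtc : Set.InjOn lab' ↑tᶜ := by
    rw [htc]
    rintro (b | b) hb (c | c) hc <;> simp [lab'] at hb hc ⊢
  have himt : t.image lab' = B := by ext b; simp [lab', t]
  have himtc : tᶜ.image lab' = B' := by rw [htc]; ext b; simp [lab']
  have hterm0 : PM (minor G s0 t * minor G s0ᶜ tᶜ) (minor M A B * minor M A' B') := by
    refine PM.mul ?_ ?_
    · have h1 := pm_minor_of_labels (G := G) (M := M) (f := lab) (g := lab') (s := s0) (t := t)
        ?_ ?_ hlabt
      · rw [himt] at h1
        convert h1 using 2
        ext a; simp [lab, s0]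
      · rintro (a | a) ha (b | b) hb <;> simp [s0, t] at ha hb ⊢
        simp [G, lab, lab']
      · rintro (b | b) hb (c | c) hc <;> simp [lab, s0] at hb hc ⊢
    · have h1 := pm_minor_of_labels (G := G) (M := M) (f := lab) (g := lab') (s := s0ᶜ) (t := tᶜ)
        ?_ ?_ hlabtc
      · rw [himtc] at h1
        convert h1 using 2
        rw [hs0c]
        ext a; simp [lab]
      · rw [hs0c, htc]
        rintro (a | a) ha (b | b) hb <;> simp at ha hb ⊢
        simp [G, lab, lab']
      · rw [hs0c]
        rintro (b | b) hb (c | c) hc <;> simp [lab] at hb hc ⊢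
  -- Any other nonzero term exchanges rows of `A` from `N` on for equally many rows of `A'` below
  -- `N`; all remaining choices of `s` leave a zero row, a repeated label or a non-square minor.
  have hterm : ∀ s ≠ s0, minor G s t * minor G sᶜ tᶜ ∈
      Submodule.span K {x | ∃ P P', P.card = A.card ∧ P'.card = A'.card ∧
        wt P + wt P' = wt A + wt A' ∧ wt P < wt A ∧ x = minor M P B * minor M P' B'} := by
    intro s hs
    by_cases hcs : s.card = t.card
    swap
    · rw [minor_of_card_ne _ hcs, zero_mul]; exact zero_mem _
    by_cases h1 : ∃ a : A', N ≤ ((a : Fin m) : ℕ) ∧ Sum.inr a ∈ s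
    · obtain ⟨a, ha, has⟩ := h1
      rw [minor_eq_zero_of_row has, zero_mul]
      · exact zero_mem _
      · rintro (b | b) hb <;> simp [t] at hb ⊢
        simp [G, ha]
    by_cases h2 : ∃ a : A, ((a : Fin m) : ℕ) < N ∧ Sum.inl a ∉ s
    · obtain ⟨a, ha, has⟩ := h2
      rw [minor_eq_zero_of_row (s := sᶜ) (i := Sum.inl a) (by simpa using has), mul_zero]
      · exact zero_mem _
      · rw [htc]
        rintro (b | b) hb <;> simp at hb ⊢
        simp [G, ha]
    push Not at h1 h2
    have hl1 : ∀ a ∈ s, ∀ b ∈ t, G a b = M (lab a) (lab' b) := by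
      rintro (a | a) ha (b | b) hb <;> simp [t] at hb ⊢
      · simp [G, lab, lab']
      · have : ((a : Fin m) : ℕ) < N := by
          by_contra hcon; exact h1 a (not_lt.mp hcon) ha
        simp [G, lab, lab', this]
    have hl2 : ∀ a ∈ sᶜ, ∀ b ∈ tᶜ, G a b = M (lab a) (lab' b) := by
      rw [htc]
      rintro (a | a) ha (b | b) hb <;> simp at ha hb ⊢
      · have : N ≤ ((a : Fin m) : ℕ) := by
          by_contra hcon; exact ha (h2 a (not_le.mp hcon))
        simp [G, lab, lab', this]
      · simp [G, lab, lab']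
    by_cases hi1 : Set.InjOn lab s
    swap
    · rw [minor_eq_zero_of_labels hl1 (fun h => hi1 h.1), zero_mul]; exact zero_mem _
    by_cases hi2 : Set.InjOn lab ↑sᶜ
    swap
    · rw [minor_eq_zero_of_labels hl2 (fun h => hi2 h.1), mul_zero]; exact zero_mem _
    have hpm := (pm_minor_of_labels hl1 hi1 hlabt).mul (pm_minor_of_labels hl2 hi2 hlabtc)
    rw [himt, himtc] at hpm
    rw [hpm.mem_iff]
    have hct : t.card = A.card := by simp [t, hAB]
    have hs0card : s0.card = A.card := by simp [s0]
    have hw1 : wt (s.image lab) = ∑ x ∈ s, 2 ^ (lab x : ℕ) := Finset.sum_image hi1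
    have hw2 : wt (sᶜ.image lab) = ∑ x ∈ sᶜ, 2 ^ (lab x : ℕ) := Finset.sum_image hi2
    have hwA : wt A = ∑ x ∈ s0, 2 ^ (lab x : ℕ) := by
      simp only [s0, Finset.sum_disjSum, Finset.sum_empty, add_zero, lab, Sum.elim_inl]
      rw [wt, ← Finset.sum_coe_sort A]
    have hwA' : wt A' = ∑ x ∈ s0ᶜ, 2 ^ (lab x : ℕ) := by
      simp only [hs0c, Finset.sum_disjSum, Finset.sum_empty, zero_add, lab, Sum.elim_inr]
      rw [wt, ← Finset.sum_coe_sort A']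
    refine Submodule.subset_span ⟨_, _, ?_, ?_, ?_, ?_, rfl⟩
    · rw [Finset.card_image_of_injOn hi1, hcs, hct]
    · rw [Finset.card_image_of_injOn hi2, Finset.card_compl, hcs, hct]; simp
    · rw [hw1, hw2, hwA, hwA', Finset.sum_add_sum_compl, Finset.sum_add_sum_compl]
    · rw [hw1, hwA, ← Finset.sum_inter_add_sum_sdiff s s0, ← Finset.sum_inter_add_sum_sdiff s0 s,
        Finset.inter_comm s0 s]
      refine Nat.add_lt_add_left ?_ _
      have hcc : (s \ s0).card = (s0 \ s).card := by
        have h3 := Finset.card_sdiff_add_card_inter s s0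
        have h4 := Finset.card_sdiff_add_card_inter s0 s
        rw [Finset.inter_comm] at h4
        omega
      have hne : (s0 \ s).Nonempty := by
        rw [Finset.nonempty_iff_ne_empty]
        intro h3
        have h4 : s \ s0 = ∅ := by rw [← Finset.card_eq_zero, hcc, h3, Finset.card_empty]
        exact hs (Finset.Subset.antisymm (Finset.sdiff_eq_empty_iff_subset.mp h4)
          (Finset.sdiff_eq_empty_iff_subset.mp h3))
      have hne' : (s \ s0).Nonempty := by
        rw [← Finset.card_pos, hcc, Finset.card_pos]; exact hne
      -- The rows entering the first column lie below `N` and the rows leaving it do not, and there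
      -- are equally many of each, so its weight drops.
      calc ∑ x ∈ s \ s0, 2 ^ (lab x : ℕ) < ∑ _x ∈ s \ s0, 2 ^ N := by
            refine Finset.sum_lt_sum_of_nonempty hne' ?_
            rintro (a | a) ha
            · simp [s0] at ha
            · have ha' := (Finset.mem_sdiff.mp ha).1
              have : ((a : Fin m) : ℕ) < N := by
                by_contra hcon; exact h1 a (not_lt.mp hcon) ha'
              exact Nat.pow_lt_pow_right (by norm_num) this
        _ = ∑ _x ∈ s0 \ s, 2 ^ N := by simp [hcc]
        _ ≤ ∑ x ∈ s0 \ s, 2 ^ (lab x : ℕ) := by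
            refine Finset.sum_le_sum ?_
            rintro (a | a) ha
            · have ha' := (Finset.mem_sdiff.mp ha).2
              have : N ≤ ((a : Fin m) : ℕ) := by
                by_contra hcon; exact ha' (h2 a (not_le.mp hcon))
              exact Nat.pow_le_pow_right (by norm_num) this
            · simp [s0] at ha
  have hpm : PM (ε s0 * (minor G s0 t * minor G s0ᶜ tᶜ)) (minor M A B * minor M A' B') := by
    simpa using (hε s0).mul hterm0
  rw [← hpm.mem_iff]
  rw [← Finset.add_sum_erase _ _ (Finset.mem_univ s0)] at h
  rw [eq_comm, ← eq_sub_iff_add_eq] at h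
  rw [h]
  refine sub_mem (Submodule.mem_sup_right hrow) (Submodule.mem_sup_left ?_)
  refine Submodule.sum_mem _ fun s hs => ?_
  have hpm' : PM (ε s * (minor G s t * minor G sᶜ tᶜ)) (minor G s t * minor G sᶜ tᶜ) := by
    simpa using (hε s).mul (PM.refl (minor G s t * minor G sᶜ tᶜ))
  rw [hpm'.mem_iff]
  exact hterm s (Finset.ne_of_mem_erase hs)

end TabSpan

/-! ### The exchange relation between the two matrices. -/

section Mixed

variable {K R : Type*} [CommRing K] [CommRing R] [Algebra K R] {m : ℕ}

/-- The exchange relation for a column and a dual column. -/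
theorem mixed_exchange (X Z : Matrix (Fin m) (Fin m) R)
    (hXZ : ∀ j j', ∑ k, Z k j' * X k j = 0) {A A' B B' : Finset (Fin m)}
    (hAB : A.card = B.card) (hAB' : A'.card = B'.card) {N : ℕ} (hNm : N ≤ m)
    (hN : N < cnt A N + cnt A' N) :
    minor X A B * minor Z A' B' ∈
      Submodule.span K {x | ∃ P P', P.card = A.card ∧ P'.card = A'.card ∧
        wt A < wt P ∧ wt A' < wt P' ∧ x = minor X P B * minor Z P' B'} := by
  classical
  -- `D` collects the common entries below `N`. They are treated as a summation range and exchanged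
  -- simultaneously in both columns, while the remaining entries form the borders.
  set D : Finset (Fin m) := (A ∩ A').filter fun a => (a : ℕ) < N with hD
  have hDA : D ⊆ A := fun a ha => Finset.mem_of_mem_inter_left (Finset.mem_of_mem_filter a ha)
  have hDA' : D ⊆ A' := fun a ha => Finset.mem_of_mem_inter_right (Finset.mem_of_mem_filter a ha)
  set A₀ := A \ D with hA₀
  set A₀' := A' \ D with hA₀'
  have hcA : A₀.card + D.card = A.card := Finset.card_sdiff_add_card_eq_card hDA
  have hcA' : A₀'.card + D.card = A'.card := Finset.card_sdiff_add_card_eq_card hDA'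
  have hcard : Fintype.card (B' ⊕ A₀) = Fintype.card (B ⊕ A₀') := by
    simp only [Fintype.card_sum, Fintype.card_coe]; omega
  let e : B' ⊕ A₀ ≃ B ⊕ A₀' := Fintype.equivOfCardEq hcard
  let f (L : Finset (Fin m)) : L ⊕ A₀ → Fin m := Sum.elim Subtype.val Subtype.val
  let f' (L : Finset (Fin m)) : L ⊕ A₀' → Fin m := Sum.elim Subtype.val Subtype.val
  let XL (L : Finset (Fin m)) : Matrix (L ⊕ A₀) B R := X.submatrix (f L) Subtype.val
  let ZL (L : Finset (Fin m)) : Matrix (L ⊕ A₀') B' R := Z.submatrix (f' L) Subtype.val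
  have himB : (Finset.univ : Finset B).image Subtype.val = B := by ext; simp
  have himB' : (Finset.univ : Finset B').image Subtype.val = B' := by ext; simp
  -- the two bordered products for complementary index sets agree up to sign
  have hdet : PM ((bordered (XL D) (ZL D)).submatrix id e).det
      ((bordered (XL Dᶜ) (ZL Dᶜ)).submatrix id e).det := by
    -- The relation `ZᵀX = 0` says that the sums over `D` and over `Dᶜ` are negatives of each other.
    -- Rescaling the rows of `B'` and the columns of `A₀'` by `-1` changes this block and leaves the
    -- borders fixed.
    let v : B' ⊕ A₀ → R := Sum.elim (fun _ => -1) fun _ => 1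
    let w : B ⊕ A₀' → R := Sum.elim (fun _ => 1) fun _ => -1
    have hv : PM (∏ i, v i) 1 := by
      have := PM.prod (R := R) Finset.univ (f := v) (g := fun _ => 1) (by
        rintro (i | i) _ <;> simp [v, PM])
      simpa using this
    have hw : PM (∏ i, w (e i)) 1 := by
      have := PM.prod (R := R) Finset.univ (f := fun i => w (e i)) (g := fun _ => 1) (by
        intro i _
        rcases e i with j | j <;> simp [w, PM])
      simpa using this
    have h1 : (bordered (XL D) (ZL D)).submatrix id e = Matrix.of fun i j => v i *
        (Matrix.of fun i j => w (e j) *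
          ((bordered (XL Dᶜ) (ZL Dᶜ)).submatrix id e) i j) i j := by
      ext i j
      simp only [Matrix.of_apply, Matrix.submatrix_apply, id]
      rcases i with i | i <;> rcases e j with j | j
      · simp only [bordered, Matrix.fromBlocks_apply₁₁, Matrix.of_apply, v, w, XL, ZL, f, f',
          Sum.elim_inl, Matrix.submatrix_apply]
        have h2 := hXZ (j : Fin m) (i : Fin m)
        rw [← Finset.sum_add_sum_compl D] at h2
        rw [Finset.sum_coe_sort D fun k => Z k i * X k j,
          Finset.sum_coe_sort Dᶜ fun k => Z k i * X k j]
        linear_combination -h2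
      · simp [bordered, v, w, ZL, f']
      · simp [bordered, v, w, XL, f]
      · simp [bordered, v, w]
    rw [h1, Matrix.det_mul_column, Matrix.det_mul_row]
    simpa using hv.mul (hw.mul (PM.refl _))
  -- the expansion for `D`
  have hleft : PM (minor X A B * minor Z A' B')
      ((bordered (XL D) (ZL D)).submatrix id e).det := by
    obtain ⟨ε, hε, h⟩ := exists_det_bordered (XL D) (ZL D) e
    -- A proper subset `C` of `D` gives too few rows for the columns `B`, so only the original
    -- product remains.
    rw [h, Finset.sum_eq_single Finset.univ]
    · refine PM.symm ?_
      have h1 : PM (minor (XL D) ((Finset.univ : Finset D).disjSum Finset.univ) Finset.univ)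
          (minor X A B) := by
        have := pm_minor_of_labels (G := XL D) (M := X) (f := f D) (g := Subtype.val)
          (s := (Finset.univ : Finset D).disjSum Finset.univ) (t := Finset.univ)
          (fun _ _ _ _ => rfl) ?_ Subtype.val_injective.injOn
        · rw [himB] at this
          convert this using 2
          ext a
          by_cases ha : a ∈ D
          · simp [f, ha, hDA ha]
          · simp [f, ha, hA₀]
        · rintro (a | a) _ (b | b) _ hab
          · exact congrArg Sum.inl (Subtype.ext hab)
          · have hab' : (a : Fin m) = b := hab
            exact absurd (hab' ▸ a.2) (Finset.mem_sdiff.mp b.2).2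
          · have hab' : (a : Fin m) = b := hab
            exact absurd (hab' ▸ b.2) (Finset.mem_sdiff.mp a.2).2
          · exact congrArg Sum.inr (Subtype.ext hab)
      have h2 : PM (minor (ZL D) ((Finset.univ : Finset D).disjSum Finset.univ) Finset.univ)
          (minor Z A' B') := by
        have := pm_minor_of_labels (G := ZL D) (M := Z) (f := f' D) (g := Subtype.val)
          (s := (Finset.univ : Finset D).disjSum Finset.univ) (t := Finset.univ)
          (fun _ _ _ _ => rfl) ?_ Subtype.val_injective.injOn
        · rw [himB'] at this
          convert this using 2
          ext a
          by_cases ha : a ∈ D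
          · simp [f', ha, hDA' ha]
          · simp [f', ha, hA₀']
        · rintro (a | a) _ (b | b) _ hab
          · exact congrArg Sum.inl (Subtype.ext hab)
          · have hab' : (a : Fin m) = b := hab
            exact absurd (hab' ▸ a.2) (Finset.mem_sdiff.mp b.2).2
          · have hab' : (a : Fin m) = b := hab
            exact absurd (hab' ▸ b.2) (Finset.mem_sdiff.mp a.2).2
          · exact congrArg Sum.inr (Subtype.ext hab)
      simpa using (hε Finset.univ).mul (h1.mul h2)
    · intro C _ hC
      rw [minor_of_card_ne (XL D), zero_mul, mul_zero]
      simp only [Finset.card_disjSum, Finset.card_univ, Fintype.card_coe]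
      have := Finset.card_lt_univ_of_notMem (s := C) (x := (Finset.eq_univ_iff_forall.not.trans
        not_forall).mp hC |>.choose) ((Finset.eq_univ_iff_forall.not.trans
        not_forall).mp hC |>.choose_spec)
      rw [Fintype.card_coe] at this
      omega
    · simp
  rw [(hleft.trans hdet).mem_iff]
  -- Expanding over the complementary range replaces `D` in both columns by a set `C` of the same
  -- size disjoint from `D`.
  obtain ⟨ε, hε, h⟩ := exists_det_bordered (XL Dᶜ) (ZL Dᶜ) e
  rw [h]
  refine Submodule.sum_mem _ fun C _ => ?_
  have hpm : PM (ε C * (minor (XL Dᶜ) (C.disjSum Finset.univ) Finset.univ *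
      minor (ZL Dᶜ) (C.disjSum Finset.univ) Finset.univ))
      (minor (XL Dᶜ) (C.disjSum Finset.univ) Finset.univ *
      minor (ZL Dᶜ) (C.disjSum Finset.univ) Finset.univ) := by
    simpa using (hε C).mul (PM.refl (minor (XL Dᶜ) (C.disjSum Finset.univ) Finset.univ *
      minor (ZL Dᶜ) (C.disjSum Finset.univ) Finset.univ))
  rw [hpm.mem_iff]
  by_cases hcC : C.card = D.card
  swap
  · rw [minor_of_card_ne (XL Dᶜ), zero_mul]
    · exact zero_mem _
    · simp only [Finset.card_disjSum, Finset.card_univ, Fintype.card_coe]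
      omega
  by_cases hi : Set.InjOn (f Dᶜ) (C.disjSum (Finset.univ : Finset A₀))
  swap
  · rw [minor_eq_zero_of_labels (G := XL Dᶜ) (M := X) (f := f Dᶜ) (g := Subtype.val)
      (fun _ _ _ _ => rfl) fun h => hi h.1, zero_mul]
    exact zero_mem _
  by_cases hi' : Set.InjOn (f' Dᶜ) (C.disjSum (Finset.univ : Finset A₀'))
  swap
  · rw [minor_eq_zero_of_labels (G := ZL Dᶜ) (M := Z) (f := f' Dᶜ) (g := Subtype.val)
      (fun _ _ _ _ => rfl) fun h => hi' h.1, mul_zero]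
    exact zero_mem _
  have h1 := pm_minor_of_labels (G := XL Dᶜ) (M := X) (f := f Dᶜ) (g := Subtype.val)
    (s := C.disjSum Finset.univ) (t := Finset.univ) (fun _ _ _ _ => rfl) hi
    Subtype.val_injective.injOn
  have h2 := pm_minor_of_labels (G := ZL Dᶜ) (M := Z) (f := f' Dᶜ) (g := Subtype.val)
    (s := C.disjSum Finset.univ) (t := Finset.univ) (fun _ _ _ _ => rfl) hi'
    Subtype.val_injective.injOn
  rw [himB] at h1
  rw [himB'] at h2
  rw [(h1.mul h2).mem_iff]
  have hw : wt D < ∑ c ∈ C, 2 ^ ((c : Fin m) : ℕ) := by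
    -- In a nonzero term `C` avoids `A` and `A'`. Below `N` there are only `N - cnt A N - cnt A' N +
    -- D.card < D.card` places outside their union, so `C` cannot fit there.
    have hex : ∃ c ∈ C, N ≤ ((c : Fin m) : ℕ) := by
      by_contra hcon
      push Not at hcon
      have hdisj : Disjoint (C.image Subtype.val) ((A ∪ A').filter fun a => (a : ℕ) < N) := by
        rw [Finset.disjoint_left]
        intro a ha ha'
        obtain ⟨c, hc, rfl⟩ := Finset.mem_image.mp ha
        have hcD : (c : Fin m) ∉ D := Finset.mem_compl.mp c.2
        rcases Finset.mem_union.mp (Finset.mem_filter.mp ha').1 with h3 | h3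
        · have := hi (x₁ := Sum.inl c) (x₂ := Sum.inr ⟨c, Finset.mem_sdiff.mpr ⟨h3, hcD⟩⟩)
            (by simpa using hc) (by simp) rfl
          simp at this
        · have := hi' (x₁ := Sum.inl c) (x₂ := Sum.inr ⟨c, Finset.mem_sdiff.mpr ⟨h3, hcD⟩⟩)
            (by simpa using hc) (by simp) rfl
          simp at this
      have h3 : (C.image Subtype.val ∪ (A ∪ A').filter fun a => (a : ℕ) < N).card ≤
          cnt (Finset.univ : Finset (Fin m)) N := by
        refine Finset.card_le_card fun a ha => ?_
        simp only [Finset.mem_filter, Finset.mem_univ, true_and]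
        rcases Finset.mem_union.mp ha with ha | ha
        · obtain ⟨c, hc, rfl⟩ := Finset.mem_image.mp ha
          exact hcon c hc
        · exact (Finset.mem_filter.mp ha).2
      rw [cnt_univ hNm, Finset.card_union_of_disjoint hdisj,
        Finset.card_image_of_injective _ Subtype.val_injective, Finset.filter_union] at h3
      have h4 := Finset.card_union_add_card_inter (A.filter fun a : Fin m => (a : ℕ) < N)
        (A'.filter fun a : Fin m => (a : ℕ) < N)
      rw [← Finset.filter_inter_distrib, ← hD] at h4
      simp only [cnt] at hN
      omega
    obtain ⟨c, hc, hcN⟩ := hex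
    -- Binary weights: a single entry from `N` on outweighs all entries below `N` together.
    calc wt D = ∑ k ∈ D.map Fin.valEmbedding, 2 ^ k := by rw [Finset.sum_map]; rfl
      _ < 2 ^ N := Nat.geomSum_lt le_rfl (by
          intro k hk
          obtain ⟨a, ha, rfl⟩ := Finset.mem_map.mp hk
          exact (Finset.mem_filter.mp ha).2)
      _ ≤ 2 ^ ((c : Fin m) : ℕ) := Nat.pow_le_pow_right (by norm_num) hcN
      _ ≤ _ := Finset.single_le_sum (f := fun c : (Dᶜ : Finset (Fin m)) => 2 ^ ((c : Fin m) : ℕ))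
          (fun _ _ => Nat.zero_le _) hc
  refine Submodule.subset_span ⟨_, _, ?_, ?_, ?_, ?_, rfl⟩
  · rw [Finset.card_image_of_injOn hi]
    simp only [Finset.card_disjSum, Finset.card_univ, Fintype.card_coe]
    omega
  · rw [Finset.card_image_of_injOn hi']
    simp only [Finset.card_disjSum, Finset.card_univ, Fintype.card_coe]
    omega
  · have h3 : wt ((C.disjSum Finset.univ).image (f Dᶜ)) =
        ∑ c ∈ C, 2 ^ ((c : Fin m) : ℕ) + wt A₀ := by
      rw [wt, Finset.sum_image hi, Finset.sum_disjSum, wt, ← Finset.sum_coe_sort A₀]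
      rfl
    have h4 : wt A = wt D + wt A₀ := by
      rw [wt, ← Finset.sum_sdiff hDA, add_comm]; rfl
    omega
  · have h3 : wt ((C.disjSum Finset.univ).image (f' Dᶜ)) =
        ∑ c ∈ C, 2 ^ ((c : Fin m) : ℕ) + wt A₀' := by
      rw [wt, Finset.sum_image hi', Finset.sum_disjSum, wt, ← Finset.sum_coe_sort A₀']
      rfl
    have h4 : wt A' = wt D + wt A₀' := by
      rw [wt, ← Finset.sum_sdiff hDA', add_comm]; rfl
    omega

end Mixed

/-! ### Straightening -/

section Straighten

variable {K R : Type*} [CommRing K] [CommRing R] [Algebra K R] {m : ℕ}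
variable {ι : Type*} [Fintype ι] [DecidableEq ι]

/-- The product of minors given by two fillings of the same shape. -/
def fillVal (Mt : Bool → Matrix (Fin m) (Fin m) R) (tag : ι → Bool) (S T : ι → Finset (Fin m)) : R :=
  ∏ q, minor (Mt (tag q)) (S q) (T q)

/-- Standard fillings. -/
def FillStd (tag : ι → Bool) (pos : ι → ℕ) (S : ι → Finset (Fin m)) : Prop :=
  (∀ q q', tag q = tag q' → pos q < pos q' → ColLE (S q) (S q')) ∧
    ∀ q q', tag q = true → tag q' = false → Mix (S q) (S q')

/-- An exchange between two columns may be carried out inside a longer product: the other columns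
are untouched, so the increase of the position-weighted sum and of the measure persists. -/
theorem fillVal_step {Mt : Bool → Matrix (Fin m) (Fin m) R} (tag : ι → Bool) (pos : ι → ℕ)
    {S T : ι → Finset (Fin m)} (hST : ∀ q, (S q).card = (T q).card) {q q' : ι} (hq : q ≠ q')
    (h : minor (Mt (tag q)) (S q) (T q) * minor (Mt (tag q')) (S q') (T q') ∈
      Submodule.span K {x | ∃ P P', P.card = (S q).card ∧ P'.card = (S q').card ∧
        pos q * wt (S q) + pos q' * wt (S q') < pos q * wt P + pos q' * wt P' ∧
        x = minor (Mt (tag q)) P (T q) * minor (Mt (tag q')) P' (T q')} ⊔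
      tabSpan K Mt ((S q).card + (S q').card)
        (3 ^ (S q).card - 1 + (3 ^ (S q').card - 1) + 1)) :
    fillVal Mt tag S T ∈ Submodule.span K {x | ∃ S₁ : ι → Finset (Fin m),
        (∀ q, (S₁ q).card = (T q).card) ∧ ∑ q, pos q * wt (S q) < ∑ q, pos q * wt (S₁ q) ∧
        x = fillVal Mt tag S₁ T} ⊔
      tabSpan K Mt (∑ q, (T q).card) (∑ q, (3 ^ (T q).card - 1) + 1) := by
  set E := (Finset.univ.erase q).erase q' with hE
  have hq' : q' ∈ Finset.univ.erase q := Finset.mem_erase.mpr ⟨hq.symm, Finset.mem_univ _⟩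
  have hsplit : ∀ f : ι → R, ∏ x, f x = f q * f q' * ∏ x ∈ E, f x := by
    intro f
    rw [← Finset.mul_prod_erase _ f (Finset.mem_univ q), ← Finset.mul_prod_erase _ f hq', mul_assoc]
  have hsplit' : ∀ f : ι → ℕ, ∑ x, f x = f q + f q' + ∑ x ∈ E, f x := by
    intro f
    rw [← Finset.add_sum_erase _ f (Finset.mem_univ q), ← Finset.add_sum_erase _ f hq', add_assoc]
  rw [fillVal, hsplit]
  set r := ∏ x ∈ E, minor (Mt (tag x)) (S x) (T x) with hr
  have hrm : r ∈ tabSpan K Mt (∑ x ∈ E, (S x).card) (∑ x ∈ E, (3 ^ (S x).card - 1)) :=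
    prod_mem_tabSpan E fun x _ => minor_mem_tabSpan _ _ _
  rw [← LinearMap.mulRight_apply (R := K), ← Submodule.mem_comap]
  refine SetLike.le_def.mp (sup_le ?_ ?_) h
  · rw [Submodule.span_le]
    rintro _ ⟨P, P', hP, hP', hlt, rfl⟩
    refine Submodule.mem_sup_left (Submodule.subset_span ?_)
    have h1 : ∀ x ∈ E, Function.update (Function.update S q P) q' P' x = S x := by
      intro x hx
      rw [Function.update_of_ne (Finset.ne_of_mem_erase hx),
        Function.update_of_ne (Finset.ne_of_mem_erase (Finset.mem_of_mem_erase hx))]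
    have h2 : Function.update (Function.update S q P) q' P' q = P := by
      rw [Function.update_of_ne hq, Function.update_self]
    have h3 : Function.update (Function.update S q P) q' P' q' = P' := Function.update_self _ _ _
    refine ⟨Function.update (Function.update S q P) q' P', ?_, ?_, ?_⟩
    · intro x
      by_cases hx : x = q'
      · subst hx; rw [h3, hP', hST]
      by_cases hx' : x = q
      · subst hx'; rw [h2, hP, hST]
      rw [h1 x (by simp [hE, hx, hx']), hST]
    · rw [hsplit', hsplit', h2, h3]
      have h4 : ∑ x ∈ E, pos x * wt (Function.update (Function.update S q P) q' P' x) =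
          ∑ x ∈ E, pos x * wt (S x) := Finset.sum_congr rfl fun x hx => by rw [h1 x hx]
      omega
    · rw [fillVal, hsplit, h2, h3, Finset.prod_congr rfl fun x hx => by rw [h1 x hx]]
      rfl
  · intro x hx
    refine Submodule.mem_sup_right ?_
    rw [hsplit', hsplit']
    simp only [← hST]
    exact tabSpan_anti (by omega) (mul_mem_tabSpan hx hrm)

/-- A violation of standardness is removed by an exchange. Both kinds of exchange strictly increase
the sum of the column weights multiplied by the positions, and this sum is bounded; hence the
process ends in standard fillings, up to products of larger measure. The column sets `T` stay fixed.
-/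
theorem fill_straighten {Mt : Bool → Matrix (Fin m) (Fin m) R}
    (hXZ : ∀ j j', ∑ k, Mt false k j' * Mt true k j = 0) (tag : ι → Bool) (pos : ι → ℕ)
    (hpos : ∀ q, pos q ≠ 0) {T : ι → Finset (Fin m)}
    (hT : ∀ q q', tag q = tag q' → pos q < pos q' → (T q').card ≤ (T q).card)
    (S : ι → Finset (Fin m)) (hST : ∀ q, (S q).card = (T q).card) :
    fillVal Mt tag S T ∈ Submodule.span K {x | ∃ S₁ : ι → Finset (Fin m),
        (∀ q, (S₁ q).card = (T q).card) ∧ FillStd tag pos S₁ ∧ x = fillVal Mt tag S₁ T} ⊔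
      tabSpan K Mt (∑ q, (T q).card) (∑ q, (3 ^ (T q).card - 1) + 1) := by
  have hbound : ∀ S : ι → Finset (Fin m), ∑ q, pos q * wt (S q) ≤ ∑ q, pos q * (2 ^ m * m) :=
    fun S => Finset.sum_le_sum fun q _ => Nat.mul_le_mul_left _ (wt_le _)
  obtain ⟨n, hn⟩ : ∃ n, ∑ q, pos q * (2 ^ m * m) - ∑ q, pos q * wt (S q) = n := ⟨_, rfl⟩
  induction n using Nat.strong_induction_on generalizing S with
  | _ n ih =>
    by_cases hstd : FillStd tag pos S
    · exact Submodule.mem_sup_left (Submodule.subset_span ⟨S, hST, hstd, rfl⟩)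
    have hstep : fillVal Mt tag S T ∈ Submodule.span K {x | ∃ S₁ : ι → Finset (Fin m),
        (∀ q, (S₁ q).card = (T q).card) ∧ ∑ q, pos q * wt (S q) < ∑ q, pos q * wt (S₁ q) ∧
        x = fillVal Mt tag S₁ T} ⊔
        tabSpan K Mt (∑ q, (T q).card) (∑ q, (3 ^ (T q).card - 1) + 1) := by
      rw [FillStd, not_and_or] at hstd
      rcases hstd with hstd | hstd
      · push Not at hstd
        obtain ⟨q, q', htag, hlt, hle⟩ := hstd
        obtain ⟨N, hN⟩ := not_forall.mp hle
        have hne : q ≠ q' := fun h => by subst h; omega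
        refine fillVal_step tag pos hST hne ?_
        have h1 := exchange (K := K) (Mt := Mt) (tag q) (hST q) (hST q')
          (by rw [hST, hST]; exact hT q q' htag hlt) (not_le.mp hN)
        rw [← htag]
        refine SetLike.le_def.mp (sup_le_sup_right (Submodule.span_mono ?_) _) h1
        rintro _ ⟨P, P', hP, hP', hw, hw', rfl⟩
        refine ⟨P, P', hP, hP', ?_, rfl⟩
        -- With `c + 1` the loss of weight in the earlier column and `d + 1` the difference of the
        -- positions, the weighted sum grows by `(d + 1) * (c + 1)`.
        obtain ⟨d, hd⟩ := Nat.exists_eq_add_of_lt hlt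
        rw [hd]
        have e1 : wt P' = wt (S q') + (wt (S q) - wt P) := by omega
        obtain ⟨c, hc⟩ := Nat.exists_eq_add_of_lt hw'
        rw [e1, hc]
        have e2 : wt P + c + 1 - wt P = c + 1 := by omega
        rw [e2]
        nlinarith [Nat.zero_le (d * c), Nat.zero_le (pos q * c)]
      · push Not at hstd
        obtain ⟨q, q', hq, hq', hmix⟩ := hstd
        rw [Mix] at hmix
        push Not at hmix
        obtain ⟨N, hNm, hN⟩ := hmix
        have hne : q ≠ q' := fun h => by subst h; rw [hq] at hq'; cases hq'
        refine fillVal_step tag pos hST hne (Submodule.mem_sup_left ?_)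
        have h1 := mixed_exchange (K := K) (Mt true) (Mt false) hXZ (hST q) (hST q') hNm hN
        rw [hq, hq']
        refine Submodule.span_mono ?_ h1
        rintro _ ⟨P, P', hP, hP', hw, hw', rfl⟩
        -- Here both weights increase, so positive positions are enough.
        exact ⟨P, P', hP, hP', Nat.add_lt_add
          (Nat.mul_lt_mul_of_pos_left hw (Nat.pos_of_ne_zero (hpos q)))
          (Nat.mul_lt_mul_of_pos_left hw' (Nat.pos_of_ne_zero (hpos q'))), rfl⟩
    refine SetLike.le_def.mp (sup_le ?_ le_sup_right) hstep
    rw [Submodule.span_le]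
    rintro _ ⟨S₁, hS₁, hlt, rfl⟩
    exact ih _ (by have := hbound S₁; omega) S₁ hS₁ rfl

theorem tabSpan_transpose (Mt : Bool → Matrix (Fin m) (Fin m) R) (d N : ℕ) :
    tabSpan K (fun b => (Mt b).transpose) d N ≤ tabSpan K Mt d N := by
  refine Submodule.span_le.mpr ?_
  rintro _ ⟨s, hs, hd, hN, rfl⟩
  let sw : Bool × Finset (Fin m) × Finset (Fin m) → Bool × Finset (Fin m) × Finset (Fin m) :=
    fun p => (p.1, p.2.2, p.2.1)
  have h1 : s.map (fun p => (sw p).2.1.card) = s.map fun p => p.2.1.card :=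
    Multiset.map_congr rfl fun p hp => (hs p hp).1.symm
  have h2 : PM (prodMinors (fun b => (Mt b).transpose) s) (prodMinors Mt (s.map sw)) := by
    rw [prodMinors, prodMinors, Multiset.map_map]
    obtain ⟨l, rfl⟩ := Quot.exists_rep s
    exact PM.list_prod l fun p _ => minor_transpose _ _ _
  rw [SetLike.mem_coe, h2.mem_iff]
  refine Submodule.subset_span ⟨s.map sw, ?_, ?_, ?_, rfl⟩
  · intro p hp
    obtain ⟨p', hp', rfl⟩ := Multiset.mem_map.mp hp
    exact ⟨(hs p' hp').1.symm, fun h => (hs p' hp').2 ((hs p' hp').1.trans h)⟩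
  · rw [tabDeg, Multiset.map_map]
    change (s.map fun p => (sw p).2.1.card).sum = d
    rw [h1]; exact hd
  · have h3 : s.map (fun p => 3 ^ (sw p).2.1.card - 1) = s.map fun p => 3 ^ p.2.1.card - 1 :=
      Multiset.map_congr rfl fun p hp => by rw [(hs p hp).1]
    rw [tabMeas, Multiset.map_map]
    change N ≤ (s.map fun p => 3 ^ (sw p).2.1.card - 1).sum
    rw [h3]; exact hN

theorem pm_fillVal_transpose (Mt : Bool → Matrix (Fin m) (Fin m) R) (tag : ι → Bool)
    (S T : ι → Finset (Fin m)) :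
    PM (fillVal (fun b => (Mt b).transpose) tag T S) (fillVal Mt tag S T) :=
  PM.prod _ fun _ _ => minor_transpose _ _ _

/-- The row sets are straightened first. Passing to transposed matrices then straightens the column
sets without changing the row sets, which are already standard; this uses the second contraction
relation. -/
theorem fill_straighten_both {Mt : Bool → Matrix (Fin m) (Fin m) R}
    (hXZ : ∀ j j', ∑ k, Mt false k j' * Mt true k j = 0)
    (hXZ' : ∀ j j', ∑ k, Mt false j' k * Mt true j k = 0) (tag : ι → Bool) (pos : ι → ℕ)
    (hpos : ∀ q, pos q ≠ 0) {S T : ι → Finset (Fin m)} (hST : ∀ q, (S q).card = (T q).card)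
    (hT : ∀ q q', tag q = tag q' → pos q < pos q' → (T q').card ≤ (T q).card) :
    fillVal Mt tag S T ∈ Submodule.span K {x | ∃ S₁ T₁ : ι → Finset (Fin m),
        (∀ q, (S₁ q).card = (T q).card) ∧ (∀ q, (T₁ q).card = (T q).card) ∧ FillStd tag pos S₁ ∧
        FillStd tag pos T₁ ∧ x = fillVal Mt tag S₁ T₁} ⊔
      tabSpan K Mt (∑ q, (T q).card) (∑ q, (3 ^ (T q).card - 1) + 1) := by
  refine SetLike.le_def.mp (sup_le ?_ le_sup_right) (fill_straighten hXZ tag pos hpos hT S hST)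
  rw [Submodule.span_le]
  rintro _ ⟨S₁, hS₁, hstd, rfl⟩
  have h1 := fill_straighten (K := K) (Mt := fun b => (Mt b).transpose) hXZ' tag pos hpos
    (T := S₁) (by simpa only [hS₁] using hT) T (fun q => (hS₁ q).symm)
  rw [(pm_fillVal_transpose Mt tag S₁ T).mem_iff] at h1
  simp only [hS₁] at h1
  refine SetLike.le_def.mp (sup_le (le_sup_of_le_left ?_) (le_sup_of_le_right (tabSpan_transpose Mt _ _))) h1
  rw [Submodule.span_le]
  rintro _ ⟨T₁, hT₁, hstd', rfl⟩
  rw [SetLike.mem_coe, (pm_fillVal_transpose Mt tag S₁ T₁).mem_iff]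
  exact Submodule.subset_span ⟨S₁, T₁, hS₁, hT₁, hstd, hstd', rfl⟩

/-- For fixed total size the measure is bounded, which terminates the induction towards larger
minors. The bound comes from `(3^a - 1) + (3^b - 1) ≤ 3^(a+b) - 1`. -/
theorem tabMeas_lt {τ : Type*} (s : Multiset (τ × Finset (Fin m) × Finset (Fin m))) :
    tabMeas s < 3 ^ tabDeg s := by
  induction s using Multiset.induction_on with
  | empty => simp [tabMeas, tabDeg]
  | cons p s ih =>
    simp only [tabMeas, tabDeg, Multiset.map_cons, Multiset.sum_cons] at ih ⊢
    rw [pow_add]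
    have h1 : 0 < 3 ^ p.2.1.card := by positivity
    obtain ⟨a, ha⟩ := Nat.exists_eq_add_of_lt h1
    obtain ⟨b, hb⟩ := Nat.exists_eq_add_of_lt ih
    rw [hb, ha]
    have : 0 + a + 1 - 1 = a := by omega
    rw [this]
    nlinarith [Nat.zero_le (a * (s.map fun p => 3 ^ p.2.1.card - 1).sum), Nat.zero_le (a * b)]

/-- Standard rational bitableaux: two lists of pairs of columns. -/
def IsStd (L L' : List (Finset (Fin m) × Finset (Fin m))) : Prop :=
  (∀ p ∈ L, p.1.card = p.2.card ∧ p.1.card ≠ 0) ∧ (∀ p ∈ L', p.1.card = p.2.card ∧ p.1.card ≠ 0) ∧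
    L.Pairwise (fun p q => ColLE p.1 q.1 ∧ ColLE p.2 q.2) ∧
    L'.Pairwise (fun p q => ColLE p.1 q.1 ∧ ColLE p.2 q.2) ∧
    ∀ p ∈ L, ∀ p' ∈ L', Mix p.1 p'.1 ∧ Mix p.2 p'.2

/-- The product of minors given by a rational bitableau. -/
def stdVal (X Z : Matrix (Fin m) (Fin m) R) (L L' : List (Finset (Fin m) × Finset (Fin m))) : R :=
  (L.map fun p => minor X p.1 p.2).prod * (L'.map fun p => minor Z p.1 p.2).prod

variable (K) in
/-- The span of the standard rational bitableaux. -/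
def stdSpan (X Z : Matrix (Fin m) (Fin m) R) : Submodule K R :=
  Submodule.span K {x | ∃ L L', IsStd L L' ∧ x = stdVal X Z L L'}

theorem fillVal_mem_stdSpan (Mt : Bool → Matrix (Fin m) (Fin m) R) {n n' : ℕ}
    {S T : Fin n ⊕ Fin n' → Finset (Fin m)} (hST : ∀ q, (S q).card = (T q).card)
    (h0 : ∀ q, (T q).card ≠ 0)
    (hS : FillStd Sum.isLeft (Sum.elim (fun i : Fin n => (i : ℕ) + 1) fun i : Fin n' => (i : ℕ) + 1) S)
    (hT : FillStd Sum.isLeft (Sum.elim (fun i : Fin n => (i : ℕ) + 1) fun i : Fin n' => (i : ℕ) + 1) T) :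
    fillVal Mt Sum.isLeft S T ∈ stdSpan K (Mt true) (Mt false) := by
  refine Submodule.subset_span ⟨List.ofFn fun i => (S (Sum.inl i), T (Sum.inl i)),
    List.ofFn fun i => (S (Sum.inr i), T (Sum.inr i)), ⟨?_, ?_, ?_, ?_, ?_⟩, ?_⟩
  · intro p hp
    obtain ⟨i, rfl⟩ := (List.mem_ofFn' _ _).mp hp
    exact ⟨hST _, hST (Sum.inl i) ▸ h0 _⟩
  · intro p hp
    obtain ⟨i, rfl⟩ := (List.mem_ofFn' _ _).mp hp
    exact ⟨hST _, hST (Sum.inr i) ▸ h0 _⟩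
  · rw [List.pairwise_ofFn]
    intro i j hij
    exact ⟨hS.1 _ _ rfl (by simpa using hij), hT.1 _ _ rfl (by simpa using hij)⟩
  · rw [List.pairwise_ofFn]
    intro i j hij
    exact ⟨hS.1 _ _ rfl (by simpa using hij), hT.1 _ _ rfl (by simpa using hij)⟩
  · intro p hp p' hp'
    obtain ⟨i, rfl⟩ := (List.mem_ofFn' _ _).mp hp
    obtain ⟨j, rfl⟩ := (List.mem_ofFn' _ _).mp hp'
    exact ⟨hS.2 _ _ rfl rfl, hT.2 _ _ rfl rfl⟩
  · rw [fillVal, stdVal, Fintype.prod_sum_type, List.map_ofFn, List.map_ofFn, List.prod_ofFn,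
      List.prod_ofFn]
    rfl

/-- Straightening leaves only correction terms of the same total size and strictly larger measure,
so induction on the distance of the measure from its bound absorbs them. -/
theorem prodMinors_mem_stdSpan {Mt : Bool → Matrix (Fin m) (Fin m) R}
    (hXZ : ∀ j j', ∑ k, Mt false k j' * Mt true k j = 0)
    (hXZ' : ∀ j j', ∑ k, Mt false j' k * Mt true j k = 0)
    (s : Multiset (Bool × Finset (Fin m) × Finset (Fin m))) (hs : IsTab s) :
    prodMinors Mt s ∈ stdSpan K (Mt true) (Mt false) := by
  obtain ⟨n, hn⟩ : ∃ n, 3 ^ tabDeg s - tabMeas s = n := ⟨_, rfl⟩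
  induction n using Nat.strong_induction_on generalizing s with
  | _ n ih =>
    -- For each of the two matrices the minors are listed by decreasing size, as the exchange
    -- relation requires the earlier column to be at least as long.
    let sorted (b : Bool) : List (Finset (Fin m) × Finset (Fin m)) :=
      ((s.filter fun p => p.1 = b).map Prod.snd).toList.mergeSort
        fun p q => decide (q.2.card ≤ p.2.card)
    have hperm : ∀ b, ((sorted b : List _) : Multiset (Finset (Fin m) × Finset (Fin m))) =
        (s.filter fun p => p.1 = b).map Prod.snd := fun b => by
      rw [← Multiset.coe_toList ((s.filter fun p => p.1 = b).map Prod.snd)]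
      exact Multiset.coe_eq_coe.mpr (List.mergeSort_perm _ _)
    have hpw : ∀ b, (sorted b).Pairwise fun p q => q.2.card ≤ p.2.card := fun b => by
      have := List.pairwise_mergeSort (le := fun p q : Finset (Fin m) × Finset (Fin m) =>
        decide (q.2.card ≤ p.2.card)) (by simp; omega) (by simp; omega)
        ((s.filter fun p => p.1 = b).map Prod.snd).toList
      simpa using this
    let get (q : Fin (sorted true).length ⊕ Fin (sorted false).length) :
        Finset (Fin m) × Finset (Fin m) :=
      Sum.elim (fun i => (sorted true).get i) (fun i => (sorted false).get i) q
    have hmem : ∀ b, ∀ p ∈ sorted b, (b, p) ∈ s := fun b p hp => by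
      have h1 : p ∈ (s.filter fun p => p.1 = b).map Prod.snd := by
        rw [← hperm b]; exact hp
      obtain ⟨⟨b', p'⟩, h2, rfl⟩ := Multiset.mem_map.mp h1
      obtain ⟨h3, rfl⟩ := Multiset.mem_filter.mp h2
      exact h3
    have hget : ∀ q, (Sum.isLeft q, get q) ∈ s := by
      rintro (i | i)
      · exact hmem true _ (List.get_mem _ _)
      · exact hmem false _ (List.get_mem _ _)
    have hsum : s = Finset.univ.val.map fun q => (Sum.isLeft q, get q) := by
      have h1 : ∀ b, (Finset.univ.val.map fun i : Fin (sorted b).length =>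
          (b, (sorted b).get i)) = s.filter fun p => p.1 = b := fun b => by
        have h2 : (Finset.univ.val.map fun i : Fin (sorted b).length => (b, (sorted b).get i)) =
            ((sorted b : List _) : Multiset _).map (Prod.mk b) := by
          conv_rhs => rw [← List.ofFn_get (sorted b), Multiset.map_coe, List.map_ofFn]
          rw [Fin.univ_val_map]
          rfl
        rw [h2, hperm b, Multiset.map_map]
        conv_rhs => rw [← Multiset.map_id (s.filter fun p => p.1 = b)]
        refine Multiset.map_congr rfl fun p hp => ?_
        rw [← (Multiset.mem_filter.mp hp).2]
        rfl
      have h3 : s = (s.filter fun p => p.1 = true) + s.filter fun p => p.1 = false := by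
        conv_lhs => rw [← Multiset.filter_add_not (fun p => p.1 = true) s]
        simp
      conv_lhs => rw [h3, ← h1, ← h1]
      rw [← Finset.univ_disjSum_univ, Finset.val_disjSum, Multiset.disjSum, Multiset.map_add,
        Multiset.map_map, Multiset.map_map]
      rfl
    have hST : ∀ q, (get q).1.card = (get q).2.card := fun q => (hs _ (hget q)).1
    have hval : prodMinors Mt s =
        fillVal Mt Sum.isLeft (fun q => (get q).1) fun q => (get q).2 := by
      rw [prodMinors, hsum, Multiset.map_map]
      rfl
    have hdeg : ∑ q, (get q).2.card = tabDeg s := by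
      simp only [← hST]
      rw [tabDeg, hsum, Multiset.map_map]
      rfl
    have hmeas : ∑ q, (3 ^ (get q).2.card - 1) = tabMeas s := by
      simp only [← hST]
      rw [tabMeas, hsum, Multiset.map_map]
      rfl
    have hmain := fill_straighten_both (K := K) hXZ hXZ' Sum.isLeft
      (Sum.elim (fun i : Fin (sorted true).length => (i : ℕ) + 1)
        fun i : Fin (sorted false).length => (i : ℕ) + 1)
      (by rintro (i | i) <;> simp) hST (by
        rintro (i | i) (j | j) htag hlt
        · exact (List.pairwise_iff_get.mp (hpw true)) i j (by simpa using hlt)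
        · simp at htag
        · simp at htag
        · exact (List.pairwise_iff_get.mp (hpw false)) i j (by simpa using hlt))
    rw [hval]
    refine SetLike.le_def.mp (sup_le ?_ ?_) hmain
    · rw [Submodule.span_le]
      rintro _ ⟨S₁, T₁, hS₁, hT₁, hstd, hstd', rfl⟩
      exact fillVal_mem_stdSpan Mt (fun q => (hS₁ q).trans (hT₁ q).symm)
        (fun q => by rw [hT₁, ← hST]; exact (hs _ (hget q)).2) hstd hstd'
    · rw [hdeg, hmeas, tabSpan, Submodule.span_le]
      rintro _ ⟨s', hs', hd', hm', rfl⟩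
      refine ih _ ?_ s' hs' rfl
      have h1 := tabMeas_lt s'
      rw [hd'] at h1 ⊢
      omega

end Straighten

/-! ### Minors of the inverse matrix -/

section Jacobi

variable {R : Type*} [CommRing R] {m : ℕ}

/-- Jacobi's formula for the minors of the inverse, up to sign. -/
theorem pm_minor_inv {M N : Matrix (Fin m) (Fin m) R} (h : M * N = 1) {A B : Finset (Fin m)}
    (hAB : A.card = B.card) : PM (minor N.transpose A B * M.det) (minor M Aᶜ Bᶜ) := by
  let e : {a // a ∈ A} ≃ {a // a ∈ B} := Finset.equivOfCardEq hAB
  have hc : Fintype.card {a // a ∉ A} = Fintype.card {a // a ∉ B} := by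
    simp [Fintype.card_subtype_compl, hAB]
  let f : {a // a ∉ A} ≃ {a // a ∉ B} := Fintype.equivOfCardEq hc
  let eA : {a // a ∈ A} ⊕ {a // a ∉ A} ≃ Fin m := Equiv.sumCompl (· ∈ A)
  let eB : {a // a ∈ A} ⊕ {a // a ∉ A} ≃ Fin m := (e.sumCongr f).trans (Equiv.sumCompl (· ∈ B))
  -- `Q` consists of the columns of `N` indexed by `A` and of unit vectors. Multiplication by `M`
  -- turns the former into unit vectors and the latter into columns of `M` outside `B`; comparing
  -- determinants gives the formula.
  let Q : Matrix ({a // a ∈ A} ⊕ {a // a ∉ A}) ({a // a ∈ A} ⊕ {a // a ∉ A}) R :=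
    Matrix.fromBlocks (Matrix.of fun a a' => N (e a) a') 0 (Matrix.of fun c a => N (f c) a) 1
  let Q' : Matrix ({a // a ∈ A} ⊕ {a // a ∉ A}) ({a // a ∈ A} ⊕ {a // a ∉ A}) R :=
    Matrix.fromBlocks 1 (Matrix.of fun a c => M a (f c)) 0 (Matrix.of fun c c' => M c (f c'))
  have hmul : M.submatrix eA eB * Q = Q' := by
    have hl : ∀ i (a : {a // a ∈ A}), (M.submatrix eA eB * Q) i (Sum.inl a) =
        (1 : Matrix (Fin m) (Fin m) R) (eA i) a := by
      intro i a
      rw [← h, Matrix.mul_apply, Matrix.mul_apply, ← eB.sum_comp]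
      refine Finset.sum_congr rfl ?_
      rintro (x | x) _ <;> rfl
    have hr : ∀ i (c : {a // a ∉ A}), (M.submatrix eA eB * Q) i (Sum.inr c) = M (eA i) (f c) := by
      intro i c
      rw [Matrix.mul_apply, Finset.sum_eq_single (Sum.inr c)]
      · simp [Q, eB]
      · rintro (x | x) _ hx
        · simp [Q]
        · have : x ≠ c := fun h => hx (h ▸ rfl)
          simp [Q, Matrix.one_apply_ne this]
      · simp
    ext i j
    rcases j with a | c
    · rw [hl]
      rcases i with i | i
      · change (1 : Matrix (Fin m) (Fin m) R) i a = (1 : Matrix {a // a ∈ A} {a // a ∈ A} R) i a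
        by_cases hia : i = a
        · rw [hia, Matrix.one_apply_eq, Matrix.one_apply_eq]
        · rw [Matrix.one_apply_ne hia, Matrix.one_apply_ne fun h => hia (Subtype.ext h)]
      · have : (i : Fin m) ≠ a := fun h => i.2 (h ▸ a.2)
        exact Matrix.one_apply_ne this
    · rw [hr]
      rcases i with i | i <;> simp [Q', eA]
  have hdet := congrArg Matrix.det hmul
  rw [Matrix.det_mul, Matrix.det_fromBlocks_zero₁₂, Matrix.det_fromBlocks_zero₂₁, Matrix.det_one,
    Matrix.det_one, one_mul, mul_one] at hdet
  have h1 : PM (minor N.transpose A B) (Matrix.of fun a a' : {a // a ∈ A} => N (e a) a').det := by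
    refine (minor_pm N.transpose e).trans (PM.of_eq ?_)
    rw [← Matrix.det_transpose]
    rfl
  have h2 : PM (Matrix.of fun (c c' : {a // a ∉ A}) => M c (f c')).det (minor M Aᶜ Bᶜ) := by
    refine pm_minor M (f := fun c : {a // a ∉ A} => (c : Fin m)) (g := fun c => (f c : Fin m))
      Subtype.val_injective (Subtype.val_injective.comp f.injective) ?_ ?_
    · ext i; simp
    · ext i
      simp only [Finset.mem_image, Finset.mem_univ, true_and, Finset.mem_compl]
      exact ⟨fun ⟨c, hc⟩ => hc ▸ (f c).2, fun hi => ⟨f.symm ⟨i, hi⟩, by simp⟩⟩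
  refine (h1.mul (pm_det_submatrix M eA eB).symm).trans ((PM.of_eq ?_).trans h2)
  rw [← hdet, mul_comm]

theorem minor_univ (M : Matrix (Fin m) (Fin m) R) : PM (minor M Finset.univ Finset.univ) M.det := by
  refine (pm_minor M (f := id) (g := id) Function.injective_id Function.injective_id ?_ ?_).symm
    <;> simp

theorem minor_empty (M : Matrix (Fin m) (Fin m) R) : minor M ∅ ∅ = 1 := by
  rw [minor, dif_pos rfl, Matrix.det_isEmpty]

/-- The Cauchy–Binet formula, up to signs. -/
theorem exists_minor_mul (Y W : Matrix (Fin m) (Fin m) R) {A B : Finset (Fin m)}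
    (hAB : A.card = B.card) : ∃ ε : Finset (Fin m) → R, (∀ C, PM (ε C) 1) ∧
      PM (minor (Y * W) A B) (∑ C, ε C * (minor W.transpose B C * minor Y A C)) := by
  let e : A ≃ B := Finset.equivOfCardEq hAB
  let X : Matrix (Fin m ⊕ Empty) B R := Matrix.of fun k b => Sum.elim (fun k => W k b) Empty.elim k
  -- This is the bordered formula with empty borders. The minus sign cancels the one in the
  -- definition of `bordered`.
  let Z : Matrix (Fin m ⊕ Empty) A R := Matrix.of fun k a => Sum.elim (fun k => -Y a k) Empty.elim k
  let e' : A ⊕ Empty ≃ B ⊕ Empty := e.sumCongr (Equiv.refl _)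
  obtain ⟨ε, hε, h⟩ := exists_det_bordered X Z e'
  have hd : ((bordered X Z).submatrix id e').det =
      ((Y * W).submatrix (fun a : A => (a : Fin m)) (fun a => (e a : Fin m))).det := by
    rw [← Matrix.det_submatrix_equiv_self (Equiv.sumEmpty A Empty).symm]
    congr 1
    ext i j
    simp [bordered, X, Z, e', Matrix.mul_apply]
  rw [hd] at h
  have hX : ∀ C : Finset (Fin m), PM (minor X (C.disjSum Finset.univ) Finset.univ)
      (minor W.transpose B C) := by
    intro C
    refine PM.trans ?_ (minor_transpose W C B).symm
    have := pm_minor_of_labels (G := X) (M := W) (f := Sum.elim id Empty.elim)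
      (g := fun b : B => (b : Fin m)) (s := C.disjSum Finset.univ) (t := Finset.univ)
      (by rintro (i | i) _ j _; · rfl
          · exact i.elim)
      (by rintro (i | i) _ (j | j) _ hij
          · exact congrArg _ hij
          all_goals first | exact i.elim | exact j.elim)
      (Subtype.val_injective.injOn)
    convert this using 2
    · ext i; simp
    · ext i; simp
  have hZ : ∀ C : Finset (Fin m), ∃ η : R, PM η 1 ∧
      minor Z (C.disjSum Finset.univ) Finset.univ = η * minor Y A C := by
    intro C
    have h0 := pm_minor_of_labels (G := Z) (M := (-Y).transpose) (f := Sum.elim id Empty.elim)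
      (g := fun b : A => (b : Fin m)) (s := C.disjSum Finset.univ) (t := Finset.univ)
      (by rintro (i | i) _ j _; · rfl
          · exact i.elim)
      (by rintro (i | i) _ (j | j) _ hij
          · exact congrArg _ hij
          all_goals first | exact i.elim | exact j.elim)
      (Subtype.val_injective.injOn)
    have h1 : PM (minor Z (C.disjSum Finset.univ) Finset.univ) (minor (-Y) A C) := by
      refine PM.trans ?_ (minor_transpose (-Y) A C)
      convert h0 using 2
      · ext i; simp
      · ext i; simp
    rw [show -Y = (-1 : R) • Y by simp, minor_smul] at h1
    obtain ⟨η, hη, h2⟩ := h1.exists_mul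
    refine ⟨η * (-1) ^ A.card, ?_, by rw [h2]; ring⟩
    simpa using hη.mul (y' := 1) (neg_one_pow_eq_or R A.card)
  choose ζ hζ hX' using fun C => (hX C).exists_mul
  choose η hη hZ' using hZ
  refine ⟨fun C => ε C * (ζ C * η C), fun C => ?_, (minor_pm (Y * W) e).trans (PM.of_eq ?_)⟩
  · have := (hε C).mul ((hζ C).mul (hη C))
    simpa using this
  · rw [h]
    refine Finset.sum_congr rfl fun C _ => ?_
    rw [hX', hZ']
    ring

end Jacobi

/-! ### Leading terms of minors -/

section Lead

open Polynomial

variable {R : Type*} [CommRing R]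

/-- `P` has degree at most `D`, and its coefficient in degree `D` is `ℓ`. -/
def Lead (P : R[X]) (D : ℕ) (ℓ : R) : Prop := P.natDegree ≤ D ∧ P.coeff D = ℓ

theorem Lead.mul {P P' : R[X]} {D D' : ℕ} {ℓ ℓ' : R} (h : Lead P D ℓ) (h' : Lead P' D' ℓ') :
    Lead (P * P') (D + D') (ℓ * ℓ') :=
  ⟨natDegree_mul_le_of_le h.1 h'.1, by
    rw [coeff_mul_add_eq_of_natDegree_le h.1 h'.1, h.2, h'.2]⟩

theorem Lead.one : Lead (1 : R[X]) 0 1 := ⟨by simp, by simp⟩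

theorem Lead.sum {ι : Type*} (s : Finset ι) {P : ι → R[X]} {D : ℕ} {ℓ : ι → R}
    (h : ∀ i ∈ s, Lead (P i) D (ℓ i)) : Lead (∑ i ∈ s, P i) D (∑ i ∈ s, ℓ i) :=
  ⟨natDegree_sum_le_of_forall_le _ _ fun i hi => (h i hi).1, by
    rw [finsetSum_coeff]; exact Finset.sum_congr rfl fun i hi => (h i hi).2⟩

theorem Lead.of_pm {P P' : R[X]} {D : ℕ} {ℓ : R} (h : PM P P') (h' : Lead P' D ℓ) :
    ∃ η : R, PM η 1 ∧ Lead P D (η * ℓ) := by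
  rcases h with rfl | rfl
  · exact ⟨1, PM.refl 1, by rwa [one_mul]⟩
  · exact ⟨-1, Or.inr rfl, by rw [natDegree_neg]; exact h'.1, by rw [coeff_neg, h'.2]; ring⟩

theorem Lead.of_pm_one {ε : R[X]} (h : PM ε 1) : ∃ η : R, PM η 1 ∧ Lead ε 0 η := by
  simpa using Lead.of_pm h Lead.one

end Lead

/-! ### Ranks and the maximization of the weights. -/

section Exponents

variable {m : ℕ}

/-- The rank of `a` with respect to `A`. -/
def rank (A : Finset (Fin m)) (a : Fin m) : Fin m :=
  ⟨cnt A a, by have := cnt_add_cnt_compl A a.2.le; omega⟩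

theorem cnt_mono (A : Finset (Fin m)) {N N' : ℕ} (h : N ≤ N') : cnt A N ≤ cnt A N' :=
  Finset.card_le_card fun a ha => by
    simp only [Finset.mem_filter] at ha ⊢
    exact ⟨ha.1, ha.2.trans_le h⟩

theorem rank_strictMono {A : Finset (Fin m)} {a a' : Fin m} (ha : a ∈ A) (h : a < a') :
    rank A a < rank A a' := by
  have h1 := cnt_succ A a
  rw [if_pos ha] at h1
  have h2 := cnt_mono A (show (a : ℕ) + 1 ≤ a' from h)
  change cnt A a < cnt A a'
  omega

theorem rank_injOn (A : Finset (Fin m)) : Set.InjOn (rank A) A := by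
  intro a ha a' ha' h
  rcases lt_trichotomy a a' with hlt | heq | hlt
  · exact absurd h (rank_strictMono ha hlt).ne
  · exact heq
  · exact absurd h (rank_strictMono ha' hlt).ne'

theorem rank_lt_iff {A : Finset (Fin m)} {a : Fin m} (ha : a ∈ A) {N : ℕ} :
    (rank A a : ℕ) < cnt A N ↔ (a : ℕ) < N := by
  constructor
  · intro h
    by_contra hN
    exact absurd (cnt_mono A (not_lt.mp hN)) (not_le.mpr h)
  · intro h
    have h1 := cnt_succ A a
    rw [if_pos ha] at h1
    have h2 := cnt_mono A (show (a : ℕ) + 1 ≤ N from h)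
    change cnt A a < _
    omega

/-- The ranks count `A` from zero without gaps, so initial segments of `A` have initial segments as
ranks. -/
theorem image_rank (A : Finset (Fin m)) (N : ℕ) :
    (A.filter fun a : Fin m => (a : ℕ) < N).image (fun a => (rank A a : ℕ)) =
      Finset.range (cnt A N) := by
  refine Finset.eq_of_subset_of_card_le ?_ ?_
  · intro i hi
    obtain ⟨a, ha, rfl⟩ := Finset.mem_image.mp hi
    obtain ⟨ha, ha'⟩ := Finset.mem_filter.mp ha
    exact Finset.mem_range.mpr ((rank_lt_iff ha).mpr ha')
  · rw [Finset.card_range, Finset.card_image_of_injOn]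
    · exact le_rfl
    · intro a ha a' ha' h
      exact rank_injOn A (Finset.mem_filter.mp ha).1 (Finset.mem_filter.mp ha').1 (Fin.ext h)

/-- The weight `(m - a) (m - k)`, as the number of points of a rectangle. -/
def expo (a k : Fin m) : ℕ :=
  ∑ p : Fin m × Fin m, if a ≤ p.1 ∧ k ≤ p.2 then 1 else 0

theorem expo_anti {a k k' : Fin m} (h : k ≤ k') : expo a k' ≤ expo a k := by
  refine Finset.sum_le_sum fun p _ => ?_
  split_ifs with h1 h2
  · exact le_rfl
  · exact absurd ⟨h1.1, h.trans h1.2⟩ h2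
  · exact Nat.zero_le _
  · exact le_rfl

theorem expo_strictAnti {a k k' : Fin m} (h : k < k') : expo a k' < expo a k := by
  refine Finset.sum_lt_sum (fun p _ => ?_) ⟨(a, k), Finset.mem_univ _, ?_⟩
  · split_ifs with h1 h2
    · exact le_rfl
    · exact absurd ⟨h1.1, h.le.trans h1.2⟩ h2
    · exact Nat.zero_le _
    · exact le_rfl
  · simp [h]

/-- Counting lattice points turns the total exponent into a sum of counts, one for each point `p`,
and each count can be maximized separately. -/
theorem sum_expo (A : Finset (Fin m)) (β : Fin m → Fin m) :
    ∑ a ∈ A, expo a (β a) =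
      ∑ p : Fin m × Fin m, (A.filter fun a => a ≤ p.1 ∧ β a ≤ p.2).card := by
  unfold expo
  rw [Finset.sum_comm]
  refine Finset.sum_congr rfl fun p _ => ?_
  rw [Finset.card_filter]

theorem card_filter_rank (A : Finset (Fin m)) (N j : Fin m) :
    (A.filter fun a => a ≤ N ∧ rank A a ≤ j).card = min (cnt A (N + 1)) (j + 1) := by
  rw [← Finset.card_range (min _ _), ← Finset.range_inter_range, ← image_rank,
    ← Finset.filter_mem_eq_inter, Finset.filter_image, Finset.card_image_of_injOn,
    Finset.filter_filter]
  · congr 1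
    ext a
    simp only [Finset.mem_filter, Finset.mem_range, Fin.le_def, Nat.lt_succ_iff]
  · intro a ha a' ha' h
    simp only [Finset.coe_filter, Set.mem_ofPred_eq] at ha ha'
    refine rank_injOn A ?_ ?_ (Fin.ext h)
    · simpa using (Finset.mem_filter.mp ha.1).1
    · simpa using (Finset.mem_filter.mp ha'.1).1

/-- The count on the left is at most the number of elements of `A` up to `N` and, by injectivity, at
most the number of values up to `j`. The rank function attains the minimum of these two bounds. -/
theorem card_filter_le_rank {A : Finset (Fin m)} {β : Fin m → Fin m} (hβ : Set.InjOn β A)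
    (N j : Fin m) : (A.filter fun a => a ≤ N ∧ β a ≤ j).card ≤
      (A.filter fun a => a ≤ N ∧ rank A a ≤ j).card := by
  rw [card_filter_rank]
  refine le_min ?_ ?_
  · refine Finset.card_le_card fun a ha => ?_
    simp only [Finset.mem_filter, Fin.le_def] at ha ⊢
    exact ⟨ha.1, by omega⟩
  · have h : (A.filter fun a => a ≤ N ∧ β a ≤ j).card ≤ (Finset.Iic j).card :=
      Finset.card_le_card_of_injOn β (fun a ha => by
        simp only [Finset.coe_filter, Set.mem_ofPred_eq] at ha
        simpa using ha.2.2) (hβ.mono fun a ha => (Finset.mem_filter.mp ha).1)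
    simpa using h

theorem sum_expo_le {A : Finset (Fin m)} {β : Fin m → Fin m} (hβ : Set.InjOn β A) :
    ∑ a ∈ A, expo a (β a) ≤ ∑ a ∈ A, expo a (rank A a) := by
  rw [sum_expo, sum_expo]
  exact Finset.sum_le_sum fun p _ => card_filter_le_rank hβ _ _

/-- This is the equality case of a rearrangement inequality, and it makes the leading term of a
minor unique. Equal totals force equal counts at every lattice point. -/
theorem eq_rank_of_sum_expo {A : Finset (Fin m)} {β : Fin m → Fin m} (hβ : Set.InjOn β A)
    (h : ∑ a ∈ A, expo a (β a) = ∑ a ∈ A, expo a (rank A a)) : ∀ a ∈ A, β a = rank A a := by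
  have h0 := h
  rw [sum_expo, sum_expo,
    Finset.sum_eq_sum_iff_of_le fun p _ => card_filter_le_rank hβ p.1 p.2] at h
  have hle : ∀ a ∈ A, β a ≤ rank A a := by
    intro a ha
    -- At this point the rank function counts every element of `A` up to `a`, so `β` must keep all
    -- of them, in particular `a`, below `rank A a`.
    have h1 := h (a, rank A a) (Finset.mem_univ _)
    have h2 : (A.filter fun a' => a' ≤ a ∧ rank A a' ≤ rank A a) = A.filter fun a' => a' ≤ a := by
      refine Finset.filter_congr fun a' ha' => ⟨And.left, fun h => ⟨h, ?_⟩⟩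
      exact cnt_mono A h
    rw [h2] at h1
    have h3 := Finset.eq_of_subset_of_card_le
      (Finset.monotone_filter_right A fun a' _ (h : a' ≤ a ∧ β a' ≤ rank A a) => h.1) h1.ge
    have h4 : a ∈ A.filter fun a' => a' ≤ a := by simp [ha]
    rw [← h3] at h4
    exact (Finset.mem_filter.mp h4).2.2
  intro a ha
  have h1 := (Finset.sum_eq_sum_iff_of_le fun a ha => expo_anti (a := a) (hle a ha)).mp h0.symm a ha
  by_contra hne
  exact absurd h1 (expo_strictAnti (lt_of_le_of_ne (hle a ha) hne)).ne

end Exponents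

/-! ### Leading terms of minors of weighted matrices. -/

section LeadMinor

open Polynomial

variable {R : Type*} [CommRing R] {m : ℕ}

/-- The matrix `v` with weights. -/
def wMat (v : Matrix (Fin m) (Fin m) R) : Matrix (Fin m) (Fin m) R[X] :=
  Matrix.of fun a k => C (v a k) * X ^ expo a k

/-- The leading degree of a minor of a matrix with weights. -/
def topDeg (A : Finset (Fin m)) : ℕ := ∑ a ∈ A, expo a (rank A a)

/-- The leading coefficient of a minor of a matrix with weights. -/
def topCoeff (v : Matrix (Fin m) (Fin m) R) (A : Finset (Fin m)) : R := ∏ a ∈ A, v a (rank A a)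

open Classical in
-- Among the monomials of a minor, only the one that sends each row to its rank reaches the top
-- degree.
theorem lead_prod_wMat (v : Matrix (Fin m) (Fin m) R) {A : Finset (Fin m)} {β : Fin m → Fin m}
    (hβ : Set.InjOn β A) : Lead (∏ a ∈ A, wMat v a (β a)) (topDeg A)
      (if ∀ a ∈ A, β a = rank A a then topCoeff v A else 0) := by
  have h : ∏ a ∈ A, wMat v a (β a) = C (∏ a ∈ A, v a (β a)) * X ^ ∑ a ∈ A, expo a (β a) := by
    rw [map_prod, ← Finset.prod_pow_eq_pow_sum, ← Finset.prod_mul_distrib]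
    rfl
  have hle := sum_expo_le hβ
  rw [h]
  refine ⟨(natDegree_C_mul_X_pow_le _ _).trans hle, ?_⟩
  rw [coeff_C_mul_X_pow]
  split_ifs with h1 h2 h2
  · exact Finset.prod_congr rfl fun a ha => by rw [h2 a ha]
  · exact absurd (eq_rank_of_sum_expo hβ h1.symm) h2
  · exact absurd (Finset.sum_congr rfl fun a ha => by rw [h2 a ha]) h1
  · rfl

open Classical in
-- At most one term of the Leibniz expansion can reach the top degree, and one does exactly when the
-- column set consists of the first indices. For other column sets the coefficient in that degree is
-- zero.
theorem lead_minor_wMat (v : Matrix (Fin m) (Fin m) R) {A B : Finset (Fin m)}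
    (hAB : A.card = B.card) : ∃ η : R, PM η 1 ∧ Lead (minor (wMat v) A B) (topDeg A)
      (if B = A.image (rank A) then η * topCoeff v A else 0) := by
  have key : ∀ g : A → Fin m, g.Injective → Lead ((wMat v).submatrix (fun a : A => (a : Fin m)) g).det
      (topDeg A) (∑ σ : Equiv.Perm A, ((Equiv.Perm.sign σ : ℤ) : R) *
        if ∀ a, g (σ a) = rank A a then topCoeff v A else 0) := by
    intro g hg
    rw [← Matrix.det_transpose, Matrix.det_apply']
    refine Lead.sum _ fun σ _ => ?_
    have h1 := lead_prod_wMat v (A := A)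
      (β := fun a => if h : a ∈ A then g (σ ⟨a, h⟩) else a) (by
        intro a ha a' ha' h
        simp only [Finset.mem_coe] at ha ha'
        simp only [ha, ha', dif_pos] at h
        exact congrArg Subtype.val (σ.injective (hg h)))
    have h2 : (∀ a ∈ A, (if h : a ∈ A then g (σ ⟨a, h⟩) else a) = rank A a) ↔
        ∀ a, g (σ a) = rank A a := by
      constructor
      · intro h a
        have := h a a.2
        rwa [dif_pos a.2] at this
      · intro h a ha
        rw [dif_pos ha]
        exact h ⟨a, ha⟩
    rw [← Finset.prod_coe_sort] at h1
    simp only [h2, Finset.coe_mem, dif_pos] at h1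
    have h3 : Lead (((Equiv.Perm.sign σ : ℤ) : R[X])) 0 ((Equiv.Perm.sign σ : ℤ) : R) :=
      ⟨by simp, by simp⟩
    have h4 := h3.mul h1
    rw [zero_add] at h4
    exact h4
  by_cases hB : B = A.image (rank A)
  · have h1 := key (fun a => rank A a) (fun a a' h => Subtype.ext (rank_injOn A a.2 a'.2 h))
    rw [Finset.sum_eq_single 1] at h1
    · simp only [Equiv.Perm.sign_one, Units.val_one, Int.cast_one, one_mul, Equiv.Perm.one_apply,
        implies_true, if_true] at h1
      simp only [if_pos hB]
      refine Lead.of_pm (PM.symm ?_) h1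
      refine pm_minor _ Subtype.val_injective
        (fun a a' h => Subtype.ext (rank_injOn A a.2 a'.2 h)) (by ext i; simp) ?_
      rw [hB]
      ext i
      simp
    · intro σ _ hσ
      rw [if_neg, mul_zero]
      intro h
      exact hσ (Equiv.ext fun a => Subtype.ext (rank_injOn A (σ a).2 a.2 (h a)))
    · simp
  · refine ⟨1, PM.refl 1, ?_⟩
    rw [if_neg hB, minor, dif_pos hAB]
    have h1 := key (fun a => (Finset.equivOfCardEq hAB a : Fin m))
      (Subtype.val_injective.comp (Equiv.injective _))
    rw [Finset.sum_eq_zero] at h1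
    · exact h1
    · intro σ _
      rw [if_neg, mul_zero]
      intro h
      refine hB ?_
      ext b
      rw [Finset.mem_image]
      constructor
      · intro hb
        refine ⟨σ.symm ((Finset.equivOfCardEq hAB).symm ⟨b, hb⟩), Finset.coe_mem _, ?_⟩
        rw [← h]
        simp
      · rintro ⟨a, ha, rfl⟩
        rw [← h ⟨a, ha⟩]
        exact Finset.coe_mem _

theorem image_rank_eq_of_card {A B : Finset (Fin m)} (hAB : A.card = B.card) :
    A.image (rank A) = B.image (rank B) := by
  have h : ∀ A : Finset (Fin m), (A.image (rank A)).image (fun a : Fin m => (a : ℕ)) =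
      Finset.range A.card := by
    intro A
    have h1 := image_rank A m
    rw [cnt_top A le_rfl, Finset.filter_true_of_mem fun a _ => a.2] at h1
    rw [Finset.image_image]
    exact h1
  exact Finset.image_injective Fin.val_injective ((h A).trans (hAB ▸ (h B).symm))

/-- In the Cauchy–Binet sum only the initial set of indices, common to `A` and `B` since they have
equal size, reaches the top degree. Hence the leading coefficient is, up to sign, a product of
entries that separates the rows from the columns. -/
theorem lead_minor_mul (v w : Matrix (Fin m) (Fin m) R) {A B : Finset (Fin m)}
    (hAB : A.card = B.card) : ∃ η : R, PM η 1 ∧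
      Lead (minor (wMat v * (wMat w).transpose) A B) (topDeg A + topDeg B)
        (η * (topCoeff v A * topCoeff w B)) := by
  classical
  obtain ⟨ε, hε, h⟩ := exists_minor_mul (wMat v) (wMat w).transpose hAB
  rw [Matrix.transpose_transpose] at h
  set C₀ := A.image (rank A) with hC₀
  have hC₀' : C₀ = B.image (rank B) := image_rank_eq_of_card hAB
  have hcard : C₀.card = A.card := Finset.card_image_of_injOn (rank_injOn A)
  obtain ⟨η₁, hη₁, h₁⟩ := lead_minor_wMat v hcard.symm
  obtain ⟨η₂, hη₂, h₂⟩ := lead_minor_wMat w (hAB.symm.trans hcard.symm)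
  obtain ⟨η₀, hη₀, h₀⟩ := Lead.of_pm_one (hε C₀)
  rw [if_pos hC₀] at h₁
  rw [if_pos hC₀'] at h₂
  have hsum : Lead (∑ C, ε C * (minor (wMat w) B C * minor (wMat v) A C)) (topDeg A + topDeg B)
      (∑ C, if C = C₀ then η₀ * ((η₂ * topCoeff w B) * (η₁ * topCoeff v A)) else 0) := by
    refine Lead.sum _ fun C _ => ?_
    by_cases hC : C = C₀
    · rw [if_pos hC, hC]
      have := h₀.mul (h₂.mul h₁)
      rwa [zero_add, add_comm] at this
    · rw [if_neg hC]
      by_cases hc : A.card = C.card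
      · obtain ⟨η₁', -, h₁'⟩ := lead_minor_wMat v hc
        obtain ⟨η₂', -, h₂'⟩ := lead_minor_wMat w (hAB.symm.trans hc)
        obtain ⟨η₀', -, h₀'⟩ := Lead.of_pm_one (hε C)
        rw [if_neg hC] at h₁'
        have := h₀'.mul (h₂'.mul h₁')
        rwa [zero_add, add_comm, mul_zero, mul_zero] at this
      · rw [minor_of_card_ne (wMat v) hc, mul_zero, mul_zero]
        exact ⟨by simp, by simp⟩
  rw [Finset.sum_ite_eq' Finset.univ C₀, if_pos (Finset.mem_univ _)] at hsum
  obtain ⟨η, hη, h3⟩ := Lead.of_pm h hsum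
  refine ⟨η * (η₀ * (η₂ * η₁)), by simpa using hη.mul (hη₀.mul (hη₂.mul hη₁)), ?_⟩
  convert h3 using 1
  ring

end LeadMinor

/-! ### Standard rational bitableaux are linearly independent -/

theorem PM.pow {R : Type*} [CommRing R] {x y : R} (h : PM x y) (n : ℕ) : PM (x ^ n) (y ^ n) := by
  induction n with
  | zero => simpa using PM.refl (1 : R)
  | succ n ih => simpa only [pow_succ] using ih.mul h

section Recovery

variable {m : ℕ}

theorem colLE_of_le {A A' : Finset (Fin m)} (h : ∀ N, N ≤ m → cnt A' N ≤ cnt A N) : ColLE A A' := by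
  intro N
  rcases le_total N m with hN | hN
  · exact h N hN
  · have := h m le_rfl
    rwa [cnt_top _ le_rfl, cnt_top _ le_rfl, ← cnt_top A' hN, ← cnt_top A hN] at this

theorem ColLE.compl {A A' : Finset (Fin m)} (h : ColLE A A') : ColLE A'ᶜ Aᶜ :=
  colLE_of_le fun N hN => by
    have h1 := cnt_add_cnt_compl A hN
    have h2 := cnt_add_cnt_compl A' hN
    have := h N
    omega

/-- Taking complements converts the condition between a column and a dual column into the ordinary
order of columns, because `cnt A'ᶜ N = N - cnt A' N` for `N ≤ m`. -/
theorem Mix.colLE {A A' : Finset (Fin m)} (h : Mix A A') : ColLE A'ᶜ A :=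
  colLE_of_le fun N hN => by
    have h2 := cnt_add_cnt_compl A' hN
    have := h N hN
    omega

theorem colLE_univ (A : Finset (Fin m)) : ColLE Finset.univ A :=
  fun _ => Finset.card_le_card (Finset.filter_subset_filter _ (Finset.subset_univ A))

theorem colLE_empty (A : Finset (Fin m)) : ColLE A ∅ := fun N => by simp [cnt]

/-- In an ordered list the first column has the largest counts, so it is determined by which of the
numbers are positive. It is removed and the argument repeats. -/
theorem eq_of_countP_cnt {l l' : List (Finset (Fin m))} (hlen : l.length = l'.length)
    (hl : l.Pairwise ColLE) (hl' : l'.Pairwise ColLE)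
    (h : ∀ N i, l.countP (fun A => i < cnt A N) = l'.countP fun A => i < cnt A N) : l = l' := by
  induction l generalizing l' with
  | nil => exact (List.length_eq_zero_iff.mp hlen.symm).symm
  | cons A t ih =>
    obtain _ | ⟨A', t'⟩ := l'
    · simp at hlen
    have hhead : ∀ (B : Finset (Fin m)) (u : List (Finset (Fin m))), (B :: u).Pairwise ColLE →
        ∀ N i, 0 < (B :: u).countP (fun A => i < cnt A N) ↔ i < cnt B N := by
      intro B u hu N i
      rw [List.countP_pos_iff]
      constructor
      · rintro ⟨P, hP, hlt⟩
        rcases List.mem_cons.mp hP with rfl | hP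
        · simpa using hlt
        · exact (of_decide_eq_true hlt).trans_le ((List.pairwise_cons.mp hu).1 P hP N)
      · intro hlt
        exact ⟨B, by simp, by simpa using hlt⟩
    have hA : A = A' := eq_of_cnt_eq fun N => by
      have h1 : ∀ i, i < cnt A N ↔ i < cnt A' N := fun i => by
        rw [← hhead A t hl, ← hhead A' t' hl', h]
      have h2 := h1 (cnt A N)
      have h3 := h1 (cnt A' N)
      omega
    subst hA
    congr 1
    refine ih (by simpa using hlen) (List.pairwise_cons.mp hl).2 (List.pairwise_cons.mp hl').2 ?_
    intro N i
    have := h N i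
    simpa [List.countP_cons] using this

/-- The exponents of the leading monomial of a column. -/
def colExp (A : Finset (Fin m)) (x : Fin m × Fin m) : ℕ :=
  (A.filter fun a => (a, rank A a) = x).card

/-- Exactly one element of `A` has rank `i` when there is one, and it lies below `N` precisely when
`i < cnt A N`. Thus partial sums of exponents recover the counts. -/
theorem sum_colExp (A : Finset (Fin m)) (N : ℕ) (i : Fin m) :
    (∑ a : Fin m, if (a : ℕ) < N then colExp A (a, i) else 0) =
      if (i : ℕ) < cnt A N then 1 else 0 := by
  have h1 : (∑ a : Fin m, if (a : ℕ) < N then colExp A (a, i) else 0) =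
      ((A.filter fun a : Fin m => (a : ℕ) < N).filter fun a => (rank A a : ℕ) = i).card := by
    rw [Finset.card_eq_sum_card_fiberwise (f := id) (t := Finset.univ) (by simp [Set.MapsTo])]
    refine Finset.sum_congr rfl fun a _ => ?_
    split_ifs with h
    · rw [colExp]
      congr 1
      ext b
      simp only [Finset.mem_filter, Prod.mk.injEq, id, Fin.ext_iff]
      constructor
      · rintro ⟨h1, h2, h3⟩
        exact ⟨⟨⟨h1, h2 ▸ h⟩, h3⟩, h2⟩
      · rintro ⟨⟨⟨h1, -⟩, h3⟩, h2⟩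
        exact ⟨h1, h2, h3⟩
    · refine (Finset.card_eq_zero.mpr ?_).symm
      ext b
      simp only [Finset.mem_filter, id, Finset.notMem_empty, iff_false]
      rintro ⟨⟨⟨-, h1⟩, -⟩, rfl⟩
      exact h h1
  rw [h1]
  have h2 : (i : ℕ) < cnt A N ↔ ∃ a ∈ A.filter fun a : Fin m => (a : ℕ) < N, (rank A a : ℕ) = i := by
    rw [← Finset.mem_range, ← image_rank, Finset.mem_image]
  split_ifs with h
  · obtain ⟨a, ha, hai⟩ := h2.mp h
    refine Finset.card_eq_one.mpr ⟨a, ?_⟩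
    ext b
    rw [Finset.mem_filter, Finset.mem_singleton]
    constructor
    · rintro ⟨hb, hbi⟩
      exact rank_injOn A (Finset.mem_filter.mp hb).1 (Finset.mem_filter.mp ha).1
        (Fin.ext (hbi.trans hai.symm))
    · rintro rfl
      exact ⟨ha, hai⟩
  · rw [Finset.card_eq_zero, Finset.filter_eq_empty_iff]
    intro a ha hai
    exact h (h2.mpr ⟨a, ha, hai⟩)

/-- The leading monomial of a product determines the ordered list of columns: partial sums of its
exponents give the numbers needed for `eq_of_countP_cnt`. -/
theorem eq_of_sum_colExp {l l' : List (Finset (Fin m))} (hlen : l.length = l'.length)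
    (hl : l.Pairwise ColLE) (hl' : l'.Pairwise ColLE)
    (h : ∀ x, (l.map fun A => colExp A x).sum = (l'.map fun A => colExp A x).sum) : l = l' := by
  refine eq_of_countP_cnt hlen hl hl' fun N i => ?_
  by_cases hi : i < m
  · have key : ∀ l : List (Finset (Fin m)), l.countP (fun A => i < cnt A N) =
        ∑ a : Fin m, if (a : ℕ) < N then (l.map fun A => colExp A (a, ⟨i, hi⟩)).sum else 0 := by
      intro l
      induction l with
      | nil => simp
      | cons A t ih =>
        have h1 := sum_colExp A N ⟨i, hi⟩
        rw [List.countP_cons, ih]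
        simp only [List.map_cons, List.sum_cons, decide_eq_true_eq]
        simp only at h1
        rw [← h1, ← Finset.sum_add_distrib]
        refine Finset.sum_congr rfl fun a _ => ?_
        split_ifs <;> omega
    rw [key, key]
    simp only [h]
  · have key : ∀ l : List (Finset (Fin m)), l.countP (fun A => i < cnt A N) = 0 := by
      intro l
      rw [List.countP_eq_zero]
      intro A _ hA
      have h1 := cnt_le_card A N
      have h2 := Finset.card_le_univ A
      rw [Fintype.card_fin] at h2
      have := of_decide_eq_true hA
      omega
    rw [key, key]

/-- The exponents of the leading monomial of a pair of columns. -/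
def pairExp (p : Finset (Fin m) × Finset (Fin m)) :
    (Fin m × Fin m) ⊕ (Fin m × Fin m) →₀ ℕ :=
  ∑ a ∈ p.1, Finsupp.single (Sum.inl (a, rank p.1 a)) 1 +
    ∑ b ∈ p.2, Finsupp.single (Sum.inr (b, rank p.2 b)) 1

theorem pairExp_inl (p : Finset (Fin m) × Finset (Fin m)) (x : Fin m × Fin m) :
    pairExp p (Sum.inl x) = colExp p.1 x := by
  simp [pairExp, colExp, Finsupp.single_apply]

theorem pairExp_inr (p : Finset (Fin m) × Finset (Fin m)) (x : Fin m × Fin m) :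
    pairExp p (Sum.inr x) = colExp p.2 x := by
  simp [pairExp, colExp, Finsupp.single_apply]

theorem eq_of_sum_pairExp {l l' : List (Finset (Fin m) × Finset (Fin m))}
    (hlen : l.length = l'.length)
    (hl : l.Pairwise fun p q => ColLE p.1 q.1 ∧ ColLE p.2 q.2)
    (hl' : l'.Pairwise fun p q => ColLE p.1 q.1 ∧ ColLE p.2 q.2)
    (h : (l.map pairExp).sum = (l'.map pairExp).sum) : l = l' := by
  have happ : ∀ (l : List (Finset (Fin m) × Finset (Fin m))) x,
      (l.map pairExp).sum x = (l.map fun p => pairExp p x).sum := by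
    intro l x
    induction l with
    | nil => simp
    | cons p t ih => simp [ih]
  have h1 : l.map Prod.fst = l'.map Prod.fst := by
    refine eq_of_sum_colExp (by simpa using hlen) (List.pairwise_map.mpr (hl.imp And.left))
      (List.pairwise_map.mpr (hl'.imp And.left)) fun x => ?_
    have := DFunLike.congr_fun h (Sum.inl x)
    simpa only [happ, pairExp_inl, List.map_map, Function.comp_def] using this
  have h2 : l.map Prod.snd = l'.map Prod.snd := by
    refine eq_of_sum_colExp (by simpa using hlen) (List.pairwise_map.mpr (hl.imp And.right))
      (List.pairwise_map.mpr (hl'.imp And.right)) fun x => ?_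
    have := DFunLike.congr_fun h (Sum.inr x)
    simpa only [happ, pairExp_inr, List.map_map, Function.comp_def] using this
  rw [← List.zip_unzip l, ← List.zip_unzip l', List.unzip_eq_map, List.unzip_eq_map, h1, h2]

/-- The columns of a standard rational bitableau, with the dual columns replaced by their
complements. -/
def colList (n P : ℕ) (L L' : List (Finset (Fin m) × Finset (Fin m))) :
    List (Finset (Fin m) × Finset (Fin m)) :=
  -- Padding gives all lists the same length `n + P`. Full columns contribute unused determinants,
  -- empty columns contribute `1`.
  List.replicate (n - L'.length) (Finset.univ, Finset.univ) ++
    (L'.reverse.map fun p => (p.1ᶜ, p.2ᶜ)) ++ (L ++ List.replicate (P - L.length) (∅, ∅))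

theorem length_colList {n P : ℕ} {L L' : List (Finset (Fin m) × Finset (Fin m))}
    (hn : L'.length ≤ n) (hP : L.length ≤ P) : (colList n P L L').length = n + P := by
  simp only [colList, List.length_append, List.length_replicate, List.length_map,
    List.length_reverse]
  omega

theorem card_of_mem_colList {n P : ℕ} {L L' : List (Finset (Fin m) × Finset (Fin m))}
    (h : IsStd L L') : ∀ p ∈ colList n P L L', p.1.card = p.2.card := by
  intro p hp
  simp only [colList, List.mem_append, List.mem_replicate, List.mem_map, List.mem_reverse] at hp
  rcases hp with (⟨-, rfl⟩ | ⟨q, hq, rfl⟩) | hp | ⟨-, rfl⟩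
  · rfl
  · simp only [Finset.card_compl, (h.2.1 q hq).1]
  · exact (h.1 p hp).1
  · rfl

/-- Complements reverse the order, hence the reversed dual list. The mixed condition is exactly what
places the complements before the ordinary columns. -/
theorem pairwise_colList {n P : ℕ} {L L' : List (Finset (Fin m) × Finset (Fin m))}
    (h : IsStd L L') :
    (colList n P L L').Pairwise fun p q => ColLE p.1 q.1 ∧ ColLE p.2 q.2 := by
  obtain ⟨-, -, h1, h2, h3⟩ := h
  rw [colList, List.pairwise_append, List.pairwise_append, List.pairwise_append]
  refine ⟨⟨?_, ?_, ?_⟩, ⟨h1, ?_, ?_⟩, ?_⟩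
  · exact List.pairwise_replicate.mpr (Or.inr ⟨colLE_univ _, colLE_univ _⟩)
  · rw [List.pairwise_map, List.pairwise_reverse]
    exact h2.imp fun h => ⟨h.1.compl, h.2.compl⟩
  · intro p hp q _
    obtain ⟨-, rfl⟩ := List.mem_replicate.mp hp
    exact ⟨colLE_univ _, colLE_univ _⟩
  · exact List.pairwise_replicate.mpr (Or.inr ⟨colLE_empty _, colLE_empty _⟩)
  · intro p _ q hq
    obtain ⟨-, rfl⟩ := List.mem_replicate.mp hq
    exact ⟨colLE_empty _, colLE_empty _⟩
  · intro p hp q hq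
    rcases List.mem_append.mp hq with hq | hq
    · rcases List.mem_append.mp hp with hp | hp
      · obtain ⟨-, rfl⟩ := List.mem_replicate.mp hp
        exact ⟨colLE_univ _, colLE_univ _⟩
      · obtain ⟨p', hp', rfl⟩ := List.mem_map.mp hp
        have := h3 q hq p' (List.mem_reverse.mp hp')
        exact ⟨this.1.colLE, this.2.colLE⟩
    · obtain ⟨-, rfl⟩ := List.mem_replicate.mp hq
      exact ⟨colLE_empty _, colLE_empty _⟩

/-- The first `n` columns carry the dual part and the others the ordinary part. The padding is
recognized because columns of a standard bitableau are nonempty. -/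
theorem colList_injective {n P : ℕ} {L₁ L₁' L₂ L₂' : List (Finset (Fin m) × Finset (Fin m))}
    (h₁ : IsStd L₁ L₁') (h₂ : IsStd L₂ L₂') (hn₁ : L₁'.length ≤ n) (hn₂ : L₂'.length ≤ n)
    (h : colList n P L₁ L₁' = colList n P L₂ L₂') : L₁ = L₂ ∧ L₁' = L₂' := by
  obtain ⟨ha, hb⟩ := List.append_inj h (by
    simp only [List.length_append, List.length_replicate, List.length_map, List.length_reverse]
    omega)
  have hrec : ∀ {L : List (Finset (Fin m) × Finset (Fin m))} {k : ℕ},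
      (∀ p ∈ L, p.1.card = p.2.card ∧ p.1.card ≠ 0) →
      (L ++ List.replicate k ((∅ : Finset (Fin m)), (∅ : Finset (Fin m)))).filter
        (fun p => p.1.card ≠ 0) = L := by
    intro L k hL
    rw [List.filter_append, List.filter_eq_self.mpr (fun p hp => by simpa using (hL p hp).2),
      List.filter_eq_nil_iff.mpr, List.append_nil]
    intro p hp
    obtain ⟨-, rfl⟩ := List.mem_replicate.mp hp
    simp
  refine ⟨?_, ?_⟩
  · rw [← hrec (k := P - L₁.length) h₁.1, hb, hrec h₂.1]
  · have hc : ∀ (L' : List (Finset (Fin m) × Finset (Fin m))) (k : ℕ),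
        ((List.replicate k ((Finset.univ : Finset (Fin m)), (Finset.univ : Finset (Fin m))) ++
          (L'.reverse.map fun p => (p.1ᶜ, p.2ᶜ))).map fun p => (p.1ᶜ, p.2ᶜ)).reverse =
        L' ++ List.replicate k ((∅ : Finset (Fin m)), (∅ : Finset (Fin m))) := by
      intro L' k
      simp [Function.comp_def]
    rw [← hrec (k := n - L₁'.length) h₁.2.1, ← hc, ha, hc, hrec h₂.2.1]

/-- Each dual column uses one factor `det` through Jacobi's formula, and the remaining factors are
minors of full size. -/
theorem pm_stdVal {R : Type*} [CommRing R] {M N : Matrix (Fin m) (Fin m) R} (hMN : M * N = 1)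
    {n : ℕ} (P : ℕ) {L L' : List (Finset (Fin m) × Finset (Fin m))} (h : IsStd L L')
    (hn : L'.length ≤ n) : PM (stdVal M N.transpose L L' * M.det ^ n)
      ((colList n P L L').map fun p => minor M p.1 p.2).prod := by
  simp only [colList, List.map_append, List.prod_append, List.map_replicate, List.prod_replicate,
    minor_empty, one_pow, mul_one, List.map_map]
  have h1 : PM ((L'.map fun p => minor N.transpose p.1 p.2).prod * M.det ^ L'.length)
      (L'.reverse.map ((fun p => minor M p.1 p.2) ∘ fun p => (p.1ᶜ, p.2ᶜ))).prod := by
    rw [List.map_reverse, List.prod_reverse, ← List.prod_replicate, ← List.map_const',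
      ← List.prod_map_mul]
    exact PM.list_prod L' fun p hp => pm_minor_inv hMN (h.2.1 p hp).1
  have h2 : PM (M.det ^ (n - L'.length)) (minor M Finset.univ Finset.univ ^ (n - L'.length)) :=
    (minor_univ M).symm.pow _
  have h3 := (h2.mul h1).mul (PM.refl (L.map fun p => minor M p.1 p.2).prod)
  refine (PM.of_eq ?_).trans h3
  rw [stdVal, ← Nat.sub_add_cancel hn, pow_add]
  simp only [Nat.add_sub_cancel]
  ring

end Recovery

/-! ### Independence by comparison of leading monomials. -/

section Independence

open Polynomial

variable {K : Type*} [Field K] {m : ℕ}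

variable (K m) in
/-- The ring of coefficients of the generic product of two weighted matrices. -/
abbrev PairRing : Type _ := MvPolynomial ((Fin m × Fin m) ⊕ (Fin m × Fin m)) K

variable (K m) in
/-- The product of two generic matrices with weights. -/
def genericMul : Matrix (Fin m) (Fin m) (PairRing K m)[X] :=
  wMat (Matrix.of fun a k => MvPolynomial.X (Sum.inl (a, k))) *
    (wMat (Matrix.of fun a k => MvPolynomial.X (Sum.inr (a, k)))).transpose

theorem lead_minor_genericMul {p : Finset (Fin m) × Finset (Fin m)} (hp : p.1.card = p.2.card) :
    ∃ η : PairRing K m, PM η 1 ∧ Lead (minor (genericMul K m) p.1 p.2) (topDeg p.1 + topDeg p.2)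
      (η * MvPolynomial.monomial (pairExp p) 1) := by
  obtain ⟨η, hη, h⟩ := lead_minor_mul
    (Matrix.of fun a k => (MvPolynomial.X (Sum.inl (a, k)) : PairRing K m))
    (Matrix.of fun a k => MvPolynomial.X (Sum.inr (a, k))) hp
  refine ⟨η, hη, ?_⟩
  have h1 : (MvPolynomial.monomial (pairExp p) 1 : PairRing K m) =
      topCoeff (Matrix.of fun a k => MvPolynomial.X (Sum.inl (a, k))) p.1 *
        topCoeff (Matrix.of fun a k => MvPolynomial.X (Sum.inr (a, k))) p.2 := by
    rw [pairExp, ← mul_one (1 : K), ← MvPolynomial.monomial_mul, MvPolynomial.monomial_sum_one,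
      MvPolynomial.monomial_sum_one]
    rfl
  rw [h1]
  exact h

theorem lead_prod_genericMul {l : List (Finset (Fin m) × Finset (Fin m))}
    (hl : ∀ p ∈ l, p.1.card = p.2.card) : ∃ η : PairRing K m, PM η 1 ∧
      Lead (l.map fun p => minor (genericMul K m) p.1 p.2).prod
        (l.map fun p => topDeg p.1 + topDeg p.2).sum
        (η * MvPolynomial.monomial (l.map pairExp).sum 1) := by
  induction l with
  | nil => exact ⟨1, PM.refl 1, by simpa using Lead.one⟩
  | cons p t ih =>
    obtain ⟨η, hη, h⟩ := ih fun q hq => hl q (List.mem_cons_of_mem p hq)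
    obtain ⟨η', hη', h'⟩ := lead_minor_genericMul (K := K) (hl p (by simp))
    refine ⟨η' * η, by simpa using hη'.mul hη, ?_⟩
    simp only [List.map_cons, List.prod_cons, List.sum_cons]
    convert h'.mul h using 1
    rw [← mul_one (1 : K), ← MvPolynomial.monomial_mul, mul_one]
    ring

/-- Among the terms with nonzero coefficient take one of maximal degree and extract its leading
monomial. Terms of smaller degree do not reach it, and terms of the same degree have another
monomial. -/
theorem eq_zero_of_lead {β σ : Type*} (s : Finset β) (P : β → (MvPolynomial σ K)[X]) (D : β → ℕ)
    (e : β → σ →₀ ℕ) (he : Set.InjOn e s)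
    (hP : ∀ b ∈ s, ∃ η : MvPolynomial σ K, PM η 1 ∧
      Lead (P b) (D b) (η * MvPolynomial.monomial (e b) 1))
    (c : β → K) (h : ∑ b ∈ s, c b • P b = 0) : ∀ b ∈ s, c b = 0 := by
  classical
  by_contra hne
  push Not at hne
  obtain ⟨b₁, hb₁, hc₁⟩ := hne
  obtain ⟨b₀, hb₀, hmax⟩ := Finset.exists_max_image (s.filter fun b => c b ≠ 0) D
    ⟨b₁, Finset.mem_filter.mpr ⟨hb₁, hc₁⟩⟩
  obtain ⟨hb₀, hc₀⟩ := Finset.mem_filter.mp hb₀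
  have h1 := congrArg (fun Q : (MvPolynomial σ K)[X] => (Q.coeff (D b₀)).coeff (e b₀)) h
  simp only [finsetSum_coeff, MvPolynomial.coeff_sum, coeff_smul, MvPolynomial.coeff_smul,
    coeff_zero, MvPolynomial.coeff_zero] at h1
  rw [Finset.sum_eq_single b₀] at h1
  · obtain ⟨η, hη, hl⟩ := hP b₀ hb₀
    rw [hl.2] at h1
    rcases hη with rfl | rfl <;> simp [hc₀] at h1
  · intro b hb hbne
    by_cases hc : c b = 0
    · rw [hc, zero_smul]
    obtain ⟨η, hη, hl⟩ := hP b hb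
    have hD : D b ≤ D b₀ := hmax b (Finset.mem_filter.mpr ⟨hb, hc⟩)
    have hne : e b ≠ e b₀ := fun h => hbne (he hb hb₀ h)
    rcases hD.lt_or_eq with hD | hD
    · rw [coeff_eq_zero_of_natDegree_lt (hl.1.trans_lt hD), MvPolynomial.coeff_zero, smul_zero]
    · rw [← hD, hl.2]
      rcases hη with rfl | rfl <;> simp [MvPolynomial.coeff_monomial, hne]
  · intro hb
    exact absurd hb₀ hb

/-- The leading coefficient is a monomial up to sign, so the product of the weighted matrices
defines a point of `GL(m)` over the fraction field. -/
theorem det_genericMul_ne_zero : (genericMul K m).det ≠ 0 := by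
  obtain ⟨η, hη, h⟩ := lead_minor_genericMul (K := K) (m := m)
    (p := (Finset.univ, Finset.univ)) rfl
  intro h0
  have h1 := (h0 ▸ minor_univ (genericMul K m)).eq_zero
  rw [Lead, h1, coeff_zero] at h
  have h2 := congrArg (MvPolynomial.coeff (pairExp (Finset.univ, Finset.univ))) h.2
  rcases hη with rfl | rfl <;> simp at h2

theorem cMat_mul_dMat : cMat K m * dMat K m = 1 := Matrix.mul_nonsing_inv _ (isUnit_det_cMat K m)

theorem dMat_mul_cMat : dMat K m * cMat K m = 1 := Matrix.nonsing_inv_mul _ (isUnit_det_cMat K m)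

/-- The standard rational bitableaux are linearly independent functions on `GL(m)`. -/
theorem linearIndependent_stdVal : LinearIndependent K
    fun b : {b : List (Finset (Fin m) × Finset (Fin m)) × List (Finset (Fin m) × Finset (Fin m)) //
      IsStd b.1 b.2} => stdVal (cMat K m) (dMat K m).transpose b.1.1 b.1.2 := by
  rw [linearIndependent_iff']
  intro s c hsum
  let F := FractionRing (PairRing K m)[X]
  let M : Matrix (Fin m) (Fin m) F := (genericMul K m).map (algebraMap (PairRing K m)[X] F)
  have hdet : M.det = algebraMap (PairRing K m)[X] F (genericMul K m).det :=
    (RingHom.map_det _ _).symm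
  have hM : IsUnit M.det := by
    rw [hdet, isUnit_iff_ne_zero]
    exact (map_ne_zero_iff _ (IsFractionRing.injective _ _)).mpr det_genericMul_ne_zero
  let φ : GLCoord K m →ₐ[K] F := liftGL M hM
  have hφ : (cMat K m).map φ.toRingHom = M := by
    ext i j
    exact liftGL_cMat M hM i j
  -- One exponent of the determinant and one list length must serve all terms of the given finite
  -- relation.
  set n := s.sup fun b => b.1.2.length
  set P := s.sup fun b => b.1.1.length
  have hn : ∀ b ∈ s, b.1.2.length ≤ n := fun b hb => Finset.le_sup (f := fun b => b.1.2.length) hb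
  have hP : ∀ b ∈ s, b.1.1.length ≤ P := fun b hb => Finset.le_sup (f := fun b => b.1.1.length) hb
  let gl (b : {b : List (Finset (Fin m) × Finset (Fin m)) ×
      List (Finset (Fin m) × Finset (Fin m)) // IsStd b.1 b.2}) := colList n P b.1.1 b.1.2
  have hval : ∀ b ∈ s, ∃ ε : F, PM ε 1 ∧
      φ (stdVal (cMat K m) (dMat K m).transpose b.1.1 b.1.2) * M.det ^ n =
        ε * algebraMap _ F ((gl b).map fun p => minor (genericMul K m) p.1 p.2).prod := by
    intro b hb
    have h1 := (pm_stdVal cMat_mul_dMat P b.2 (hn b hb)).map φ.toRingHom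
    have h2 : φ.toRingHom (cMat K m).det = M.det := by
      rw [← hφ, RingHom.map_det]
      rfl
    have h3 : φ.toRingHom ((gl b).map fun p => minor (cMat K m) p.1 p.2).prod =
        algebraMap _ F ((gl b).map fun p => minor (genericMul K m) p.1 p.2).prod := by
      rw [map_list_prod, map_list_prod, List.map_map, List.map_map]
      congr 1
      refine List.map_congr_left fun p _ => ?_
      simp only [Function.comp]
      rw [map_minor, map_minor, hφ]
    rw [map_mul, map_pow, h2, h3] at h1
    exact h1.exists_mul
  -- The signs are lifted from the fraction field, so that the relation can be read in the
  -- polynomial ring.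
  have hval' : ∀ b ∈ s, ∃ ε : (PairRing K m)[X], PM ε 1 ∧
      φ (stdVal (cMat K m) (dMat K m).transpose b.1.1 b.1.2) * M.det ^ n =
        algebraMap _ F (ε * ((gl b).map fun p => minor (genericMul K m) p.1 p.2).prod) := by
    intro b hb
    obtain ⟨ε, hε, h⟩ := hval b hb
    rcases hε with rfl | rfl
    · exact ⟨1, PM.refl 1, by rw [h, map_mul, map_one]⟩
    · exact ⟨-1, Or.inr rfl, by rw [h, map_mul, map_neg, map_one]⟩
  choose! ε hε hval'' using hval'
  have hzero : ∑ b ∈ s, c b • (ε b * ((gl b).map fun p => minor (genericMul K m) p.1 p.2).prod) =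
      0 := by
    apply IsFractionRing.injective (PairRing K m)[X] F
    rw [map_zero, map_sum]
    calc ∑ b ∈ s, algebraMap (PairRing K m)[X] F
          (c b • (ε b * ((gl b).map fun p => minor (genericMul K m) p.1 p.2).prod))
        = ∑ b ∈ s, φ (c b • stdVal (cMat K m) (dMat K m).transpose b.1.1 b.1.2) * M.det ^ n := by
          refine Finset.sum_congr rfl fun b hb => ?_
          rw [map_smul φ, smul_mul_assoc, hval'' b hb]
          exact map_smul (IsScalarTower.toAlgHom K (PairRing K m)[X] F) _ _
      _ = 0 := by
          rw [← Finset.sum_mul, ← map_sum, hsum, map_zero, zero_mul]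
  refine eq_zero_of_lead s _ (fun b => ((gl b).map fun p => topDeg p.1 + topDeg p.2).sum)
    (fun b => ((gl b).map pairExp).sum) ?_ ?_ c hzero
  · intro b hb b' hb' hbb
    have h1 := colList_injective b.2 b'.2 (hn b hb) (hn b' hb') (P := P) (eq_of_sum_pairExp
      ((length_colList (hn b hb) (hP b hb)).trans (length_colList (hn b' hb') (hP b' hb')).symm)
      (pairwise_colList b.2) (pairwise_colList b'.2) hbb)
    exact Subtype.ext (Prod.ext h1.1 h1.2)
  · intro b hb
    obtain ⟨η, hη, h⟩ := lead_prod_genericMul (K := K) (card_of_mem_colList (n := n) (P := P) b.2)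
    obtain ⟨η', hη', h'⟩ := Lead.of_pm_one (hε b hb)
    refine ⟨η' * η, by simpa using hη'.mul hη, ?_⟩
    have := h'.mul h
    rwa [zero_add, ← mul_assoc] at this

end Independence

/-! ### The commutative algebra defined by the relations -/

section MixedRing

variable {K : Type*} [Field K] {m : ℕ}

theorem FreeMixed.tmul_mul_tmul (p q p' q' : FreeAlgebra K (Fin m × Fin m)) :
    (tmul p q * tmul p' q' : FreeMixed K m) = tmul (p * p') (q * q') :=
  Algebra.TensorProduct.tmul_mul_tmul p p' q q'

theorem FreeMixed.induction {P : FreeMixed K m → Prop} (hC : ∀ c, P (algebraMap K _ c))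
    (hX : ∀ i j, P (genX K m i j)) (hXs : ∀ i j, P (genXs K m i j))
    (hadd : ∀ x y, P x → P y → P (x + y)) (hmul : ∀ x y, P x → P y → P (x * y))
    (x : FreeMixed K m) : P x := by
  have h1 : ∀ p : FreeAlgebra K (Fin m × Fin m), P (FreeMixed.tmul p 1) := by
    intro p
    induction p using FreeAlgebra.induction with
    | grade0 c => exact hC c
    | grade1 x => exact hX x.1 x.2
    | mul p q hp hq =>
      have := hmul _ _ hp hq
      rwa [FreeMixed.tmul_mul_tmul, one_mul] at this
    | add p q hp hq =>
      have : FreeMixed.tmul (p + q) 1 = FreeMixed.tmul p 1 + FreeMixed.tmul q 1 :=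
        TensorProduct.add_tmul _ _ _
      exact this ▸ hadd _ _ hp hq
  have h2 : ∀ p : FreeAlgebra K (Fin m × Fin m), P (FreeMixed.tmul 1 p) := by
    intro p
    induction p using FreeAlgebra.induction with
    | grade0 c =>
      have : (FreeMixed.tmul 1 (algebraMap K _ c) : FreeMixed K m) = algebraMap K _ c :=
        (Algebra.TensorProduct.algebraMap_apply' (R := K) c).symm
      exact this ▸ hC c
    | grade1 x => exact hXs x.1 x.2
    | mul p q hp hq =>
      have := hmul _ _ hp hq
      rwa [FreeMixed.tmul_mul_tmul, one_mul] at this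
    | add p q hp hq =>
      have : FreeMixed.tmul 1 (p + q) = FreeMixed.tmul 1 p + FreeMixed.tmul 1 q :=
        TensorProduct.tmul_add _ _ _
      exact this ▸ hadd _ _ hp hq
  refine TensorProduct.induction_on (motive := P) x ?_ ?_ hadd
  · have := hC 0
    rwa [map_zero] at this
  · intro p q
    have := hmul _ _ (h1 p) (h2 q)
    rwa [FreeMixed.tmul_mul_tmul, one_mul, mul_one] at this

variable (K m) in
/-- The two-sided ideal generated by the relators. -/
def relIdeal : Ideal (FreeMixed K m) where
  carrier := Submodule.span K {y : FreeMixed K m | ∃ p q ρ, IsRelator K m ρ ∧ y = p * ρ * q}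
  add_mem' := Submodule.add_mem _
  zero_mem' := Submodule.zero_mem _
  smul_mem' := by
    intro c x hx
    refine Submodule.span_induction (p := fun x _ => c • x ∈ Submodule.span K _) ?_ ?_ ?_ ?_ hx
    · rintro _ ⟨p, q, ρ, hρ, rfl⟩
      exact Submodule.subset_span ⟨c * p, q, ρ, hρ, by simp only [smul_eq_mul, mul_assoc]⟩
    · rw [smul_zero]; exact Submodule.zero_mem _
    · intro x y _ _ hx hy
      rw [smul_add]; exact Submodule.add_mem _ hx hy
    · intro a x _ hx
      rw [smul_eq_mul, mul_smul_comm]; exact Submodule.smul_mem _ _ hx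

instance : (relIdeal K m).IsTwoSided where
  mul_mem_of_left := by
    intro x c hx
    refine Submodule.span_induction (p := fun x _ => x * c ∈ Submodule.span K _) ?_ ?_ ?_ ?_ hx
    · rintro _ ⟨p, q, ρ, hρ, rfl⟩
      exact Submodule.subset_span ⟨p, q * c, ρ, hρ, by simp only [mul_assoc]⟩
    · rw [zero_mul]; exact Submodule.zero_mem _
    · intro x y _ _ hx hy
      rw [add_mul]; exact Submodule.add_mem _ hx hy
    · intro a x _ hx
      rw [smul_mul_assoc]; exact Submodule.smul_mem _ _ hx

theorem relator_mem_relIdeal {ρ : FreeMixed K m} (h : IsRelator K m ρ) : ρ ∈ relIdeal K m :=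
  Submodule.subset_span ⟨1, 1, ρ, h, by rw [one_mul, mul_one]⟩

theorem genX_mul_genXs (i j k l : Fin m) :
    genX K m i j * genXs K m k l = genXs K m k l * genX K m i j := by
  simp only [genX, genXs, FreeMixed.tmul_mul_tmul, one_mul, mul_one]

/-- The relations make generators of the same kind commute, and the tensor product makes the two
kinds commute with each other. Commutation with generators extends to all elements, first in one
argument and then in the other. -/
theorem mul_comm_mod_relIdeal (x y : FreeMixed K m) :
    Ideal.Quotient.mk (relIdeal K m) x * Ideal.Quotient.mk (relIdeal K m) y =
      Ideal.Quotient.mk (relIdeal K m) y * Ideal.Quotient.mk (relIdeal K m) x := by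
  set q := Ideal.Quotient.mk (relIdeal K m)
  have step : ∀ z, (∀ i j, q z * q (genX K m i j) = q (genX K m i j) * q z) →
      (∀ i j, q z * q (genXs K m i j) = q (genXs K m i j) * q z) → ∀ y, q z * q y = q y * q z := by
    intro z h1 h2 y
    induction y using FreeMixed.induction with
    | hC c => rw [← map_mul, ← map_mul, Algebra.commutes]
    | hX i j => exact h1 i j
    | hXs i j => exact h2 i j
    | hadd x y hx hy => rw [map_add, mul_add, add_mul, hx, hy]
    | hmul x y hx hy => rw [map_mul, ← mul_assoc, hx, mul_assoc, hy, mul_assoc]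
  have hX : ∀ i j y, q (genX K m i j) * q y = q y * q (genX K m i j) := fun i j =>
    step _ (fun k l => by
      rw [← sub_eq_zero, ← map_mul, ← map_mul, ← map_sub]
      exact Ideal.Quotient.eq_zero_iff_mem.mpr (relator_mem_relIdeal (IsRelator.comm_x i j k l)))
      (fun k l => by rw [← map_mul, genX_mul_genXs, map_mul])
  have hXs : ∀ i j y, q (genXs K m i j) * q y = q y * q (genXs K m i j) := fun i j =>
    step _ (fun k l => by rw [← map_mul, ← genX_mul_genXs, map_mul]) (fun k l => by
      rw [← sub_eq_zero, ← map_mul, ← map_mul, ← map_sub]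
      exact Ideal.Quotient.eq_zero_iff_mem.mpr (relator_mem_relIdeal (IsRelator.comm_xs i j k l)))
  exact step x (fun i j => (hX i j x).symm) (fun i j => (hXs i j x).symm) y

variable (K m) in
/-- The quotient of the free algebra by the relations. -/
def MixedRing : Type _ := FreeMixed K m ⧸ relIdeal K m

instance : CommRing (MixedRing K m) :=
  { (Ideal.Quotient.ring (relIdeal K m) : Ring (FreeMixed K m ⧸ relIdeal K m)) with
    mul_comm := fun x y => by
      obtain ⟨x, rfl⟩ := Ideal.Quotient.mk_surjective x
      obtain ⟨y, rfl⟩ := Ideal.Quotient.mk_surjective y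
      exact mul_comm_mod_relIdeal x y }

instance : Algebra K (MixedRing K m) := (Ideal.Quotient.algebra K : Algebra K (_ ⧸ relIdeal K m))

variable (K m) in
/-- The quotient map. -/
def toMixedRing : FreeMixed K m →ₐ[K] MixedRing K m := Ideal.Quotient.mkₐ K (relIdeal K m)

theorem toMixedRing_surjective : Function.Surjective (toMixedRing K m) :=
  Ideal.Quotient.mk_surjective

theorem toMixedRing_eq_zero {x : FreeMixed K m} : toMixedRing K m x = 0 ↔ x ∈ relIdeal K m :=
  Ideal.Quotient.eq_zero_iff_mem

variable {A : Type*} [CommRing A] [Algebra K A]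

/-- Evaluation of the generators at two matrices. -/
def mixedEval (X Z : Matrix (Fin m) (Fin m) A) : FreeMixed K m →ₐ[K] A :=
  (Algebra.TensorProduct.lift (FreeAlgebra.lift K fun p => X p.1 p.2)
    (FreeAlgebra.lift K fun p => Z p.1 p.2) fun _ _ => Commute.all _ _ :
      FreeAlgebra K (Fin m × Fin m) ⊗[K] FreeAlgebra K (Fin m × Fin m) →ₐ[K] A)

theorem mixedEval_tmul (X Z : Matrix (Fin m) (Fin m) A) (p q : FreeAlgebra K (Fin m × Fin m)) :
    mixedEval X Z (FreeMixed.tmul p q) = FreeAlgebra.lift K (fun p => X p.1 p.2) p *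
      FreeAlgebra.lift K (fun p => Z p.1 p.2) q :=
  Algebra.TensorProduct.lift_tmul _ _ _ p q

theorem mixedEval_genX (X Z : Matrix (Fin m) (Fin m) A) (i j : Fin m) :
    mixedEval X Z (genX K m i j) = X i j := by
  rw [genX, mixedEval_tmul, FreeAlgebra.lift_ι_apply, map_one, mul_one]

theorem mixedEval_genXs (X Z : Matrix (Fin m) (Fin m) A) (i j : Fin m) :
    mixedEval X Z (genXs K m i j) = Z i j := by
  rw [genXs, mixedEval_tmul, FreeAlgebra.lift_ι_apply, map_one, one_mul]

theorem mixedEval_monomialX (X Z : Matrix (Fin m) (Fin m) A) {r s : ℕ} (I J : MultiIndex m r s) :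
    mixedEval X Z (monomialX K m r s I J) = (∏ a, X (I.1 a) (J.1 a)) * ∏ b, Z (I.2 b) (J.2 b) := by
  rw [monomialX, mixedEval_tmul, map_list_prod, map_list_prod, List.map_ofFn, List.map_ofFn,
    List.prod_ofFn, List.prod_ofFn]
  simp [FreeAlgebra.lift_ι_apply]

theorem mixedEval_relIdeal {X Z : Matrix (Fin m) (Fin m) A} {c : A}
    (h : ∀ i j, ∑ k, X k i * Z k j = if i = j then c else 0)
    (h' : ∀ i j, ∑ k, X i k * Z j k = if i = j then c else 0) {x : FreeMixed K m}
    (hx : x ∈ relIdeal K m) : mixedEval X Z x = 0 := by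
  have h1 : ∀ ρ, IsRelator K m ρ → mixedEval X Z ρ = 0 := by
    rintro _ (⟨i, j, k, l⟩ | ⟨i, j, k, l⟩ | ⟨i, j, hij⟩ | ⟨i, j, hij⟩ | ⟨i, j⟩)
    · rw [map_sub, map_mul, map_mul, mul_comm, sub_self]
    · rw [map_sub, map_mul, map_mul, mul_comm, sub_self]
    · simp only [map_sum, map_mul, mixedEval_genX, mixedEval_genXs]
      rw [h, if_neg hij]
    · simp only [map_sum, map_mul, mixedEval_genX, mixedEval_genXs]
      rw [h', if_neg hij]
    · simp only [map_sub, map_sum, map_mul, mixedEval_genX, mixedEval_genXs]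
      rw [h, h', if_pos rfl, if_pos rfl, sub_self]
  have h2 : Submodule.span K {y : FreeMixed K m | ∃ p q ρ, IsRelator K m ρ ∧ y = p * ρ * q} ≤
      LinearMap.ker (mixedEval X Z).toLinearMap := by
    rw [Submodule.span_le]
    rintro _ ⟨p, q, ρ, hρ, rfl⟩
    rw [SetLike.mem_coe, LinearMap.mem_ker, AlgHom.toLinearMap_apply, map_mul, map_mul, h1 ρ hρ,
      mul_zero, zero_mul]
  exact h2 hx

/-- The universal property of the quotient by the relations. -/
def MixedRing.lift {X Z : Matrix (Fin m) (Fin m) A} {c : A}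
    (h : ∀ i j, ∑ k, X k i * Z k j = if i = j then c else 0)
    (h' : ∀ i j, ∑ k, X i k * Z j k = if i = j then c else 0) : MixedRing K m →ₐ[K] A :=
  Ideal.Quotient.liftₐ (relIdeal K m) (mixedEval X Z) fun _ => mixedEval_relIdeal h h'

variable (K m) in
/-- The generators `x_{ij}` (for `true`) and `x^*_{ij}` (for `false`) in the quotient. -/
def genMat (b : Bool) : Matrix (Fin m) (Fin m) (MixedRing K m) :=
  Matrix.of fun i j => toMixedRing K m (if b then genX K m i j else genXs K m i j)

variable (K m) in
/-- The common value of the diagonal contractions. -/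
def contr [NeZero m] : MixedRing K m := ∑ k, genMat K m true k 0 * genMat K m false k 0

/-- The diagonal relations equate every column contraction with every row contraction, so all of
them agree with the one named `contr`. A nonzero `m` is needed to name it. -/
theorem sum_genMat_row [NeZero m] (i j : Fin m) :
    ∑ k, genMat K m true i k * genMat K m false j k = if i = j then contr K m else 0 := by
  have h : ∑ k, genMat K m true i k * genMat K m false j k =
      toMixedRing K m (∑ k, genX K m i k * genXs K m j k) := by
    simp [genMat]
  split_ifs with hij
  · subst hij
    rw [h, contr, eq_comm, ← sub_eq_zero]
    have := toMixedRing_eq_zero.mpr (relator_mem_relIdeal (IsRelator.diag (K := K) (0 : Fin m) i))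
    simpa [genMat] using this
  · rw [h, toMixedRing_eq_zero]
    exact relator_mem_relIdeal (IsRelator.row i j hij)

theorem sum_genMat_col [NeZero m] (i j : Fin m) :
    ∑ k, genMat K m true k i * genMat K m false k j = if i = j then contr K m else 0 := by
  have h : ∑ k, genMat K m true k i * genMat K m false k j =
      toMixedRing K m (∑ k, genX K m k i * genXs K m k j) := by
    simp [genMat]
  split_ifs with hij
  · subst hij
    have h2 := sum_genMat_row (K := K) (0 : Fin m) 0
    rw [if_pos rfl] at h2
    rw [h, ← h2, ← sub_eq_zero]
    have := toMixedRing_eq_zero.mpr (relator_mem_relIdeal (IsRelator.diag (K := K) i (0 : Fin m)))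
    simpa [genMat] using this
  · rw [h, toMixedRing_eq_zero]
    exact relator_mem_relIdeal (IsRelator.column i j hij)

end MixedRing

/-! ### Arbitrary products of minors. -/

section AllTabs

variable (K : Type*) {R : Type*} [CommRing K] [CommRing R] [Algebra K R] {m : ℕ}

/-- The span of all products of minors. -/
def allTabs (Mt : Bool → Matrix (Fin m) (Fin m) R) : Submodule K R :=
  Submodule.span K {x | ∃ s, IsTab s ∧ x = prodMinors Mt s}

variable {K}

theorem mul_mem_allTabs {Mt : Bool → Matrix (Fin m) (Fin m) R} {x y : R} (hx : x ∈ allTabs K Mt)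
    (hy : y ∈ allTabs K Mt) : x * y ∈ allTabs K Mt := by
  have h := Submodule.mul_mem_mul hx hy
  rw [allTabs, Submodule.span_mul_span] at h
  refine Submodule.span_mono ?_ h
  rintro _ ⟨_, ⟨s, hs, rfl⟩, _, ⟨s', hs', rfl⟩, rfl⟩
  refine ⟨s + s', fun p hp => ?_, ?_⟩
  · rcases Multiset.mem_add.mp hp with hp | hp
    · exact hs p hp
    · exact hs' p hp
  · simp [prodMinors]

theorem entry_mem_allTabs (Mt : Bool → Matrix (Fin m) (Fin m) R) (b : Bool) (i j : Fin m) :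
    Mt b i j ∈ allTabs K Mt :=
  Submodule.subset_span ⟨{(b, {i}, {j})}, by simp [IsTab],
    by simp [prodMinors, minor_singleton]⟩

theorem algebraMap_mem_allTabs (Mt : Bool → Matrix (Fin m) (Fin m) R) (c : K) :
    algebraMap K R c ∈ allTabs K Mt := by
  rw [Algebra.algebraMap_eq_smul_one]
  exact Submodule.smul_mem _ _ (Submodule.subset_span ⟨0, by simp [IsTab], by simp [prodMinors]⟩)

end AllTabs

/-! ### The coefficient space satisfies no further relations -/

section Injectivity

open Polynomial

variable {K : Type*} [Field K] {m : ℕ}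

theorem map_stdVal {R S : Type*} [CommRing R] [CommRing S] (f : R →+* S)
    (X Z : Matrix (Fin m) (Fin m) R) (L L' : List (Finset (Fin m) × Finset (Fin m))) :
    f (stdVal X Z L L') = stdVal (X.map f) (Z.map f) L L' := by
  simp only [stdVal, map_mul, map_list_prod, List.map_map, Function.comp_def, map_minor]

/-- The degree in the entries of the first matrix. -/
def degX (L : List (Finset (Fin m) × Finset (Fin m))) : ℕ := (L.map fun p => p.1.card).sum

theorem stdVal_smul {R : Type*} [CommRing R] (c : R) (X Z : Matrix (Fin m) (Fin m) R)
    (L L' : List (Finset (Fin m) × Finset (Fin m))) :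
    stdVal (c • X) Z L L' = c ^ degX L * stdVal X Z L L' := by
  rw [stdVal, stdVal, ← mul_assoc]
  congr 1
  induction L with
  | nil => simp [degX]
  | cons p t ih =>
    simp only [degX, List.map_cons, List.prod_cons, List.sum_cons] at ih ⊢
    rw [ih, minor_smul, pow_add]
    ring

theorem sum_cMat_dMat_col (i j : Fin m) :
    ∑ k, cMat K m k i * (dMat K m).transpose k j = if i = j then 1 else 0 := by
  have h := congrFun (congrFun (dMat_mul_cMat (K := K) (m := m)) j) i
  rw [Matrix.mul_apply, Matrix.one_apply] at h
  simp only [eq_comm (a := i)]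
  rw [← h]
  exact Finset.sum_congr rfl fun k _ => mul_comm _ _

theorem sum_cMat_dMat_row (i j : Fin m) :
    ∑ k, cMat K m i k * (dMat K m).transpose j k = if i = j then 1 else 0 := by
  have h := congrFun (congrFun (cMat_mul_dMat (K := K) (m := m)) i) j
  rwa [Matrix.mul_apply, Matrix.one_apply] at h

variable [NeZero m]

/-- Modulo the contraction the generic matrices satisfy both orthogonality relations, so the
straightening theorem applies. Every element is a combination of products of `1 × 1` minors to start
with. -/
theorem mixedRing_mem_stdSpan_sup (y : MixedRing K m) :
    ∃ w ∈ stdSpan K (genMat K m true) (genMat K m false), ∃ z, y = w + contr K m * z := by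
  let I : Ideal (MixedRing K m) := Ideal.span {contr K m}
  let q : MixedRing K m →ₐ[K] MixedRing K m ⧸ I := Ideal.Quotient.mkₐ K I
  have hq : q (contr K m) = 0 :=
    Ideal.Quotient.eq_zero_iff_mem.mpr (Ideal.subset_span (Set.mem_singleton _))
  let Mt : Bool → Matrix (Fin m) (Fin m) (MixedRing K m ⧸ I) := fun b => (genMat K m b).map q
  have h1 : ∀ j j', ∑ k, Mt false k j' * Mt true k j = 0 := by
    intro j j'
    have := congrArg q (sum_genMat_col (K := K) j j')
    rw [apply_ite q, hq, map_zero, ite_self, map_sum] at this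
    rw [← this]
    exact Finset.sum_congr rfl fun k _ => by rw [mul_comm, map_mul]; rfl
  have h2 : ∀ j j', ∑ k, Mt false j' k * Mt true j k = 0 := by
    intro j j'
    have := congrArg q (sum_genMat_row (K := K) j j')
    rw [apply_ite q, hq, map_zero, ite_self, map_sum] at this
    rw [← this]
    exact Finset.sum_congr rfl fun k _ => by rw [mul_comm, map_mul]; rfl
  have h3 : q y ∈ stdSpan K (Mt true) (Mt false) := by
    have h4 : q y ∈ allTabs K Mt := by
      obtain ⟨x, rfl⟩ := toMixedRing_surjective y
      induction x using FreeMixed.induction with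
      | hC c => rw [AlgHom.commutes, AlgHom.commutes]; exact algebraMap_mem_allTabs Mt c
      | hX i j => exact entry_mem_allTabs Mt true i j
      | hXs i j => exact entry_mem_allTabs Mt false i j
      | hadd x y hx hy => rw [map_add, map_add]; exact Submodule.add_mem _ hx hy
      | hmul x y hx hy => rw [map_mul, map_mul]; exact mul_mem_allTabs hx hy
    refine (Submodule.span_le.mpr ?_ : allTabs K Mt ≤ _) h4
    rintro _ ⟨s, hs, rfl⟩
    exact prodMinors_mem_stdSpan h1 h2 s hs
  have h5 : stdSpan K (Mt true) (Mt false) ≤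
      (stdSpan K (genMat K m true) (genMat K m false)).map q.toLinearMap := by
    rw [stdSpan, Submodule.span_le]
    rintro _ ⟨L, L', h, rfl⟩
    exact ⟨_, Submodule.subset_span ⟨L, L', h, rfl⟩, map_stdVal q.toRingHom _ _ _ _⟩
  obtain ⟨w, hw, hwy⟩ := h5 h3
  have h6 : y - w ∈ I := by
    rw [← Ideal.Quotient.eq_zero_iff_mem]
    exact (map_sub q y w).trans (sub_eq_zero.mpr hwy.symm)
  obtain ⟨z, hz⟩ := Ideal.mem_span_singleton'.mp h6
  exact ⟨w, hw, z, by rw [mul_comm, hz]; ring⟩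

variable (K m) in
/-- The span of the products of powers of the contraction with standard bitableaux. -/
def contrSpan : Submodule K (MixedRing K m) :=
  Submodule.span K {x | ∃ k L L', IsStd L L' ∧
    x = contr K m ^ k * stdVal (genMat K m true) (genMat K m false) L L'}

/-- The decomposition modulo the contraction is applied again to its own cofactor. -/
theorem mixedRing_mem_contrSpan_sup (n : ℕ) (y : MixedRing K m) :
    ∃ w ∈ contrSpan K m, ∃ z, y = w + contr K m ^ n * z := by
  induction n with
  | zero => exact ⟨0, Submodule.zero_mem _, y, by simp⟩
  | succ n ih =>
    obtain ⟨w, hw, z, rfl⟩ := ih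
    obtain ⟨w', hw', z', rfl⟩ := mixedRing_mem_stdSpan_sup z
    refine ⟨w + contr K m ^ n * w', Submodule.add_mem _ hw ?_, z', by ring⟩
    have h : stdSpan K (genMat K m true) (genMat K m false) ≤
        (contrSpan K m).comap (Algebra.lmul K (MixedRing K m) (contr K m ^ n)) := by
      rw [stdSpan, Submodule.span_le]
      rintro _ ⟨L, L', h, rfl⟩
      exact Submodule.subset_span ⟨n, L, L', h, rfl⟩
    exact h hw'

theorem sum_smul_genMat_col (i j : Fin m) :
    ∑ k, ((X : (MixedRing K m)[X]) • (genMat K m true).map C) k i *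
      (genMat K m false).map C k j = if i = j then X * C (contr K m) else 0 := by
  have h := congrArg (fun x => X * C x) (sum_genMat_col (K := K) i j)
  simp only [map_sum, Finset.mul_sum, map_mul] at h
  rw [apply_ite C, mul_ite, map_zero, mul_zero] at h
  rw [← h]
  refine Finset.sum_congr rfl fun k _ => ?_
  simp only [Matrix.smul_apply, Matrix.map_apply, smul_eq_mul, mul_assoc]

theorem sum_smul_genMat_row (i j : Fin m) :
    ∑ k, ((X : (MixedRing K m)[X]) • (genMat K m true).map C) i k *
      (genMat K m false).map C j k = if i = j then X * C (contr K m) else 0 := by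
  have h := congrArg (fun x => X * C x) (sum_genMat_row (K := K) i j)
  simp only [map_sum, Finset.mul_sum, map_mul] at h
  rw [apply_ite C, mul_ite, map_zero, mul_zero] at h
  rw [← h]
  refine Finset.sum_congr rfl fun k _ => ?_
  simp only [Matrix.smul_apply, Matrix.map_apply, smul_eq_mul, mul_assoc]

variable (K m) in
/-- The grading by the degree in the generators `x_{ij}`, as a coaction. -/
def gradeHom : MixedRing K m →ₐ[K] (MixedRing K m)[X] :=
  MixedRing.lift (X := (X : (MixedRing K m)[X]) • (genMat K m true).map C)
    (Z := (genMat K m false).map C) sum_smul_genMat_col sum_smul_genMat_row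

theorem gradeHom_genMat_true :
    (genMat K m true).map (gradeHom K m).toRingHom =
      (X : (MixedRing K m)[X]) • (genMat K m true).map C := by
  ext1 i j
  exact mixedEval_genX _ _ i j

theorem gradeHom_genMat_false :
    (genMat K m false).map (gradeHom K m).toRingHom = (genMat K m false).map C := by
  ext1 i j
  exact mixedEval_genXs _ _ i j

theorem gradeHom_contr : gradeHom K m (contr K m) = X * C (contr K m) := by
  have h := sum_smul_genMat_col (K := K) (0 : Fin m) 0
  rw [if_pos rfl] at h
  rw [← h, contr, map_sum]
  refine Finset.sum_congr rfl fun k _ => ?_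
  rw [map_mul, ← gradeHom_genMat_true, ← gradeHom_genMat_false]
  rfl

theorem gradeHom_stdVal (L L' : List (Finset (Fin m) × Finset (Fin m))) :
    gradeHom K m (stdVal (genMat K m true) (genMat K m false) L L') =
      X ^ degX L * C (stdVal (genMat K m true) (genMat K m false) L L') := by
  have h := map_stdVal (gradeHom K m).toRingHom (genMat K m true) (genMat K m false) L L'
  rw [gradeHom_genMat_true, gradeHom_genMat_false, stdVal_smul, ← map_stdVal] at h
  exact h

theorem gradeHom_monomialX {r s : ℕ} (I J : MultiIndex m r s) :
    gradeHom K m (toMixedRing K m (monomialX K m r s I J)) =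
      X ^ r * C (toMixedRing K m (monomialX K m r s I J)) := by
  have h : toMixedRing K m (monomialX K m r s I J) =
      (∏ a, genMat K m true (I.1 a) (J.1 a)) * ∏ b, genMat K m false (I.2 b) (J.2 b) := by
    have h1 : toMixedRing K m = mixedEval (genMat K m true) (genMat K m false) := by
      refine AlgHom.ext fun x => ?_
      induction x using FreeMixed.induction with
      | hC c => rw [AlgHom.commutes, AlgHom.commutes]
      | hX i j => exact (mixedEval_genX (K := K) (genMat K m true) (genMat K m false) i j).symm
      | hXs i j => exact (mixedEval_genXs (K := K) (genMat K m true) (genMat K m false) i j).symm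
      | hadd x y hx hy => rw [map_add, map_add, hx, hy]
      | hmul x y hx hy => rw [map_mul, map_mul, hx, hy]
    rw [h1, mixedEval_monomialX]
  have h2 := mixedEval_monomialX (K := K) ((X : (MixedRing K m)[X]) • (genMat K m true).map C)
    ((genMat K m false).map C) I J
  change gradeHom K m (toMixedRing K m (monomialX K m r s I J)) = _ at h2
  rw [h2, h]
  simp only [Matrix.smul_apply, smul_eq_mul, Finset.prod_mul_distrib, Finset.prod_const,
    Finset.card_univ, Fintype.card_fin, map_mul, map_prod, Matrix.map_apply, mul_assoc]

/-- Elements of `F` have degree `r` in the `x_{ij}`, and the contraction has degree `1`. Projection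
to degree `r` therefore kills the remainder and, in each other term, fixes the exponent of the
contraction. -/
theorem mem_span_of_mem_freePart {r s : ℕ} {f : FreeMixed K m} (hf : f ∈ freePart K m r s) :
    toMixedRing K m f ∈ Submodule.span K (Set.range
      fun b : {b : List (Finset (Fin m) × Finset (Fin m)) ×
        List (Finset (Fin m) × Finset (Fin m)) // IsStd b.1 b.2} =>
        contr K m ^ (r - degX b.1.1) *
          stdVal (genMat K m true) (genMat K m false) b.1.1 b.1.2) := by
  let ρ : MixedRing K m →ₗ[K] MixedRing K m :=
    (Polynomial.lcoeff (MixedRing K m) r).restrictScalars K ∘ₗ (gradeHom K m).toLinearMap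
  have hρ : ∀ y, ρ y = (gradeHom K m y).coeff r := fun _ => rfl
  have h1 : ρ (toMixedRing K m f) = toMixedRing K m f := by
    have : freePart K m r s ≤ LinearMap.eqLocus (ρ ∘ₗ (toMixedRing K m).toLinearMap)
        (toMixedRing K m).toLinearMap := by
      rw [freePart, Submodule.span_le]
      rintro _ ⟨p, rfl⟩
      change ρ (toMixedRing K m (monomialX K m r s p.1 p.2)) = _
      rw [hρ, gradeHom_monomialX, coeff_X_pow_mul', if_pos le_rfl, Nat.sub_self, coeff_C_zero]
      rfl
    exact this hf
  -- The exponent `r + 1` exceeds the degree, so the remainder has no component in degree `r`.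
  obtain ⟨w, hw, z, hwz⟩ := mixedRing_mem_contrSpan_sup (r + 1) (toMixedRing K m f)
  have h2 : ρ (contr K m ^ (r + 1) * z) = 0 := by
    rw [hρ, map_mul, map_pow, gradeHom_contr, mul_pow, mul_assoc, coeff_X_pow_mul',
      if_neg (by omega)]
  rw [← h1, hwz, map_add, h2, add_zero]
  have h3 : contrSpan K m ≤ (Submodule.span K (Set.range
      fun b : {b : List (Finset (Fin m) × Finset (Fin m)) ×
        List (Finset (Fin m) × Finset (Fin m)) // IsStd b.1 b.2} =>
        contr K m ^ (r - degX b.1.1) *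
          stdVal (genMat K m true) (genMat K m false) b.1.1 b.1.2)).comap ρ := by
    rw [contrSpan, Submodule.span_le]
    rintro _ ⟨k, L, L', h, rfl⟩
    rw [SetLike.mem_coe, Submodule.mem_comap]
    have h4 : gradeHom K m (contr K m ^ k * stdVal (genMat K m true) (genMat K m false) L L') =
        X ^ (k + degX L) *
          C (contr K m ^ k * stdVal (genMat K m true) (genMat K m false) L L') := by
      rw [map_mul, map_pow, gradeHom_contr, gradeHom_stdVal, map_mul, map_pow]
      ring
    rw [hρ, h4, coeff_X_pow_mul']
    split_ifs with h5
    · rw [coeff_C]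
      split_ifs with h6
      · have : k = r - degX L := by omega
        rw [this]
        exact Submodule.subset_span ⟨⟨(L, L'), h⟩, rfl⟩
      · exact Submodule.zero_mem _
    · exact Submodule.zero_mem _
  exact h3 hw

/-- Evaluation at the generic matrix and its inverse maps the contraction to `1`, hence a spanning
family of the image of `F` to the linearly independent standard bitableaux. It is therefore
injective on that image. -/
theorem mem_relIdeal_of_mixedEval_of_neZero {r s : ℕ} {f : FreeMixed K m}
    (hf : f ∈ freePart K m r s)
    (h0 : mixedEval (cMat K m) (dMat K m).transpose f = 0) : f ∈ relIdeal K m := by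
  let Θ : MixedRing K m →ₐ[K] GLCoord K m := MixedRing.lift sum_cMat_dMat_col sum_cMat_dMat_row
  have hX : (genMat K m true).map Θ.toRingHom = cMat K m := by
    ext1 i j
    exact mixedEval_genX _ _ i j
  have hZ : (genMat K m false).map Θ.toRingHom = (dMat K m).transpose := by
    ext1 i j
    exact mixedEval_genXs _ _ i j
  have hc : Θ (contr K m) = 1 := by
    have h := sum_cMat_dMat_col (K := K) (0 : Fin m) 0
    rw [if_pos rfl] at h
    rw [← h, contr, map_sum, ← hX, ← hZ]
    exact Finset.sum_congr rfl fun k _ => map_mul _ _ _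
  have hlin : LinearIndependent K (Θ.toLinearMap ∘
      fun b : {b : List (Finset (Fin m) × Finset (Fin m)) ×
        List (Finset (Fin m) × Finset (Fin m)) // IsStd b.1 b.2} =>
        contr K m ^ (r - degX b.1.1) *
          stdVal (genMat K m true) (genMat K m false) b.1.1 b.1.2) := by
    convert linearIndependent_stdVal (K := K) (m := m) using 1
    funext b
    have := map_stdVal Θ.toRingHom (genMat K m true) (genMat K m false) b.1.1 b.1.2
    rw [hX, hZ] at this
    rw [← this]
    change Θ _ = Θ _
    rw [map_mul, map_pow, hc, one_pow, one_mul]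
  have h1 := mem_span_of_mem_freePart hf
  have h2 := Submodule.disjoint_def.mp (Submodule.range_ker_disjoint hlin) _ h1 
    (show Θ (toMixedRing K m f) = 0 from h0)
  exact toMixedRing_eq_zero.mp h2

end Injectivity

theorem mem_relIdeal_of_mixedEval {K : Type*} [Field K] {m r s : ℕ} {f : FreeMixed K m}
    (hf : f ∈ freePart K m r s)
    (h0 : mixedEval (cMat K m) (dMat K m).transpose f = 0) : f ∈ relIdeal K m := by
  rcases Nat.eq_zero_or_pos m with rfl | hm
  -- Without indices there are no monomials except `1`, for `r = s = 0`; the counit shows that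
  -- constants are not lost.
  · have h1 : freePart K 0 r s ≤ Submodule.span K {1} := by
      rw [freePart, Submodule.span_le]
      rintro _ ⟨⟨I, J⟩, rfl⟩
      rcases Nat.eq_zero_or_pos r with rfl | hr
      · rcases Nat.eq_zero_or_pos s with rfl | hs
        · exact Submodule.subset_span rfl
        · exact (I.2 ⟨0, hs⟩).elim0
      · exact (I.1 ⟨0, hr⟩).elim0
    obtain ⟨c, rfl⟩ := Submodule.mem_span_singleton.mp (h1 hf)
    rw [map_smul, map_one, ← Algebra.algebraMap_eq_smul_one] at h0
    have : Function.Injective (counitAlgHom K (GLCoord K 0) ∘ algebraMap K (GLCoord K 0)) := by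
      intro a b hab
      simpa using hab
    have hc : c = 0 := this (by simp only [Function.comp, h0, map_zero])
    rw [hc, zero_smul]
    exact Ideal.zero_mem _
  · have : NeZero m := ⟨hm.ne'⟩
    exact mem_relIdeal_of_mixedEval_of_neZero hf h0

/-! ### Matrices that commute with the diagrams -/

section Diagrams

variable {K : Type*} [Field K] {m r s : ℕ}

open Classical in
/-- The matrix of the operator of a diagram. -/
def diagMat (R : Type*) [CommRing R] (m : ℕ) {r s : ℕ} (σ : WalledDiagram r s) :
    Matrix (MultiIndex m r s) (MultiIndex m r s) R :=
  Matrix.of fun J I => if σ.Compat (label I) (label J) then 1 else 0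

theorem mem_brauerEnd_iff {φ : Module.End K (MixedTensor K m r s)} : φ ∈ brauerEnd K m r s ↔
    ∀ σ : WalledDiagram r s, LinearMap.toMatrixAlgEquiv (mixedBasis K m r s) φ * diagMat K m σ =
      diagMat K m σ * LinearMap.toMatrixAlgEquiv (mixedBasis K m r s) φ := by
  have h1 : ∀ σ : WalledDiagram r s,
      LinearMap.toMatrixAlgEquiv (mixedBasis K m r s) (diagramOp K m r s σ) = diagMat K m σ :=
    fun σ => LinearMap.toMatrixAlgEquiv_toLinAlgEquiv _ _
  have h2 : ∀ σ : WalledDiagram r s, (diagramOp K m r s σ * φ = φ * diagramOp K m r s σ) ↔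
      LinearMap.toMatrixAlgEquiv (mixedBasis K m r s) φ * diagMat K m σ =
      diagMat K m σ * LinearMap.toMatrixAlgEquiv (mixedBasis K m r s) φ := by
    intro σ
    rw [← (LinearMap.toMatrixAlgEquiv (mixedBasis K m r s)).injective.eq_iff, map_mul, map_mul,
      h1, eq_comm]
  have h3 : ∀ σ : WalledDiagram r s, brauerAction K m r s (diagramBasis K r s (m : K) σ) =
      MulOpposite.op (diagramOp K m r s σ) := fun σ =>
    (diagramBasis K r s (m : K)).constr_basis K _ σ
  simp only [← h2]
  rw [brauerEnd, Subalgebra.mem_centralizer_iff]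
  constructor
  · intro h σ
    have := h _ ⟨diagramBasis K r s (m : K) σ, rfl⟩
    simpa only [h3, MulOpposite.unop_op] using this
  · rintro h _ ⟨x, rfl⟩
    refine Submodule.span_induction (p := fun x _ =>
      (brauerAction K m r s x).unop * φ = φ * (brauerAction K m r s x).unop) ?_ ?_ ?_ ?_
      ((diagramBasis K r s (m : K)).mem_span x)
    · rintro _ ⟨σ, rfl⟩
      simpa only [h3, MulOpposite.unop_op] using h σ
    · simp
    · intro x y _ _ hx hy
      rw [map_add, MulOpposite.unop_add, add_mul, mul_add, hx, hy]
    · intro c x _ hx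
      rw [map_smul, MulOpposite.unop_smul, smul_mul_assoc, mul_smul_comm, hx]

theorem label_injective : Function.Injective (label : MultiIndex m r s → Pos r s → Fin m) :=
  (Equiv.sumArrowEquivProdArrow (Fin r) (Fin s) (Fin m)).symm.injective

/-- The diagram of a permutation of the positions on each side of the wall. -/
def permDiagram (π : Equiv.Perm (Fin r)) (ρ : Equiv.Perm (Fin s)) : WalledDiagram r s where
  partner := Sum.elim (fun x => Sum.inr (Equiv.sumCongr π ρ x))
    fun x => Sum.inl ((Equiv.sumCongr π ρ).symm x)
  partner_partner := by rintro (x | x) <;> simp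
  side_partner := by rintro ((x | x) | (x | x)) <;> simp [side]

theorem permDiagram_compat_iff (π : Equiv.Perm (Fin r)) (ρ : Equiv.Perm (Fin s))
    (I J : MultiIndex m r s) : (permDiagram π ρ).Compat (label I) (label J) ↔
      J = (I.1 ∘ π, I.2 ∘ ρ) := by
  have h : label J = label I ∘ Equiv.sumCongr π ρ ↔ J = (I.1 ∘ π, I.2 ∘ ρ) := by
    rw [← label_injective.eq_iff]
    have : label (I.1 ∘ π, I.2 ∘ ρ) = label I ∘ Equiv.sumCongr π ρ := by
      funext x; rcases x with x | x <;> rfl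
    rw [this]
  rw [← h]
  constructor
  · intro hc
    funext x
    exact (hc (Sum.inl x)).symm
  · rintro hc (x | x)
    · exact (congrFun hc x).symm
    · have := congrFun hc ((Equiv.sumCongr π ρ).symm x)
      rw [Function.comp_apply, Equiv.apply_symm_apply] at this
      exact this

/-- Commutation with permutation diagrams is what yields the commutativity relations for the matrix
entries. -/
theorem apply_perm {R : Type*} [CommRing R] {Φ : Matrix (MultiIndex m r s) (MultiIndex m r s) R}
    (h : ∀ σ : WalledDiagram r s, Φ * diagMat R m σ = diagMat R m σ * Φ)
    (π : Equiv.Perm (Fin r)) (ρ : Equiv.Perm (Fin s)) (I J : MultiIndex m r s) :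
    Φ (I.1 ∘ π, I.2 ∘ ρ) (J.1 ∘ π, J.2 ∘ ρ) = Φ I J := by
  classical
  have h1 := congrFun (congrFun (h (permDiagram π ρ)) (I.1 ∘ π, I.2 ∘ ρ)) J
  rw [Matrix.mul_apply, Matrix.mul_apply, Finset.sum_eq_single (J.1 ∘ π, J.2 ∘ ρ),
    Finset.sum_eq_single I] at h1
  · simpa only [diagMat, Matrix.of_apply, permDiagram_compat_iff, if_true, mul_one, one_mul]
      using h1
  · intro I' _ hI'
    rw [diagMat, Matrix.of_apply, if_neg, zero_mul]
    rw [permDiagram_compat_iff]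
    intro hc
    apply hI'
    have h2 := congrArg Prod.fst hc
    have h3 := congrArg Prod.snd hc
    exact (Prod.ext (π.surjective.injective_comp_right h2)
      (ρ.surjective.injective_comp_right h3)).symm
  · simp
  · intro J' _ hJ'
    rw [diagMat, Matrix.of_apply, if_neg, mul_zero]
    rwa [permDiagram_compat_iff]
  · simp

/-- The diagram with one horizontal edge in each row, which joins the first positions on the two
sides of the wall. -/
def contrDiagram (r s : ℕ) : WalledDiagram (r + 1) (s + 1) where
  partner := fun v => if v = Sum.inl (Sum.inl 0) then Sum.inl (Sum.inr 0)
    else if v = Sum.inl (Sum.inr 0) then Sum.inl (Sum.inl 0)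
    else if v = Sum.inr (Sum.inl 0) then Sum.inr (Sum.inr 0)
    else if v = Sum.inr (Sum.inr 0) then Sum.inr (Sum.inl 0)
    else v.swap
  partner_partner := by
    rintro ((x | x) | (x | x)) <;> by_cases hx : x = 0 <;> simp [hx]
  side_partner := by
    rintro ((x | x) | (x | x)) <;> by_cases hx : x = 0 <;> simp [hx, side]

/-- A multi-index with first entries `i` and `j`. -/
def consIndex (i j : Fin m) (I : MultiIndex m r s) : MultiIndex m (r + 1) (s + 1) :=
  (Fin.cons i I.1, Fin.cons j I.2)

theorem contrDiagram_compat_iff (i j i' j' : Fin m) (I I' : MultiIndex m r s) :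
    (contrDiagram r s).Compat (label (consIndex i j I)) (label (consIndex i' j' I')) ↔
      i = j ∧ i' = j' ∧ I = I' := by
  constructor
  · intro h
    refine ⟨?_, ?_, ?_⟩
    · have := h (Sum.inr (Sum.inr 0))
      simpa [contrDiagram, label, consIndex] using this
    · have := h (Sum.inl (Sum.inr 0))
      simpa [contrDiagram, label, consIndex] using this
    · refine Prod.ext (funext fun x => ?_) (funext fun x => ?_)
      · have := h (Sum.inl (Sum.inl x.succ))
        simpa [contrDiagram, label, consIndex] using this
      · have := h (Sum.inl (Sum.inr x.succ))
        simpa [contrDiagram, label, consIndex] using this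
  · rintro ⟨rfl, rfl, rfl⟩ ((x | x) | (x | x)) <;> refine Fin.cases ?_ (fun x => ?_) x <;>
      simp [contrDiagram, label, consIndex]

/-- Multi-indices as first entries and remaining entries. -/
def consIndexEquiv (m r s : ℕ) :
    (Fin m × Fin m) × MultiIndex m r s ≃ MultiIndex m (r + 1) (s + 1) where
  toFun p := consIndex p.1.1 p.1.2 p.2
  invFun I := ((I.1 0, I.2 0), (Fin.tail I.1, Fin.tail I.2))
  left_inv p := by simp [consIndex]
  right_inv I := by simp [consIndex]

theorem sum_mul_ite_diag {R : Type*} [CommRing R] {ι κ : Type*} [Fintype ι] [DecidableEq ι]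
    [Fintype κ] [DecidableEq κ] (P : Prop) [Decidable P] (j : κ) (f : (ι × ι) × κ → R) :
    (∑ p : (ι × ι) × κ, f p * if P ∧ p.1.1 = p.1.2 ∧ j = p.2 then 1 else 0) =
      if P then ∑ k, f ((k, k), j) else 0 := by
  by_cases hP : P
  · simp only [hP, true_and, if_true]
    rw [Fintype.sum_prod_type, Fintype.sum_prod_type]
    refine Finset.sum_congr rfl fun x _ => ?_
    rw [Finset.sum_eq_single x, Finset.sum_eq_single j]
    · simp
    · intro b _ hb
      rw [if_neg fun h => hb h.2.symm, mul_zero]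
    · simp
    · intro b _ hb
      exact Finset.sum_eq_zero fun c _ => by rw [if_neg fun h => hb h.1.symm, mul_zero]
    · simp
  · simp [hP]

/-- Commutation with one contraction diagram contains the remaining relations. The cases where only
one of the two equalities `i = j`, `i' = j'` holds give the vanishing sums, and the case of both
gives equality of the diagonal ones. -/
theorem sum_contr {R : Type*} [CommRing R]
    {Φ : Matrix (MultiIndex m (r + 1) (s + 1)) (MultiIndex m (r + 1) (s + 1)) R}
    (h : ∀ σ : WalledDiagram (r + 1) (s + 1), Φ * diagMat R m σ = diagMat R m σ * Φ)
    (i j i' j' : Fin m) (I J : MultiIndex m r s) :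
    (if i = j then ∑ k, Φ (consIndex i' j' I) (consIndex k k J) else 0) =
      if i' = j' then ∑ k, Φ (consIndex k k I) (consIndex i j J) else 0 := by
  classical
  have h1 := congrFun (congrFun (h (contrDiagram r s)) (consIndex i' j' I)) (consIndex i j J)
  rw [Matrix.mul_apply, Matrix.mul_apply, ← (consIndexEquiv m r s).sum_comp,
    ← (consIndexEquiv m r s).sum_comp] at h1
  simp only [consIndexEquiv, Equiv.coe_fn_mk, diagMat, Matrix.of_apply,
    contrDiagram_compat_iff] at h1
  have h2 := sum_mul_ite_diag (i = j) J
    fun p : (Fin m × Fin m) × MultiIndex m r s =>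
      Φ (consIndex i' j' I) (consIndex p.1.1 p.1.2 p.2)
  have h3 := sum_mul_ite_diag (i' = j') I
    fun p : (Fin m × Fin m) × MultiIndex m r s =>
      Φ (consIndex p.1.1 p.1.2 p.2) (consIndex i j J)
  rw [← h2, ← h3, h1]
  refine Finset.sum_congr rfl fun p _ => ?_
  rw [mul_comm]
  congr 1
  exact if_congr ⟨fun h => ⟨h.2.1, h.1, h.2.2.symm⟩, fun h => ⟨h.2.1, h.1, h.2.2.symm⟩⟩ rfl rfl

end Diagrams

/-! ### The relations hold for the coordinates of the centralizer -/

section Words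

variable {K : Type*} [Field K] {m : ℕ}

variable (K) in
/-- The monomial of two words. -/
def word (u v : List (Fin m × Fin m)) : FreeMixed K m :=
  FreeMixed.tmul (u.map (FreeAlgebra.ι K)).prod (v.map (FreeAlgebra.ι K)).prod

theorem word_mul_word (u v u' v' : List (Fin m × Fin m)) :
    word K u v * word K u' v' = word K (u ++ u') (v ++ v') := by
  rw [word, word, FreeMixed.tmul_mul_tmul, word, List.map_append, List.map_append,
    List.prod_append, List.prod_append]

theorem genX_eq_word (i j : Fin m) : genX K m i j = word K [(i, j)] [] := by simp [genX, word]

theorem genXs_eq_word (i j : Fin m) : genXs K m i j = word K [] [(i, j)] := by simp [genXs, word]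

theorem monomialX_eq_word {r s : ℕ} (I J : MultiIndex m r s) :
    monomialX K m r s I J = word K (List.ofFn fun a => (I.1 a, J.1 a))
      (List.ofFn fun b => (I.2 b, J.2 b)) := by
  simp only [monomialX, word, List.map_ofFn]
  rfl

variable (K m) in
/-- The basis of words. -/
def wordBasis : Module.Basis (FreeMonoid (Fin m × Fin m) × FreeMonoid (Fin m × Fin m)) K
    (FreeMixed K m) :=
  ((FreeAlgebra.basisFreeMonoid K (Fin m × Fin m)).tensorProduct
    (FreeAlgebra.basisFreeMonoid K (Fin m × Fin m)) :
      Module.Basis _ K (FreeAlgebra K (Fin m × Fin m) ⊗[K] FreeAlgebra K (Fin m × Fin m)))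

theorem basisFreeMonoid_apply {X : Type*} (u : FreeMonoid X) :
    FreeAlgebra.basisFreeMonoid K X u = (u.toList.map (FreeAlgebra.ι K)).prod := by
  have h : FreeAlgebra.basisFreeMonoid K X u =
      FreeAlgebra.equivMonoidAlgebraFreeMonoid.symm (MonoidAlgebra.single u 1) := by
    simp [FreeAlgebra.basisFreeMonoid]
  rw [h, ← FreeMonoid.lift_apply, ← one_smul K (FreeMonoid.lift (FreeAlgebra.ι K) u)]
  exact MonoidAlgebra.lift_single _ _ _

theorem wordBasis_apply (p : FreeMonoid (Fin m × Fin m) × FreeMonoid (Fin m × Fin m)) :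
    wordBasis K m p = word K p.1.toList p.2.toList := by
  have h := Module.Basis.tensorProduct_apply (FreeAlgebra.basisFreeMonoid K (Fin m × Fin m))
    (FreeAlgebra.basisFreeMonoid K (Fin m × Fin m)) p.1 p.2
  rw [basisFreeMonoid_apply, basisFreeMonoid_apply] at h
  exact h

theorem mem_span_word (x : FreeMixed K m) : x ∈ Submodule.span K {y | ∃ u v, y = word K u v} := by
  refine Submodule.span_mono ?_ ((wordBasis K m).mem_span x)
  rintro _ ⟨p, rfl⟩
  exact ⟨_, _, wordBasis_apply p⟩

end Words

/-! ### The linear form attached to an element of the centralizer. -/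

section Functional

variable {K : Type*} [Field K] {m r s : ℕ}

/-- The value of the matrix `Φ` on a pair of words. -/
def wordValue (Φ : Matrix (MultiIndex m r s) (MultiIndex m r s) K)
    (u v : List (Fin m × Fin m)) : K :=
  if h : u.length = r ∧ v.length = s then
    Φ (fun a => (u.get (a.cast h.1.symm)).1, fun b => (v.get (b.cast h.2.symm)).1)
      (fun a => (u.get (a.cast h.1.symm)).2, fun b => (v.get (b.cast h.2.symm)).2)
  else 0

theorem wordValue_ofFn (Φ : Matrix (MultiIndex m r s) (MultiIndex m r s) K)
    (f : Fin r → Fin m × Fin m) (g : Fin s → Fin m × Fin m) :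
    wordValue Φ (List.ofFn f) (List.ofFn g) =
      Φ (fun a => (f a).1, fun b => (g b).1) (fun a => (f a).2, fun b => (g b).2) := by
  rw [wordValue, dif_pos (by simp)]
  simp

theorem exists_ofFn {α : Type*} {u : List α} {n : ℕ} (h : u.length = n) :
    ∃ f : Fin n → α, u = List.ofFn f := by
  subst h
  exact ⟨u.get, (List.ofFn_get u).symm⟩

theorem exists_perm_of_ofFn_perm {α : Type*} [DecidableEq α] {n : ℕ} {f g : Fin n → α}
    (h : (List.ofFn f).Perm (List.ofFn g)) : ∃ π : Equiv.Perm (Fin n), g = f ∘ π := by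
  have h1 : Finset.univ.val.map f = Finset.univ.val.map g := by
    rw [Fin.univ_val_map, Fin.univ_val_map]
    exact Multiset.coe_eq_coe.mpr h
  have h2 : ∀ x, Fintype.card {a // g a = x} = Fintype.card {a // f a = x} := by
    intro x
    have := congrArg (Multiset.count x) h1
    rw [Multiset.count_map, Multiset.count_map] at this
    rw [Fintype.card_subtype, Fintype.card_subtype]
    simp only [eq_comm (a := x)] at this
    exact this.symm
  let e : ∀ x, {a // g a = x} ≃ {a // f a = x} := fun x => Fintype.equivOfCardEq (h2 x)
  refine ⟨(Equiv.sigmaFiberEquiv g).symm.trans ((Equiv.sigmaCongrRight e).trans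
    (Equiv.sigmaFiberEquiv f)), funext fun a => ?_⟩
  exact (e (g a) ⟨a, rfl⟩).2.symm

variable {Φ : Matrix (MultiIndex m r s) (MultiIndex m r s) K}

theorem wordValue_perm (h : ∀ σ : WalledDiagram r s, Φ * diagMat K m σ = diagMat K m σ * Φ)
    {u u' v v' : List (Fin m × Fin m)} (hu : u.Perm u') (hv : v.Perm v') :
    wordValue Φ u v = wordValue Φ u' v' := by
  by_cases hl : u.length = r ∧ v.length = s
  · obtain ⟨f, rfl⟩ := exists_ofFn hl.1
    obtain ⟨g, rfl⟩ := exists_ofFn hl.2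
    obtain ⟨f', rfl⟩ := exists_ofFn (hu.length_eq.symm.trans hl.1)
    obtain ⟨g', rfl⟩ := exists_ofFn (hv.length_eq.symm.trans hl.2)
    obtain ⟨π, rfl⟩ := exists_perm_of_ofFn_perm hu
    obtain ⟨ρ, rfl⟩ := exists_perm_of_ofFn_perm hv
    rw [wordValue_ofFn, wordValue_ofFn]
    exact (apply_perm h π ρ _ _).symm
  · rw [wordValue, dif_neg hl, wordValue, dif_neg]
    rwa [← hu.length_eq, ← hv.length_eq]

theorem sum_wordValue_row (h : ∀ σ : WalledDiagram r s, Φ * diagMat K m σ = diagMat K m σ * Φ)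
    (i j i' j' : Fin m) (u v : List (Fin m × Fin m)) :
    (if i = j then ∑ k, wordValue Φ ((i', k) :: u) ((j', k) :: v) else 0) =
      if i' = j' then ∑ k, wordValue Φ ((k, i) :: u) ((k, j) :: v) else 0 := by
  by_cases hl : u.length + 1 = r ∧ v.length + 1 = s
  · obtain ⟨rfl, rfl⟩ := hl
    have h1 := sum_contr h i j i' j' (fun a => (u.get a).1, fun b => (v.get b).1)
      (fun a => (u.get a).2, fun b => (v.get b).2)
    have h2 : ∀ a b c d, wordValue Φ ((a, b) :: u) ((c, d) :: v) =
        Φ (consIndex a c (fun a => (u.get a).1, fun b => (v.get b).1))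
          (consIndex b d (fun a => (u.get a).2, fun b => (v.get b).2)) := by
      intro a b c d
      have h3 := wordValue_ofFn Φ (Fin.cons (a, b) u.get) (Fin.cons (c, d) v.get)
      rw [List.ofFn_cons, List.ofFn_cons, List.ofFn_get, List.ofFn_get] at h3
      rw [h3]
      congr 1
      · refine Prod.ext ?_ ?_ <;> funext x <;> refine Fin.cases ?_ (fun x => ?_) x <;> rfl
      · refine Prod.ext ?_ ?_ <;> funext x <;> refine Fin.cases ?_ (fun x => ?_) x <;> rfl
    simpa only [h2] using h1
  · have h2 : ∀ a b, wordValue Φ (a :: u) (b :: v) = 0 := fun a b => by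
      rw [wordValue, dif_neg]
      simpa using hl
    simp [h2]

/-- The linear form on the free algebra given by `Φ`. -/
def wordForm (Φ : Matrix (MultiIndex m r s) (MultiIndex m r s) K) : FreeMixed K m →ₗ[K] K :=
  (wordBasis K m).constr K fun p => wordValue Φ p.1.toList p.2.toList

theorem wordForm_word (Φ : Matrix (MultiIndex m r s) (MultiIndex m r s) K)
    (u v : List (Fin m × Fin m)) : wordForm Φ (word K u v) = wordValue Φ u v := by
  have h := (wordBasis K m).constr_basis K (fun p => wordValue Φ p.1.toList p.2.toList)
    (FreeMonoid.ofList u, FreeMonoid.ofList v)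
  rw [wordBasis_apply] at h
  exact h

theorem wordForm_monomialX (Φ : Matrix (MultiIndex m r s) (MultiIndex m r s) K)
    (I J : MultiIndex m r s) : wordForm Φ (monomialX K m r s I J) = Φ I J := by
  rw [monomialX_eq_word, wordForm_word, wordValue_ofFn]

/-- Permutation invariance moves the letters of a relator to the front of the surrounding words.
There the contraction identity applies, for any remaining words. -/
theorem wordForm_relIdeal (h : ∀ σ : WalledDiagram r s, Φ * diagMat K m σ = diagMat K m σ * Φ)
    {x : FreeMixed K m} (hx : x ∈ relIdeal K m) : wordForm Φ x = 0 := by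
  have key : ∀ ρ, IsRelator K m ρ → ∀ u v u' v',
      wordForm Φ (word K u v * ρ * word K u' v') = 0 := by
    have hmid : ∀ (u u' : List (Fin m × Fin m)) a, (u ++ [a] ++ u').Perm (a :: (u ++ u')) := by
      intro u u' a
      rw [List.append_assoc, List.singleton_append]
      exact List.perm_middle
    have hmid2 : ∀ (u u' : List (Fin m × Fin m)) a b,
        (u ++ ([a] ++ [b]) ++ u').Perm (u ++ ([b] ++ [a]) ++ u') := by
      intro u u' a b
      exact List.Perm.append_right _ (List.Perm.append_left _ (List.Perm.swap _ _ _))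
    rintro _ (⟨i, j, k, l⟩ | ⟨i, j, k, l⟩ | ⟨i, j, hij⟩ | ⟨i, j, hij⟩ | ⟨i, j⟩) u v u' v' <;>
      simp only [genX_eq_word, genXs_eq_word, mul_sub, sub_mul, Finset.mul_sum, Finset.sum_mul,
        word_mul_word, map_sub, map_sum, wordForm_word, List.append_nil, List.nil_append]
    · rw [wordValue_perm h (hmid2 _ _ _ _) (List.Perm.refl _), sub_self]
    · rw [wordValue_perm h (List.Perm.refl _) (hmid2 _ _ _ _), sub_self]
    · simp only [wordValue_perm h (hmid _ _ _) (hmid _ _ _)]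
      -- The last two indices are set equal, so that the other side of the identity vanishes by `i ≠
      -- j`.
      have := sum_wordValue_row h i j i i (u ++ u') (v ++ v')
      rwa [if_neg hij, if_pos rfl, eq_comm] at this
    · simp only [wordValue_perm h (hmid _ _ _) (hmid _ _ _)]
      have := sum_wordValue_row h i i i j (u ++ u') (v ++ v')
      rwa [if_neg hij, if_pos rfl] at this
    · simp only [wordValue_perm h (hmid _ _ _) (hmid _ _ _)]
      have := sum_wordValue_row h i i j j (u ++ u') (v ++ v')
      rw [if_pos rfl, if_pos rfl] at this
      rw [this, sub_self]
  have hle : Submodule.span K {y : FreeMixed K m | ∃ p q ρ, IsRelator K m ρ ∧ y = p * ρ * q} ≤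
      LinearMap.ker (wordForm Φ) := by
    rw [Submodule.span_le]
    rintro _ ⟨p, q, ρ, hρ, rfl⟩
    rw [SetLike.mem_coe, LinearMap.mem_ker]
    refine Submodule.span_induction (p := fun p _ => wordForm Φ (p * ρ * q) = 0)
      ?_ ?_ ?_ ?_ (mem_span_word p)
    · rintro _ ⟨u, v, rfl⟩
      refine Submodule.span_induction (p := fun q _ => wordForm Φ (word K u v * ρ * q) = 0)
        ?_ ?_ ?_ ?_ (mem_span_word q)
      · rintro _ ⟨u', v', rfl⟩
        exact key ρ hρ u v u' v'
      · simp
      · intro x y _ _ hx hy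
        rw [mul_add, map_add, hx, hy, add_zero]
      · intro c x _ hx
        rw [mul_smul_comm, map_smul, hx, smul_zero]
    · simp
    · intro x y _ _ hx hy
      rw [add_mul, add_mul, map_add, hx, hy, add_zero]
    · intro c x _ hx
      rw [smul_mul_assoc, smul_mul_assoc, map_smul, hx, smul_zero]
  exact hle hx

end Functional

/-! ### The rational Schur algebra commutes with the diagrams -/

section Coefficients

variable {K : Type*} [Field K] {m r s : ℕ}

variable (K m) in
/-- The matrix by which `GL(m)` acts on the tensor factor at a position. -/
def posMat : Pos r s → Matrix (Fin m) (Fin m) (GLCoord K m) :=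
  Sum.elim (fun _ => cMat K m) fun _ => (dMat K m).transpose

variable (K m) in
/-- The inverse of `posMat`. -/
def posMatInv : Pos r s → Matrix (Fin m) (Fin m) (GLCoord K m) :=
  Sum.elim (fun _ => dMat K m) fun _ => (cMat K m).transpose

theorem posMatInv_mul_posMat (x : Pos r s) : posMatInv K m x * posMat K m x = 1 := by
  rcases x with x | x
  · exact dMat_mul_cMat
  · change (cMat K m).transpose * (dMat K m).transpose = 1
    rw [← Matrix.transpose_mul, dMat_mul_cMat, Matrix.transpose_one]

theorem mixedCoeff_eq_prod (I J : MultiIndex m r s) :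
    mixedCoeff K m r s I J = ∏ x, posMat K m x (label I x) (label J x) := by
  rw [Fintype.prod_sum_type]
  rfl

variable (K m r s) in
/-- The matrix of coefficient functions. -/
def coeffMat : Matrix (MultiIndex m r s) (MultiIndex m r s) (GLCoord K m) :=
  Matrix.of fun I J => mixedCoeff K m r s I J

variable (K m r s) in
/-- The inverse of the matrix of coefficient functions. -/
def coeffMatInv : Matrix (MultiIndex m r s) (MultiIndex m r s) (GLCoord K m) :=
  Matrix.of fun I J => ∏ x, posMatInv K m x (label I x) (label J x)

/-- Multi-indices as labellings of the positions. -/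
def labelEquiv (m r s : ℕ) : MultiIndex m r s ≃ (Pos r s → Fin m) :=
  (Equiv.sumArrowEquivProdArrow (Fin r) (Fin s) (Fin m)).symm

theorem prod_one_apply {R X ι : Type*} [CommRing R] [Fintype ι] [DecidableEq X]
    (f g : ι → X) [Decidable (f = g)] :
    ∏ x, (1 : Matrix X X R) (f x) (g x) = if f = g then 1 else 0 := by
  classical
  simp only [Matrix.one_apply, Finset.prod_ite_zero, Finset.prod_const_one, Finset.mem_univ,
    true_imp_iff, funext_iff]

theorem coeffMatInv_mul_coeffMat : coeffMatInv K m r s * coeffMat K m r s = 1 := by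
  classical
  ext I J
  rw [Matrix.mul_apply]
  simp only [coeffMatInv, coeffMat, Matrix.of_apply, mixedCoeff_eq_prod, ← Finset.prod_mul_distrib]
  have h := (labelEquiv m r s).sum_comp fun ℓ => ∏ x,
    (posMatInv K m x (label I x) (ℓ x) * posMat K m x (ℓ x) (label J x))
  refine h.trans ((Fintype.prod_sum fun x k =>
    posMatInv K m x (label I x) k * posMat K m x k (label J x)).symm.trans ?_)
  have h1 : ∀ x : Pos r s, ∑ k, posMatInv K m x (label I x) k * posMat K m x k (label J x) =
      (1 : Matrix (Fin m) (Fin m) (GLCoord K m)) (label I x) (label J x) := fun x => by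
    rw [← posMatInv_mul_posMat x, Matrix.mul_apply]
  simp only [h1]
  rw [prod_one_apply, Matrix.one_apply]
  simp only [label_injective.eq_iff]

/-- The labellings that are constant along the edges of a diagram are determined by their values at
the vertices on one side. -/
def constLabelEquiv (σ : WalledDiagram r s) (X : Type*) :
    {ℓ : Vertex r s → X // ∀ v, ℓ (σ.partner v) = ℓ v} ≃
      ({v : Vertex r s // side v = true} → X) where
  toFun ℓ v := ℓ.1 v
  invFun g := ⟨fun v => if h : side v = true then g ⟨v, h⟩ else
    g ⟨σ.partner v, by rw [σ.side_partner]; simpa using h⟩, fun v => by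
      by_cases h : side v = true
      · have h' : ¬ side (σ.partner v) = true := by rw [σ.side_partner]; simpa using h
        simp only [dif_pos h, dif_neg h', σ.partner_partner]
      · have h' : side (σ.partner v) = true := by rw [σ.side_partner]; simpa using h
        simp only [dif_pos h', dif_neg h]⟩
  left_inv ℓ := by
    refine Subtype.ext (funext fun v => ?_)
    by_cases h : side v = true
    · simp only [dif_pos h]
    · simp only [dif_neg h, ℓ.2]
  right_inv g := by
    funext v
    simp only [dif_pos v.2]

/-- The edges of a diagram join the two sides. -/
def sideEquiv (σ : WalledDiagram r s) :
    {v : Vertex r s // side v = true} ≃ {v : Vertex r s // ¬ side v = true} where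
  toFun v := ⟨σ.partner v, by rw [σ.side_partner, v.2]; simp⟩
  invFun v := ⟨σ.partner v, by rw [σ.side_partner]; simpa using v.2⟩
  left_inv v := Subtype.ext (σ.partner_partner v)
  right_inv v := Subtype.ext (σ.partner_partner v)

/-- The triple product is a sum over labellings that are constant along edges. It factors over the
edges, and each edge contributes an entry of `C C⁻¹`: one end carries `C` and the other `C⁻¹`,
because the partner lies on the other side. -/
theorem coeffMat_mul_diagMat (σ : WalledDiagram r s) :
    coeffMat K m r s * diagMat (GLCoord K m) m σ * coeffMatInv K m r s =
      diagMat (GLCoord K m) m σ := by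
  classical
  ext I J
  let out : Vertex r s → Fin m := Sum.elim (label I) (label J)
  let f : Vertex r s → Fin m → GLCoord K m := fun v k =>
    if side v = true then cMat K m (out v) k else dMat K m k (out v)
  have h1 : (coeffMat K m r s * diagMat (GLCoord K m) m σ * coeffMatInv K m r s) I J =
      ∑ ℓ : Vertex r s → Fin m, if ∀ v, ℓ (σ.partner v) = ℓ v then ∏ v, f v (ℓ v) else 0 := by
    have h2 : ∀ L M : MultiIndex m r s,
        coeffMat K m r s I L * diagMat (GLCoord K m) m σ L M * coeffMatInv K m r s M J =
        if ∀ v, (Sum.elim (label L) (label M) : Vertex r s → Fin m) (σ.partner v) =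
          (Sum.elim (label L) (label M) : Vertex r s → Fin m) v then
          ∏ v, f v ((Sum.elim (label L) (label M) : Vertex r s → Fin m) v) else 0 := by
      intro L M
      have h3 : ∏ v, f v ((Sum.elim (label L) (label M) : Vertex r s → Fin m) v) =
          coeffMat K m r s I L * coeffMatInv K m r s M J := by
        rw [Fintype.prod_sum_type, coeffMat, coeffMatInv, Matrix.of_apply, Matrix.of_apply,
          mixedCoeff_eq_prod]
        congr 1
        · refine Finset.prod_congr rfl ?_
          rintro (x | x) _ <;> simp [f, side, posMat, out]
        · refine Finset.prod_congr rfl ?_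
          rintro (x | x) _ <;> simp [f, side, posMatInv, out]
      rw [h3, diagMat, Matrix.of_apply, WalledDiagram.Compat]
      split_ifs <;> ring
    rw [← (Equiv.sumArrowEquivProdArrow (Pos r s) (Pos r s) (Fin m)).symm.sum_comp,
      ← ((labelEquiv m r s).prodCongr (labelEquiv m r s)).sum_comp, Fintype.sum_prod_type_right]
    simp only [Matrix.mul_apply, Finset.sum_mul, h2]
    rfl
  have h4 : (∑ ℓ : Vertex r s → Fin m, if ∀ v, ℓ (σ.partner v) = ℓ v then ∏ v, f v (ℓ v) else 0) =
      ∑ ℓ : {ℓ : Vertex r s → Fin m // ∀ v, ℓ (σ.partner v) = ℓ v}, ∏ v, f v (ℓ.1 v) := by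
    rw [← Finset.sum_filter]
    exact Finset.sum_subtype _ (by simp) _
  have h5 : ∀ g : {v : Vertex r s // side v = true} → Fin m,
      ∏ v, f v (((constLabelEquiv σ (Fin m)).symm g).1 v) =
        ∏ v : {v : Vertex r s // side v = true},
          cMat K m (out v) (g v) * dMat K m (g v) (out (σ.partner v)) := by
    intro g
    rw [← Fintype.prod_subtype_mul_prod_subtype (fun v : Vertex r s => side v = true),
      ← (sideEquiv σ).prod_comp, ← Finset.prod_mul_distrib]
    refine Finset.prod_congr rfl fun v _ => ?_
    have h6 : ((constLabelEquiv σ (Fin m)).symm g).1 v = g v :=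
      congrFun ((constLabelEquiv σ (Fin m)).apply_symm_apply g) v
    have h7 := ((constLabelEquiv σ (Fin m)).symm g).2 v
    have h8 : ((sideEquiv σ v : {v : Vertex r s // ¬ side v = true}) : Vertex r s) =
        σ.partner v := rfl
    rw [h8, h7, h6]
    simp only [f, v.2, σ.side_partner, if_true, Bool.not_true, Bool.false_eq_true, if_false]
  rw [h1, h4, ← (constLabelEquiv σ (Fin m)).symm.sum_comp, Finset.sum_congr rfl fun g _ => h5 g]
  refine (Fintype.prod_sum fun (v : {v : Vertex r s // side v = true}) k =>
    cMat K m (out v) k * dMat K m k (out (σ.partner v))).symm.trans ?_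
  have h9 : ∀ v : {v : Vertex r s // side v = true},
      ∑ k, cMat K m (out v) k * dMat K m k (out (σ.partner v)) =
      (1 : Matrix (Fin m) (Fin m) (GLCoord K m)) (out v) (out (σ.partner v)) := fun v => by
    rw [← cMat_mul_dMat, Matrix.mul_apply]
  simp only [h9]
  rw [prod_one_apply, diagMat, Matrix.of_apply]
  refine if_congr ⟨fun h v => ?_, fun h => funext fun v => (h v).symm⟩ rfl rfl
  by_cases hv : side v = true
  · exact (congrFun h ⟨v, hv⟩).symm
  · have := congrFun h ⟨σ.partner v, by rw [σ.side_partner]; simpa using hv⟩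
    simpa only [σ.partner_partner] using this

theorem coeffMat_comm (σ : WalledDiagram r s) :
    coeffMat K m r s * diagMat (GLCoord K m) m σ = diagMat (GLCoord K m) m σ * coeffMat K m r s := by
  have h := congrArg (· * coeffMat K m r s) (coeffMat_mul_diagMat (K := K) (m := m) σ)
  simpa only [mul_assoc, coeffMatInv_mul_coeffMat, mul_one] using h

theorem toMatrix_distAction (μ : Dist K m) :
    LinearMap.toMatrixAlgEquiv (mixedBasis K m r s) (distAction K m r s μ) =
      Matrix.of fun I J => μ.1 (mixedCoeff K m r s I J) :=
  LinearMap.toMatrixAlgEquiv_toLinAlgEquiv _ _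

/-- Applying a distribution entrywise to the commutation identity over `K[GL(m)]` preserves it,
since the diagram matrices have entries `0` and `1`. -/
theorem rationalSchur_le_brauerEnd : rationalSchur K m r s ≤ brauerEnd K m r s := by
  classical
  rintro _ ⟨μ, rfl⟩
  refine mem_brauerEnd_iff.mpr fun σ => ?_
  refine (toMatrix_distAction (r := r) (s := s) μ).symm ▸ ?_
  ext I J
  have h := congrArg μ.1.ofConv (congrFun (congrFun (coeffMat_comm (K := K) (m := m) σ) I) J)
  rw [Matrix.mul_apply, Matrix.mul_apply, map_sum, map_sum] at h
  rw [Matrix.mul_apply, Matrix.mul_apply]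
  simp only [diagMat, coeffMat, Matrix.of_apply, mul_ite, ite_mul, mul_one, mul_zero, one_mul,
    zero_mul, apply_ite μ.1.ofConv, map_zero] at h ⊢
  exact h

end Coefficients

/-! ### Separation of functions by distributions; the transposition automorphism. -/

section Separation

variable {K : Type*} [Field K] {m : ℕ}

theorem det_mvPolynomialX_mem_nonZeroDivisors :
    Submonoid.powers (Matrix.mvPolynomialX (Fin m) (Fin m) K).det ≤
      nonZeroDivisors (MvPolynomial (Fin m × Fin m) K) :=
  powers_le_nonZeroDivisors_of_noZeroDivisors (Matrix.det_mvPolynomialX_ne_zero (Fin m) K)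

instance : IsDomain (GLCoord K m) :=
  IsLocalization.isDomain_of_le_nonZeroDivisors _
    (det_mvPolynomialX_mem_nonZeroDivisors (K := K) (m := m))

instance : IsNoetherianRing (GLCoord K m) :=
  IsLocalization.isNoetherianRing
    (Submonoid.powers (Matrix.mvPolynomialX (Fin m) (Fin m) K).det) (GLCoord K m) inferInstance

/-- Distributions separate the points of `K[GL(m)]`. -/
theorem eq_zero_of_dist {f : GLCoord K m} (h : ∀ μ : Dist K m, μ.1 f = 0) : f = 0 := by
  by_contra hf
  -- Krull's theorem for a Noetherian domain. A nonzero function lies outside some power of the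
  -- ideal, and a linear form killing that power but not the function is a distribution.
  have h1 : ⨅ n : ℕ, augIdeal K m ^ n = ⊥ :=
    Ideal.iInf_pow_eq_bot_of_isDomain _ (RingHom.ker_ne_top _)
  have h2 : ∃ n, f ∉ augIdeal K m ^ n := by
    by_contra hn
    push Not at hn
    have : f ∈ ⨅ n : ℕ, augIdeal K m ^ n := by simpa [Submodule.mem_iInf] using hn
    rw [h1] at this
    exact hf this
  obtain ⟨n, hn⟩ := h2
  obtain ⟨ψ, hψ, hle⟩ := Submodule.exists_le_ker_of_notMem
    (p := (augIdeal K m ^ n).restrictScalars K) (v := f) hn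
  refine hψ (h ⟨WithConv.toConv ψ, n, fun g hg => ?_⟩)
  exact hle (Ideal.pow_le_pow_right (Nat.le_succ n) hg)

variable (K m) in
/-- The automorphism of `K[GL(m)]` that transposes the generic matrix. -/
def transposeHom : GLCoord K m →ₐ[K] GLCoord K m :=
  liftGL (cMat K m).transpose (by rw [Matrix.det_transpose]; exact isUnit_det_cMat K m)

theorem transposeHom_cMat (i j : Fin m) : transposeHom K m (cMat K m i j) = cMat K m j i :=
  liftGL_cMat _ _ i j

theorem transposeHom_dMat (i j : Fin m) : transposeHom K m (dMat K m i j) = dMat K m j i := by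
  refine map_dMat (transposeHom K m) (cMat K m).transpose (dMat K m).transpose transposeHom_cMat ?_
    i j
  rw [← Matrix.transpose_mul, dMat_mul_cMat, Matrix.transpose_one]

theorem transposeHom_transposeHom (f : GLCoord K m) :
    transposeHom K m (transposeHom K m f) = f := by
  have h : (transposeHom K m).comp (transposeHom K m) = AlgHom.id K _ := by
    apply algHom_ext_GL
    intro i j
    rw [AlgHom.comp_apply, transposeHom_cMat, transposeHom_cMat, AlgHom.id_apply]
  exact DFunLike.congr_fun h f

theorem transposeHom_mixedCoeff {r s : ℕ} (I J : MultiIndex m r s) :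
    transposeHom K m (mixedCoeff K m r s I J) = mixedCoeff K m r s J I := by
  simp only [mixedCoeff, map_mul, map_prod, transposeHom_cMat, transposeHom_dMat]

end Separation

/-! ### The comparison of the dual spaces -/

section Spanning

variable {K : Type*} [Field K] {m r s : ℕ}

/-- Two spanning families with the same linear relations are quotients of the same free space by the
same kernel. -/
theorem exists_linearEquiv_of_span {ι A B : Type*} [AddCommGroup A] [Module K A] [AddCommGroup B]
    [Module K B] {v : ι → A} {w : ι → B} (hv : Submodule.span K (Set.range v) = ⊤)
    (hw : Submodule.span K (Set.range w) = ⊤)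
    (h : ∀ l, Finsupp.linearCombination K v l = 0 ↔ Finsupp.linearCombination K w l = 0) :
    ∃ e : A ≃ₗ[K] B, ∀ i, e (v i) = w i := by
  have hv' := LinearMap.range_eq_top.mp ((Finsupp.range_linearCombination K (v := v)).trans hv)
  have hw' := LinearMap.range_eq_top.mp ((Finsupp.range_linearCombination K (v := w)).trans hw)
  have hker : LinearMap.ker (Finsupp.linearCombination K v) =
      LinearMap.ker (Finsupp.linearCombination K w) := by
    ext l
    exact h l
  refine ⟨((Finsupp.linearCombination K v).quotKerEquivOfSurjective hv').symm.trans
    ((Submodule.quotEquivOfEq _ _ hker).trans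
      ((Finsupp.linearCombination K w).quotKerEquivOfSurjective hw')), fun i => ?_⟩
  have h1 : ((Finsupp.linearCombination K v).quotKerEquivOfSurjective hv').symm (v i) =
      Submodule.Quotient.mk (Finsupp.single i 1) := by
    rw [LinearEquiv.symm_apply_eq, LinearMap.quotKerEquivOfSurjective_apply_mk]
    simp
  rw [LinearEquiv.trans_apply, LinearEquiv.trans_apply, h1, Submodule.quotEquivOfEq_mk,
    LinearMap.quotKerEquivOfSurjective_apply_mk]
  simp

theorem coordFun_apply (I J : MultiIndex m r s) (φ : Module.End K (MixedTensor K m r s)) :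
    coordFun K m r s I J φ = LinearMap.toMatrixAlgEquiv (mixedBasis K m r s) φ I J := by
  rw [LinearMap.toMatrixAlgEquiv_apply]
  rfl

theorem span_coordFun : Submodule.span K (Set.range fun p : MultiIndex m r s × MultiIndex m r s =>
    coordFun K m r s p.1 p.2) = ⊤ := by
  classical
  rw [eq_top_iff]
  intro ψ _
  let M := LinearMap.toMatrixAlgEquiv (mixedBasis K m r s)
  have h : ψ = ∑ I, ∑ J, ψ (M.symm (Matrix.single I J 1)) • coordFun K m r s I J := by
    ext1 φ
    have h1 : φ = ∑ I, ∑ J, coordFun K m r s I J φ • M.symm (Matrix.single I J 1) := by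
      apply M.injective
      simp only [map_sum, map_smul, AlgEquiv.apply_symm_apply, coordFun_apply]
      conv_lhs => rw [Matrix.matrix_eq_sum_single (M φ)]
      refine Finset.sum_congr rfl fun I _ => Finset.sum_congr rfl fun J _ => ?_
      rw [Matrix.smul_single, smul_eq_mul, mul_one]
    conv_lhs => rw [h1]
    simp only [map_sum, map_smul, LinearMap.sum_apply, LinearMap.smul_apply, smul_eq_mul, mul_comm]
  rw [h]
  exact Submodule.sum_mem _ fun I _ => Submodule.sum_mem _ fun J _ =>
    Submodule.smul_mem _ _ (Submodule.subset_span ⟨(I, J), rfl⟩)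

/-- Linear forms on a subspace extend to the whole space, where the coordinates span. -/
theorem span_coordFun_restrict (S : Subalgebra K (Module.End K (MixedTensor K m r s))) :
    Submodule.span K (Set.range fun p : MultiIndex m r s × MultiIndex m r s =>
      (coordFun K m r s p.1 p.2).comp S.val.toLinearMap) = ⊤ := by
  have h : Submodule.span K (Set.range fun p : MultiIndex m r s × MultiIndex m r s =>
      (coordFun K m r s p.1 p.2).comp S.val.toLinearMap) =
      (Submodule.span K (Set.range fun p : MultiIndex m r s × MultiIndex m r s =>
        coordFun K m r s p.1 p.2)).map (Module.Dual.transpose S.val.toLinearMap) := by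
    rw [Submodule.map_span, ← Set.range_comp]
    rfl
  rw [h, span_coordFun, Submodule.map_top, LinearMap.range_eq_top]
  intro ψ
  let _ : AddCommGroup (Module.End K (MixedTensor K m r s)) :=
    Module.addCommMonoidToAddCommGroup K
  obtain ⟨g, hg⟩ := LinearMap.exists_extend (p := Subalgebra.toSubmodule S)
    (show Subalgebra.toSubmodule S →ₗ[K] K from ψ)
  exact ⟨g, hg⟩

theorem span_monomialClass : Submodule.span K
    (Set.range fun p : MultiIndex m r s × MultiIndex m r s => monomialClass K m r s p.1 p.2) =
      ⊤ := by
  let v : MultiIndex m r s × MultiIndex m r s → freePart K m r s := fun p =>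
    ⟨monomialX K m r s p.1 p.2, Submodule.subset_span ⟨p, rfl⟩⟩
  have h : Submodule.span K (Set.range v) = ⊤ := by
    apply Submodule.map_injective_of_injective (freePart K m r s).injective_subtype
    rw [Submodule.map_span, ← Set.range_comp, Submodule.map_top, Submodule.range_subtype]
    rfl
  have h1 : Submodule.span K (Set.range fun p : MultiIndex m r s × MultiIndex m r s =>
      monomialClass K m r s p.1 p.2) = (Submodule.span K (Set.range v)).map
        (relPart K m r s).mkQ := by
    rw [Submodule.map_span, ← Set.range_comp]
    rfl
  rw [h1, h, Submodule.map_top, Submodule.range_mkQ]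

theorem exists_prod_eq_prod_pow {α : Type*} [Fintype α] {n : ℕ} {a : α → ℕ} (ha : ∑ p, a p = n) :
    ∃ g : Fin n → α, ∀ {R : Type _} [CommRing R] (f : α → R), ∏ i, f (g i) = ∏ p, f p ^ a p := by
  let t : Multiset α := ∑ p, a p • {p}
  have ht : t.toList.length = n := by
    rw [Multiset.length_toList, ← ha, Multiset.card_sum]
    simp
  obtain ⟨g, hg⟩ := exists_ofFn ht
  refine ⟨g, fun {R} _ f => ?_⟩
  rw [← List.prod_ofFn]
  have h1 : (List.ofFn fun i => f (g i)) = t.toList.map f := by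
    rw [hg, List.map_ofFn]
    rfl
  rw [h1, ← Multiset.prod_coe, ← Multiset.map_coe, Multiset.coe_toList]
  have h2 : t.map f = ∑ p, a p • {f p} := by
    rw [← Multiset.coe_mapAddMonoidHom, map_sum]
    refine Finset.sum_congr rfl fun p _ => ?_
    rw [map_nsmul, Multiset.coe_mapAddMonoidHom, Multiset.map_singleton]
  rw [h2, Multiset.prod_sum]
  refine Finset.prod_congr rfl fun p _ => ?_
  rw [Multiset.prod_nsmul, Multiset.prod_singleton]

theorem prod_eq_prod_pow_card {R α : Type*} [CommRing R] [Fintype α] [DecidableEq α] {n : ℕ}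
    (g : Fin n → α) (f : α → R) :
    ∏ i, f (g i) = ∏ p, f p ^ (Finset.univ.filter fun i => g i = p).card := by
  rw [← Finset.prod_fiberwise Finset.univ g]
  refine Finset.prod_congr rfl fun p _ => ?_
  rw [Finset.prod_congr rfl fun i hi => by rw [(Finset.mem_filter.mp hi).2], Finset.prod_const]

theorem coeffSpace_eq_span : coeffSpace K m r s = Submodule.span K
    (Set.range fun p : MultiIndex m r s × MultiIndex m r s => mixedCoeff K m r s p.1 p.2) := by
  classical
  refine le_antisymm (Submodule.span_le.mpr ?_) (Submodule.span_le.mpr ?_)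
  · rintro _ ⟨a, b, ha, hb, rfl⟩
    obtain ⟨g, hg⟩ := exists_prod_eq_prod_pow ha
    obtain ⟨g', hg'⟩ := exists_prod_eq_prod_pow hb
    refine Submodule.subset_span
      ⟨((fun i => (g i).1, fun i => (g' i).2), (fun i => (g i).2, fun i => (g' i).1)), ?_⟩
    rw [← hg fun p => cMat K m p.1 p.2, ← hg' fun p => dMat K m p.1 p.2]
    rfl
  · rintro _ ⟨⟨I, J⟩, rfl⟩
    refine Submodule.subset_span
      ⟨fun p => (Finset.univ.filter fun i => (I.1 i, J.1 i) = p).card,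
        fun p => (Finset.univ.filter fun i => (J.2 i, I.2 i) = p).card, ?_, ?_, ?_⟩
    · rw [← Finset.card_eq_sum_card_fiberwise (by simp [Set.MapsTo])]
      simp
    · rw [← Finset.card_eq_sum_card_fiberwise (by simp [Set.MapsTo])]
      simp
    · rw [← prod_eq_prod_pow_card (fun i => (I.1 i, J.1 i)) fun p => cMat K m p.1 p.2,
        ← prod_eq_prod_pow_card (fun i => (J.2 i, I.2 i)) fun p => dMat K m p.1 p.2]
      rfl

theorem mixedCoeff_mem_coeffSpace (I J : MultiIndex m r s) :
    mixedCoeff K m r s I J ∈ coeffSpace K m r s := by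
  rw [coeffSpace_eq_span]
  exact Submodule.subset_span ⟨(I, J), rfl⟩

theorem span_mixedCoeff : Submodule.span K
    (Set.range fun p : MultiIndex m r s × MultiIndex m r s =>
      (⟨mixedCoeff K m r s p.1 p.2, mixedCoeff_mem_coeffSpace p.1 p.2⟩ : coeffSpace K m r s)) =
      ⊤ := by
  apply Submodule.map_injective_of_injective (coeffSpace K m r s).injective_subtype
  rw [Submodule.map_span, ← Set.range_comp, Submodule.map_top, Submodule.range_subtype]
  exact coeffSpace_eq_span.symm

theorem span_mixedCoeff_swap : Submodule.span K
    (Set.range fun p : MultiIndex m r s × MultiIndex m r s =>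
      (⟨mixedCoeff K m r s p.2 p.1, mixedCoeff_mem_coeffSpace p.2 p.1⟩ : coeffSpace K m r s)) =
      ⊤ := by
  rw [← span_mixedCoeff, ← (Equiv.prodComm (MultiIndex m r s) (MultiIndex m r s)).surjective.range_comp]
  rfl

end Spanning

/-! ### The cycle of implications between the four kernels. -/

section Kernels

variable {K : Type*} [Field K] {m r s : ℕ}

variable (K m r s) in
/-- The linear form on `End_K(V^{⊗r} ⊗ W^{⊗s})` with given coordinates. -/
def coordComb : (MultiIndex m r s × MultiIndex m r s →₀ K) →ₗ[K]
    Module.Dual K (Module.End K (MixedTensor K m r s)) :=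
  Finsupp.linearCombination K fun p => coordFun K m r s p.1 p.2

variable (K m r s) in
/-- The combination of coefficient functions with given coordinates. -/
def coeffComb : (MultiIndex m r s × MultiIndex m r s →₀ K) →ₗ[K] GLCoord K m :=
  Finsupp.linearCombination K fun p => mixedCoeff K m r s p.1 p.2

variable (K m r s) in
/-- The combination of monomials with given coordinates. -/
def monomialComb : (MultiIndex m r s × MultiIndex m r s →₀ K) →ₗ[K] FreeMixed K m :=
  Finsupp.linearCombination K fun p => monomialX K m r s p.1 p.2

variable {l : MultiIndex m r s × MultiIndex m r s →₀ K}

theorem coordComb_distAction (μ : Dist K m) :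
    coordComb K m r s l (distAction K m r s μ) = μ.1 (coeffComb K m r s l) := by
  have h : (LinearMap.applyₗ (distAction K m r s μ)).comp (coordComb K m r s) =
      μ.1.ofConv.comp (coeffComb K m r s) := by
    ext p
    simp only [coordComb, coeffComb, LinearMap.comp_apply, Finsupp.lsingle_apply,
      Finsupp.linearCombination_single, one_smul, LinearMap.applyₗ_apply_apply]
    rw [coordFun_apply, toMatrix_distAction]
    rfl
  exact DFunLike.congr_fun h l

theorem coeffComb_eq_zero_of_rationalSchur
    (h : ∀ φ ∈ rationalSchur K m r s, coordComb K m r s l φ = 0) : coeffComb K m r s l = 0 :=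
  eq_zero_of_dist fun μ => by rw [← coordComb_distAction]; exact h _ ⟨μ, rfl⟩

theorem monomialComb_mem_relIdeal (h : coeffComb K m r s l = 0) :
    monomialComb K m r s l ∈ relIdeal K m := by
  refine mem_relIdeal_of_mixedEval (r := r) (s := s) ?_ ?_
  · have := LinearMap.mem_range_self (monomialComb K m r s) l
    rw [monomialComb, Finsupp.range_linearCombination] at this
    exact this
  · have h1 : (mixedEval (cMat K m) (dMat K m).transpose).toLinearMap.comp (monomialComb K m r s) =
        coeffComb K m r s := by
      ext p
      simp only [monomialComb, coeffComb, LinearMap.comp_apply, Finsupp.lsingle_apply,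
        Finsupp.linearCombination_single, one_smul, AlgHom.toLinearMap_apply, mixedEval_monomialX]
      rfl
    exact (DFunLike.congr_fun h1 l).trans h

theorem coordComb_eq_zero_of_relIdeal (h : monomialComb K m r s l ∈ relIdeal K m)
    {φ : Module.End K (MixedTensor K m r s)} (hφ : φ ∈ brauerEnd K m r s) :
    coordComb K m r s l φ = 0 := by
  have h1 : (LinearMap.applyₗ φ).comp (coordComb K m r s) =
      (wordForm (LinearMap.toMatrixAlgEquiv (mixedBasis K m r s) φ)).comp
        (monomialComb K m r s) := by
    ext p
    simp only [coordComb, monomialComb, LinearMap.comp_apply, Finsupp.lsingle_apply,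
      Finsupp.linearCombination_single, one_smul, LinearMap.applyₗ_apply_apply]
    rw [coordFun_apply, wordForm_monomialX]
  exact (DFunLike.congr_fun h1 l).trans (wordForm_relIdeal (mem_brauerEnd_iff.mp hφ) h)

/-- This closes the cycle: forward through the smaller algebra and the separation of functions,
backward through the relation ideal. -/
theorem brauerEnd_vanishing_iff : (∀ φ ∈ brauerEnd K m r s, coordComb K m r s l φ = 0) ↔
    coeffComb K m r s l = 0 :=
  ⟨fun h => coeffComb_eq_zero_of_rationalSchur fun φ hφ => h φ (rationalSchur_le_brauerEnd hφ),
    fun h _ hφ => coordComb_eq_zero_of_relIdeal (monomialComb_mem_relIdeal h) hφ⟩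

theorem rationalSchur_vanishing_iff :
    (∀ φ ∈ rationalSchur K m r s, coordComb K m r s l φ = 0) ↔ coeffComb K m r s l = 0 :=
  ⟨coeffComb_eq_zero_of_rationalSchur, fun h φ hφ =>
    brauerEnd_vanishing_iff.mpr h φ (rationalSchur_le_brauerEnd hφ)⟩

theorem monomialComb_mem_relIdeal_iff :
    monomialComb K m r s l ∈ relIdeal K m ↔ coeffComb K m r s l = 0 :=
  ⟨fun h => brauerEnd_vanishing_iff.mp fun _ hφ => coordComb_eq_zero_of_relIdeal h hφ,
    monomialComb_mem_relIdeal⟩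

theorem linearCombination_restrict_eq_zero_iff
    (S : Subalgebra K (Module.End K (MixedTensor K m r s))) :
    Finsupp.linearCombination K (fun p : MultiIndex m r s × MultiIndex m r s =>
      (coordFun K m r s p.1 p.2).comp S.val.toLinearMap) l = 0 ↔
      ∀ φ ∈ S, coordComb K m r s l φ = 0 := by
  have h : Finsupp.linearCombination K (fun p : MultiIndex m r s × MultiIndex m r s =>
      (coordFun K m r s p.1 p.2).comp S.val.toLinearMap) =
      (Module.Dual.transpose S.val.toLinearMap).comp (coordComb K m r s) := by
    ext p
    simp only [coordComb, LinearMap.comp_apply, Finsupp.lsingle_apply,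
      Finsupp.linearCombination_single, one_smul]
    rfl
  rw [h]
  constructor
  · intro h φ hφ
    exact DFunLike.congr_fun h ⟨φ, hφ⟩
  · intro h
    ext φ
    exact h φ.1 φ.2

theorem linearCombination_monomialClass_eq_zero_iff :
    Finsupp.linearCombination K (fun p : MultiIndex m r s × MultiIndex m r s =>
      monomialClass K m r s p.1 p.2) l = 0 ↔ coeffComb K m r s l = 0 := by
  let v : MultiIndex m r s × MultiIndex m r s → freePart K m r s := fun p =>
    ⟨monomialX K m r s p.1 p.2, Submodule.subset_span ⟨p, rfl⟩⟩
  have h1 : Finsupp.linearCombination K (fun p : MultiIndex m r s × MultiIndex m r s =>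
      monomialClass K m r s p.1 p.2) =
      (relPart K m r s).mkQ.comp (Finsupp.linearCombination K v) := by
    ext p
    simp [v, monomialClass]
  have h2 : (freePart K m r s).subtype.comp (Finsupp.linearCombination K v) =
      monomialComb K m r s := by
    ext p
    simp [v, monomialComb]
  rw [← monomialComb_mem_relIdeal_iff, h1, LinearMap.comp_apply, Submodule.mkQ_apply,
    Submodule.Quotient.mk_eq_zero, ← h2]
  rfl

theorem linearCombination_mixedCoeff_eq_zero_iff :
    Finsupp.linearCombination K (fun p : MultiIndex m r s × MultiIndex m r s =>
      (⟨mixedCoeff K m r s p.1 p.2, mixedCoeff_mem_coeffSpace p.1 p.2⟩ : coeffSpace K m r s)) l =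
        0 ↔ coeffComb K m r s l = 0 := by
  have h : (coeffSpace K m r s).subtype.comp (Finsupp.linearCombination K
      (fun p : MultiIndex m r s × MultiIndex m r s =>
        (⟨mixedCoeff K m r s p.1 p.2, mixedCoeff_mem_coeffSpace p.1 p.2⟩ :
          coeffSpace K m r s))) = coeffComb K m r s := by
    ext p
    simp [coeffComb]
  rw [← h, LinearMap.comp_apply, Submodule.subtype_apply, ZeroMemClass.coe_eq_zero]

/-- The transposition automorphism exchanges the two multi-indices of a coefficient function, so
swapping them does not change the linear relations. -/
theorem linearCombination_mixedCoeff_swap_eq_zero_iff :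
    Finsupp.linearCombination K (fun p : MultiIndex m r s × MultiIndex m r s =>
      (⟨mixedCoeff K m r s p.2 p.1, mixedCoeff_mem_coeffSpace p.2 p.1⟩ : coeffSpace K m r s)) l =
        0 ↔ coeffComb K m r s l = 0 := by
  have h : (transposeHom K m).toLinearMap.comp
      ((coeffSpace K m r s).subtype.comp (Finsupp.linearCombination K
      (fun p : MultiIndex m r s × MultiIndex m r s =>
        (⟨mixedCoeff K m r s p.2 p.1, mixedCoeff_mem_coeffSpace p.2 p.1⟩ :
          coeffSpace K m r s)))) = coeffComb K m r s := by
    ext p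
    simp [coeffComb, transposeHom_mixedCoeff]
  have hinj : Function.Injective (transposeHom K m) :=
    Function.LeftInverse.injective transposeHom_transposeHom
  rw [← h, LinearMap.comp_apply, LinearMap.comp_apply, AlgHom.toLinearMap_apply,
    map_eq_zero_iff _ hinj, Submodule.subtype_apply, ZeroMemClass.coe_eq_zero]

/-- An element of the centralizer outside the Schur algebra would be detected by a linear form
vanishing on the latter. But the two subspaces have the same annihilator. -/
theorem rationalSchur_eq_brauerEnd : rationalSchur K m r s = brauerEnd K m r s := by
  refine le_antisymm rationalSchur_le_brauerEnd fun φ hφ => ?_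
  by_contra hS
  let _ : AddCommGroup (Module.End K (MixedTensor K m r s)) :=
    Module.addCommMonoidToAddCommGroup K
  obtain ⟨ψ, hψ, hle⟩ := Submodule.exists_le_ker_of_notMem
    (p := Subalgebra.toSubmodule (rationalSchur K m r s)) (v := φ) hS
  have h1 : ψ ∈ LinearMap.range (coordComb K m r s) := by
    rw [coordComb, Finsupp.range_linearCombination, span_coordFun]
    trivial
  obtain ⟨l, rfl⟩ := h1
  exact hψ (brauerEnd_vanishing_iff.mpr
    (rationalSchur_vanishing_iff.mp fun χ hχ => hle hχ) φ hφ)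

end Kernels

/-! ### The anti-automorphism of the centralizer. -/

section Transpose

variable {K : Type*} [Field K] {m r s : ℕ}

/-- The reflection of a diagram in a horizontal line. -/
def WalledDiagram.flip (σ : WalledDiagram r s) : WalledDiagram r s where
  partner v := (σ.partner v.swap).swap
  partner_partner v := by simp [σ.partner_partner]
  side_partner v := by
    have h : ∀ v : Vertex r s, side v.swap = !side v := by
      rintro ((x | x) | (x | x)) <;> rfl
    rw [h, σ.side_partner, h, Bool.not_not]

theorem WalledDiagram.flip_compat_iff {X : Type*} (σ : WalledDiagram r s) (a b : Pos r s → X) :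
    σ.flip.Compat a b ↔ σ.Compat b a := by
  have h : ∀ v : Vertex r s, (Sum.elim b a : Vertex r s → X) v =
      (Sum.elim a b : Vertex r s → X) v.swap := by
    rintro (x | x) <;> rfl
  constructor
  · intro hc v
    have := hc v.swap
    rwa [h, h v.swap, WalledDiagram.flip, Sum.swap_swap, Sum.swap_swap] at this
  · intro hc v
    rw [h, h v, WalledDiagram.flip, Sum.swap_swap]
    exact hc v.swap

theorem diagMat_flip (σ : WalledDiagram r s) :
    diagMat K m σ.flip = (diagMat K m σ).transpose := by
  classical
  ext I J
  exact if_congr (σ.flip_compat_iff _ _) rfl rfl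

variable (K m r s) in
/-- The transposition of endomorphisms with respect to the standard basis. -/
def endTranspose : Module.End K (MixedTensor K m r s) →ₗ[K] Module.End K (MixedTensor K m r s) :=
  (LinearMap.toMatrixAlgEquiv (mixedBasis K m r s)).symm.toLinearMap ∘ₗ
    (Matrix.transposeLinearEquiv _ _ K K).toLinearMap ∘ₗ
      (LinearMap.toMatrixAlgEquiv (mixedBasis K m r s)).toLinearMap

theorem toMatrix_endTranspose (φ : Module.End K (MixedTensor K m r s)) :
    LinearMap.toMatrixAlgEquiv (mixedBasis K m r s) (endTranspose K m r s φ) =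
      (LinearMap.toMatrixAlgEquiv (mixedBasis K m r s) φ).transpose :=
  AlgEquiv.apply_symm_apply _ _

theorem endTranspose_endTranspose (φ : Module.End K (MixedTensor K m r s)) :
    endTranspose K m r s (endTranspose K m r s φ) = φ := by
  apply (LinearMap.toMatrixAlgEquiv (mixedBasis K m r s)).injective
  rw [toMatrix_endTranspose, toMatrix_endTranspose, Matrix.transpose_transpose]

theorem endTranspose_mul (φ ψ : Module.End K (MixedTensor K m r s)) :
    endTranspose K m r s (φ * ψ) = endTranspose K m r s ψ * endTranspose K m r s φ := by
  apply (LinearMap.toMatrixAlgEquiv (mixedBasis K m r s)).injective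
  rw [toMatrix_endTranspose, map_mul (LinearMap.toMatrixAlgEquiv (mixedBasis K m r s)),
    map_mul (LinearMap.toMatrixAlgEquiv (mixedBasis K m r s)), toMatrix_endTranspose,
    toMatrix_endTranspose, Matrix.transpose_mul]

theorem endTranspose_algebraMap (c : K) :
    endTranspose K m r s (algebraMap K _ c) = algebraMap K _ c := by
  apply (LinearMap.toMatrixAlgEquiv (mixedBasis K m r s)).injective
  rw [toMatrix_endTranspose, AlgEquiv.commutes, Matrix.algebraMap_eq_diagonal,
    Matrix.diagonal_transpose]

/-- The transpose of a diagram matrix belongs to the reflected diagram, so transposing the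
commutation relations gives commutation relations again. -/
theorem endTranspose_mem_brauerEnd {φ : Module.End K (MixedTensor K m r s)}
    (h : φ ∈ brauerEnd K m r s) : endTranspose K m r s φ ∈ brauerEnd K m r s := by
  rw [mem_brauerEnd_iff] at h ⊢
  intro σ
  have h1 := congrArg Matrix.transpose (h σ.flip)
  rw [Matrix.transpose_mul, Matrix.transpose_mul, diagMat_flip, Matrix.transpose_transpose] at h1
  rw [toMatrix_endTranspose, h1]

variable (K m r s) in
/-- The centralizer is isomorphic to its opposite algebra. -/
def brauerEndEquivOp : brauerEnd K m r s ≃ₐ[K] (brauerEnd K m r s)ᵐᵒᵖ where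
  toFun φ := MulOpposite.op ⟨endTranspose K m r s φ, endTranspose_mem_brauerEnd φ.2⟩
  invFun x := ⟨endTranspose K m r s x.unop, endTranspose_mem_brauerEnd x.unop.2⟩
  left_inv φ := Subtype.ext (endTranspose_endTranspose φ.1)
  right_inv x := MulOpposite.unop_injective (Subtype.ext (endTranspose_endTranspose x.unop.1))
  map_mul' φ ψ := MulOpposite.unop_injective (Subtype.ext (endTranspose_mul φ.1 ψ.1))
  map_add' φ ψ := MulOpposite.unop_injective (Subtype.ext (map_add (endTranspose K m r s) φ.1 ψ.1))
  commutes' c := MulOpposite.unop_injective (Subtype.ext (endTranspose_algebraMap c))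

end Transpose

end

end MixedSchurWeyl


theorem mainTheorem2 (K : Type*) [Field K] [Infinite K] (m r s : ℕ) :
    MixedSchurWeyl.rationalSchur K m r s = MixedSchurWeyl.brauerEnd K m r s ∧
    Nonempty (MixedSchurWeyl.rationalSchur K m r s ≃ₐ[K]
      (MixedSchurWeyl.brauerEnd K m r s)ᵐᵒᵖ) ∧
    (∃ e : Module.Dual K (MixedSchurWeyl.brauerEnd K m r s)ᵐᵒᵖ ≃ₗ[K]
        (MixedSchurWeyl.freePart K m r s ⧸ MixedSchurWeyl.relPart K m r s),
      ∀ I J : MixedSchurWeyl.MultiIndex m r s,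
        e (((MixedSchurWeyl.coordFun K m r s I J).comp
              (MixedSchurWeyl.brauerEnd K m r s).val.toLinearMap).comp
              (MulOpposite.opLinearEquiv K).symm.toLinearMap) =
          MixedSchurWeyl.monomialClass K m r s I J) ∧
    (∃ e : (MixedSchurWeyl.freePart K m r s ⧸ MixedSchurWeyl.relPart K m r s) ≃ₗ[K]
        MixedSchurWeyl.coeffSpace K m r s,
      ∀ I J : MixedSchurWeyl.MultiIndex m r s,
        (e (MixedSchurWeyl.monomialClass K m r s I J) : MixedSchurWeyl.GLCoord K m) =
          (∏ a, MixedSchurWeyl.cMat K m (J.1 a) (I.1 a)) *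
            ∏ b, MixedSchurWeyl.dMat K m (I.2 b) (J.2 b)) ∧
    (∃ e : Module.Dual K (MixedSchurWeyl.rationalSchur K m r s) ≃ₗ[K]
        MixedSchurWeyl.coeffSpace K m r s,
      ∀ I J : MixedSchurWeyl.MultiIndex m r s,
        (e ((MixedSchurWeyl.coordFun K m r s I J).comp
            (MixedSchurWeyl.rationalSchur K m r s).val.toLinearMap) :
              MixedSchurWeyl.GLCoord K m) =
          (∏ a, MixedSchurWeyl.cMat K m (I.1 a) (J.1 a)) *
            ∏ b, MixedSchurWeyl.dMat K m (J.2 b) (I.2 b)) := by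
  have hSE := MixedSchurWeyl.rationalSchur_eq_brauerEnd (K := K) (m := m) (r := r) (s := s)
  refine ⟨hSE, ⟨(Subalgebra.equivOfEq _ _ hSE).trans
    (MixedSchurWeyl.brauerEndEquivOp K m r s)⟩, ?_, ?_, ?_⟩
  · obtain ⟨e, he⟩ := MixedSchurWeyl.exists_linearEquiv_of_span
      (MixedSchurWeyl.span_coordFun_restrict (MixedSchurWeyl.brauerEnd K m r s))
      MixedSchurWeyl.span_monomialClass fun l => by
        rw [MixedSchurWeyl.linearCombination_restrict_eq_zero_iff,
          MixedSchurWeyl.brauerEnd_vanishing_iff,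
          MixedSchurWeyl.linearCombination_monomialClass_eq_zero_iff]
    -- As a vector space the opposite algebra is the centralizer itself, so its dual is identified
    -- with the dual of the latter.
    refine ⟨(MulOpposite.opLinearEquiv K).dualMap.trans e, fun I J => ?_⟩
    exact he (I, J)
  · obtain ⟨e, he⟩ := MixedSchurWeyl.exists_linearEquiv_of_span
      (MixedSchurWeyl.span_monomialClass (K := K) (m := m) (r := r) (s := s))
      MixedSchurWeyl.span_mixedCoeff_swap fun l => by
        rw [MixedSchurWeyl.linearCombination_monomialClass_eq_zero_iff,
          MixedSchurWeyl.linearCombination_mixedCoeff_swap_eq_zero_iff]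
    exact ⟨e, fun I J => congrArg Subtype.val (he (I, J))⟩
  · obtain ⟨e, he⟩ := MixedSchurWeyl.exists_linearEquiv_of_span
      (MixedSchurWeyl.span_coordFun_restrict (MixedSchurWeyl.rationalSchur K m r s))
      MixedSchurWeyl.span_mixedCoeff fun l => by
        rw [MixedSchurWeyl.linearCombination_restrict_eq_zero_iff,
          MixedSchurWeyl.rationalSchur_vanishing_iff,
          MixedSchurWeyl.linearCombination_mixedCoeff_eq_zero_iff]
    exact ⟨e, fun I J => congrArg Subtype.val (he (I, J))⟩
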